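/- Let $0<D\le\infty$, let $1<p\le q<\infty$, and let $\mu,\nu$ be Borel measures on $(0,D)$, $\nu$ being $\sigma$-finite. Write $p^*=p/(p-1)$. Let $v$ be the density of the absolutely continuous part of $\nu$ with respect to Lebesgue measure, $\hat v=v^{-1/(p-1)}$ (with $0^{-1/(p-1)}=\infty$), and $\varphi(x)=\hat\nu(0,x)=\int_0^x\hat v(y)\,dy$. Assume $\varphi(x)<\infty$ for every $x\in(0,D)$. All quantities below take values in $[0,\infty]$ with $0\cdot\infty=0$; $\int_y^D$ means integration over $(y,D)$, and $\int_a^b$ with $b<D$ integration over $(a,b]$. Norms are $\|f\|_{\mu,q}=(\int_0^D|f|^q\,d\mu)^{1/q}$, $\|g\|_{\nu,p}=(\int_0^D|g|^p\,d\nu)^{1/p}$ and $\|g\|_{v,p}=(\int_0^D |g|^p v\,dx)^{1/p}$. Let $A$ be the optimal constant in $\|f\|_{\mu,q}\le A\|f'\|_{\nu,p}$ over all functions $f$ with $f(0)=0$ that are absolutely continuous on $[0,D]$ (if $D=\infty$: on each compact subinterval of $[0,\infty)$), with $A=\infty$ if there is no finite constant. Put $$B=\sup_{x\in(0,D)}\varphi(x)^{1/p^*}\mu(x,D)^{1/q},\qquad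 \gamma^*=\frac{q}{p^*+q},\qquad \tilde k_{q,p}=\Big(1+\frac q{p^*}\Big)^{1/q}\Big(1+\frac{p^*}q\Big)^{1/p^*},$$ $$k_{q,p}=\left[\frac{\Gamma\big(\frac{pq}{q-p}\big)}{\Gamma\big(\frac{q}{q-p}\big)\Gamma\big(\frac{p(q-1)}{q-p}\big)}\right]^{1/p-1/q}\ (q>p),\qquad k_{p,p}=p^{1/p}(p^*)^{1/p^*}.$$ Define $\delta_1=\big(\sup_{x\in(0,D)}f_2(x)/f_1(x)\big)^{1/p^*}$ with $f_1=\varphi^{\gamma^*}$ and $f_2(x)=\int_0^x\hat v(y)\big(\int_y^D f_1^{q/p^*}d\mu\big)^{p^*/q}dy$. For $x_0\in(0,D]$ put $f_1^{(x_0)}(x)=\varphi(x\wedge x_0)$ and $$f_2^{(x_0)}(x)=\int_0^{x\wedge x_0}\hat v(y)\Big(\int_y^D (f_1^{(x_0)})^{q-1}d\mu\Big)^{p^*-1}dy .$$ Define $$\bar\delta_1=\sup_{x_0\in(0,D]}\frac{\|f_1^{(x_0)}\|_{\mu,q}}{\|(f_1^{(x_0)})'\|_{v,p}},\qquad \tilde\delta_1=\sup_{x_0}\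 \|f_2^{(x_0)}\|_{\mu,q}^{1-q/p}\Big(\inf_{x\in(0,D)}\frac{f_2^{(x_0)}(x)}{f_1^{(x_0)}(x)}\Big)^{(q-1)/p},$$ where a quotient with infinite denominator counts as $0$ in $\bar\delta_1$ (it can be infinite only for $x_0=D$), and the supremum in $\tilde\delta_1$ is over $x_0\in(0,D]$, the value $x_0=D$ being admitted only if $f_2^{(D)}\in L^q(\mu)$. Then $$B\le\bar\delta_1\vee\tilde\delta_1\le A\le\delta_1\wedge(k_{q,p}B)\le\delta_1\le\tilde k_{q,p}B,\qquad k_{q,p}\le\tilde k_{q,p}.$$ More precisely, $$\delta_1=\Big\{\sup_{x\in(0,D)}\frac1{\varphi(x)^{\gamma^*}}\int_0^x\hat v(y)\Big(\int_y^D\varphi^{q\gamma^*/p^*}d\mu\Big)^{p^*/q}dy\Big\}^{1/p^*}\le\tilde k_{q,p}B,$$ $$\bar\delta_1=\Big\{\sup_{x\in(0,D)}\Big[\frac1{\varphi(x)^{q/p}}\int_0^x\varphi^q\,d\mu+\varphi(x)^{q/p^*}\mu(x,D)\Big]\Big\}^{1/q}\ge B,$$ $$\tilde\delta_1=\sup_{x_0\in(0,D)}\big\|f_2^{(x_0)}\big\|_{\mu,q}^{1-q/p}\Big[\frac{f_2^{(x_0)}(x_0)}{\varphi(x_0)}\Big]^{(q-1)/p},$$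 where, for $x_0\in(0,D)$ and $x\in(0,D)$, $$f_2^{(x_0)}(x)=\int_0^{x\wedge x_0}\hat v(y)\Big[\int_y^{x_0}\varphi^{q-1}d\mu+\varphi(x_0)^{q-1}\mu(x_0,D)\Big]^{p^*-1}dy .$$ -/

import Mathlib

open MeasureTheory Set
open scoped ENNReal

namespace HardyType

noncomputable section

/-- The open interval `(a, b)` of real numbers, with possibly infinite end points. -/
def openInt (a b : EReal) : Set ℝ := {x : ℝ | a < (x : EReal) ∧ (x : EReal) < b}

/-- `x ∧ x₀` for a real `x` and `x₀ ∈ (0, ∞]`. -/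
def cut (x₀ : EReal) (x : ℝ) : ℝ := (min (x : EReal) x₀).toReal

/-- `f` is absolutely continuous on `[0, D]` if `D < ∞`, and on every compact interval `[0, T]`
of `[0, ∞)` if `D = ∞`. -/
def IsAC (D : EReal) (f : ℝ → ℝ) : Prop :=
  ∀ T : ℝ, 0 ≤ T → (T : EReal) ≤ D → AbsolutelyContinuousOnInterval f 0 T

/-- The norm of `L^r(m)` on the interval `(0, D)`. -/
def lrNorm {E : Type*} [ENorm E] (D : EReal) (m : Measure ℝ) (r : ℝ) (f : ℝ → E) : ℝ≥0∞ :=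
  eLpNorm f (ENNReal.ofReal r) (m.restrict (openInt 0 D))

/-- The optimal constant `A ∈ [0, ∞]` of the Hardy-type inequality
`‖f‖_{μ, q} ≤ A ‖f'‖_{ν, p}` for all absolutely continuous `f` with `f 0 = 0`;
it is `∞` if the inequality holds with no finite constant. Here `deriv f` is the derivative wherever
it exists (Lebesgue almost everywhere) and `0` elsewhere; since any Lebesgue null set can be covered
by open sets of small measure on which `f` is made locally constant, a singular part of `ν` does not
change the value of the constant. -/
def optConst (p q : ℝ) (D : EReal) (μ ν : Measure ℝ) : ℝ≥0∞ :=
  sInf {C : ℝ≥0∞ | ∀ f : ℝ → ℝ, IsAC D f → f 0 = 0 →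
    lrNorm D μ q f ≤ C * lrNorm D ν p (deriv f)}

/-- The density `v` of the absolutely continuous part of `ν` with respect to Lebesgue measure. -/
def dens (ν : Measure ℝ) : ℝ → ℝ≥0∞ := ν.rnDeriv volume

/-- `v̂ = v ^ (-1 / (p - 1))`. -/
def vhat (p : ℝ) (ν : Measure ℝ) (x : ℝ) : ℝ≥0∞ := dens ν x ^ (-(1 / (p - 1)))

/-- `φ(x) = ν̂(0, x) = ∫_0^x v̂`. -/
def phi (p : ℝ) (ν : Measure ℝ) (x : ℝ) : ℝ≥0∞ := ∫⁻ y in Ioc 0 x, vhat p ν y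

/-- The conjugate exponent `p* = p / (p - 1)`. -/
abbrev pStar (p : ℝ) : ℝ := p.conjExponent

/-- `B = sup_{x ∈ (0, D)} ν̂(0, x)^{1/p*} μ(x, D)^{1/q}`. -/
def constB (p q : ℝ) (D : EReal) (μ ν : Measure ℝ) : ℝ≥0∞ :=
  ⨆ x ∈ openInt 0 D, phi p ν x ^ (1 / pStar p) * μ (openInt (x : EReal) D) ^ (1 / q)

/-- The factor `k_{q,p}` of the basic estimates. -/
def kConst (q p : ℝ) : ℝ :=
  if p < q then
    (Real.Gamma (p * q / (q - p)) /
      (Real.Gamma (q / (q - p)) * Real.Gamma (p * (q - 1) / (q - p)))) ^ (1 / p - 1 / q)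
  else p ^ (1 / p) * pStar p ^ (1 / pStar p)

/-- The factor `k̃_{q,p} = (1 + q/p*)^{1/q} (1 + p*/q)^{1/p*}`. -/
def kTilde (q p : ℝ) : ℝ :=
  (1 + q / pStar p) ^ (1 / q) * (1 + pStar p / q) ^ (1 / pStar p)

/-- `γ* = q / (p* + q)`. -/
def gammaStar (q p : ℝ) : ℝ := q / (pStar p + q)

/-- The operator
`II*(f)(x) = f(x)⁻¹ ∫_0^x v̂(y) (∫_{(y, D)} f^{q/p*} dμ)^{p*/q} dy`. -/
def opIIStar (p q : ℝ) (D : EReal) (μ ν : Measure ℝ) (f : ℝ → ℝ≥0∞) (x : ℝ) : ℝ≥0∞ :=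
  (∫⁻ y in Ioc 0 x, vhat p ν y *
    (∫⁻ z in openInt (y : EReal) D, f z ^ (q / pStar p) ∂μ) ^ (pStar p / q)) / f x

/-- `δ_1 = (sup_{x ∈ (0, D)} f_2(x) / f_1(x))^{1/p*}`, where `f_1 = φ^{γ*}` and
`f_2 = f_1 II*(f_1)`. -/
def delta (p q : ℝ) (D : EReal) (μ ν : Measure ℝ) : ℝ≥0∞ :=
  (⨆ x ∈ openInt 0 D,
    opIIStar p q D μ ν (fun z => phi p ν z ^ gammaStar q p) x) ^ (1 / pStar p)

/-- The operator
`II(f)(x) = f(x)⁻¹ ∫_0^x v̂(y) (∫_{(y, D)} f^{q-1} dμ)^{p*-1} dy`, modified for functions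
`f = f(· ∧ x₀)` by stopping the outer integral at `x ∧ x₀`. For `x₀ = D` it is `II` itself on
`(0, D)`. -/
def opIITilde (p q : ℝ) (D : EReal) (μ ν : Measure ℝ) (x₀ : EReal) (f : ℝ → ℝ≥0∞) (x : ℝ) :
    ℝ≥0∞ :=
  (∫⁻ y in Ioc 0 (cut x₀ x), vhat p ν y *
    (∫⁻ z in openInt (y : EReal) D, f z ^ (q - 1) ∂μ) ^ (pStar p - 1)) / f x

/-- The domain of the modified operator, for a given `x₀ ∈ (0, D]`: `f 0 = 0`, `0 < f < ∞` on
`(0, D)`, `f = f(· ∧ x₀)`, and `f II(f) ∈ L^q(μ)` in case `x₀ = D`. -/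
def domTilde (p q : ℝ) (D : EReal) (μ ν : Measure ℝ) (x₀ : EReal) : Set (ℝ → ℝ≥0∞) :=
  {f | f 0 = 0 ∧ (∀ x ∈ openInt 0 D, 0 < f x ∧ f x < ∞) ∧
    (∀ x ∈ openInt 0 D, f x = f (cut x₀ x)) ∧
    (x₀ = D → lrNorm D μ q (fun x => f x * opIITilde p q D μ ν x₀ f x) < ∞)}

/-- The test function `f_1^{(x₀)}(x) = ν̂(0, x ∧ x₀)`. -/
def testFun (p : ℝ) (ν : Measure ℝ) (x₀ : EReal) (x : ℝ) : ℝ≥0∞ := phi p ν (cut x₀ x)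

/-- `δ̃_1`: the supremum, over those `x₀ ∈ (0, D]` for which `f = f_1^{(x₀)}` is in the domain, of
`‖f II~(f)‖_{μ, q}^{1 - q/p} (inf_{x ∈ (0, D)} II~(f)(x))^{(q-1)/p}`. -/
def deltaTilde (p q : ℝ) (D : EReal) (μ ν : Measure ℝ) : ℝ≥0∞ :=
  ⨆ (x₀ : EReal) (_ : 0 < x₀ ∧ x₀ ≤ D) (_ : testFun p ν x₀ ∈ domTilde p q D μ ν x₀),
    lrNorm D μ q (fun x => testFun p ν x₀ x * opIITilde p q D μ ν x₀ (testFun p ν x₀) x)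
        ^ (1 - q / p) *
      (⨅ x ∈ openInt 0 D, opIITilde p q D μ ν x₀ (testFun p ν x₀) x) ^ ((q - 1) / p)

/-- `δ̄_1 = sup_{x₀ ∈ (0, D]} ‖f_1^{(x₀)}‖_{μ, q} / ‖(f_1^{(x₀)})'‖_{v, p}`, with the norm of
`L^p(v(x) dx)` in the denominator. A quotient with infinite denominator (possible
only for `x₀ = D`) does not contribute. -/
def deltaBar (p q : ℝ) (D : EReal) (μ ν : Measure ℝ) : ℝ≥0∞ :=
  ⨆ (x₀ : EReal) (_ : 0 < x₀ ∧ x₀ ≤ D),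
    lrNorm D μ q (testFun p ν x₀) /
      lrNorm D (volume.withDensity (dens ν)) p (deriv (fun x => (testFun p ν x₀ x).toReal))

/-- The explicit function
`x ↦ ∫_0^{x ∧ x₀} v̂(y) (∫_{(y, x₀]} φ^{q-1} dμ + φ(x₀)^{q-1} μ(x₀, D))^{p*-1} dy`. -/
def f2 (p q : ℝ) (D : EReal) (μ ν : Measure ℝ) (x₀ x : ℝ) : ℝ≥0∞ :=
  ∫⁻ y in Ioc 0 (min x x₀), vhat p ν y *
    ((∫⁻ z in Ioc y x₀, phi p ν z ^ (q - 1) ∂μ) +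
      phi p ν x₀ ^ (q - 1) * μ (openInt (x₀ : EReal) D)) ^ (pStar p - 1)

end

end HardyType

/-! Everything is reduced to primitives `prim g` of nonnegative functions. One direction is |f| ≤ ∫
|f'| (`optConst_le`). In the other, a singular part of `ν` is made harmless by keeping the test
function locally constant near a null set carrying it (`le_optConst_mul`). Hence only the density
`v` matters.

Upper bound by `delta` (`hardy_le_delta`). Put K(y) = (∫_y^D f₁^{q/p*} dμ)^{p*/q} and apply Hölder's
inequality to g = (g v^{1/p} K^{-1/p*}) · (v̂^{1/p*} K^{1/p*}). The second factor produces ∫_0^x v̂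
K ≤ δ₁^{p*} f₁(x). Minkowski's inequality with exponent q/p then brings the tail integral of
f₁^{q/p*} inside; it is a power of K, and it cancels the weight K^{-p/p*} carried by the first
factor.

Upper bounds by B. Finiteness of B says that the image of `μ` under φ has tails at most B^q
t^{-q/p*}. Integrals of increasing functions of φ are therefore dominated by integrals against the
density with exactly these tails (`lintegral_comp_phi_le`). For powers of φ this is an explicit
computation and gives k̃ B as a bound for `delta`. For p < q, the substitution t = φ(x)
(`exists_change_of_variable`) turns the weighted problem into an unweighted one on (0, ∞), and the
same comparison leaves Bliss' inequality (`bliss`) with its sharp constant. That inequality is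
proved by monotone transport of F^q t^{-s} onto the extremal density, a pointwise
arithmetic-geometric mean inequality, an integration by parts and Hölder's inequality. For p = q the
two constants k and k̃ agree, so the bound through `delta` suffices. The inequality k ≤ k̃ is the
entropy bound for a generalized binomial coefficient (`Gamma_div_le`).

Lower bounds come from test functions. The function φ(· ∧ x₀) gives `deltaBar`, and one of the two
terms in its explicit form is already B. For `deltaTilde` the test function is f₂ itself: by
Tonelli's theorem ∫ (f₂')^p v is at most ∫ f₁^{q-1} f₂ dμ, hence at most m^{1-q} ∫ f₂^q dμ when m =
inf f₂/f₁ is positive (`rpow_mul_rpow_le_optConst`). The infimum sits at x₀ because f₂/φ is an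
average of a decreasing function with respect to v̂. In both suprema the end point x₀ = D adds
nothing beyond the values x₀ < D. -/

namespace HardyType

/-! ### Primitives of nonnegative functions and the substitution u = ∫_0^y g -/

/-- The primitive `x ↦ ∫_{(0, x]} g`. -/
noncomputable def prim (g : ℝ → ℝ≥0∞) (x : ℝ) : ℝ≥0∞ := ∫⁻ y in Ioc 0 x, g y

theorem prim_mono (g : ℝ → ℝ≥0∞) : Monotone (prim g) := fun _ _ h =>
  lintegral_mono_set (Ioc_subset_Ioc_right h)

theorem prim_of_nonpos (g : ℝ → ℝ≥0∞) {x : ℝ} (hx : x ≤ 0) : prim g x = 0 := by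
  simp [prim, Ioc_eq_empty (not_lt.2 hx)]

theorem measurable_prim (g : ℝ → ℝ≥0∞) : Measurable (prim g) := (prim_mono g).measurable

theorem prim_ne_top_of_le {g : ℝ → ℝ≥0∞} {x T : ℝ} (h : prim g T ≠ ∞) (hx : x ≤ T) :
    prim g x ≠ ∞ := ne_top_of_le_ne_top h (prim_mono g hx)

/-- The density truncated to `(0, T]`, as an integrable real function. -/
theorem integrable_indicator_toReal {g : ℝ → ℝ≥0∞} (hg : Measurable g) {T : ℝ}
    (hT : prim g T ≠ ∞) : Integrable ((Ioc 0 T).indicator fun y => (g y).toReal) := by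
  rw [integrable_indicator_iff measurableSet_Ioc]
  exact integrable_toReal_of_lintegral_ne_top hg.aemeasurable hT

theorem prim_toReal_eq {g : ℝ → ℝ≥0∞} (hg : Measurable g) {x T : ℝ} (hT : prim g T ≠ ∞)
    (hx : x ≤ T) :
    (prim g x).toReal = ∫ y in (0 : ℝ)..x, (Ioc 0 T).indicator (fun y => (g y).toReal) y := by
  rcases le_or_gt 0 x with h0 | h0
  · rw [intervalIntegral.integral_of_le h0]
    have hae : ∀ᵐ y ∂(volume.restrict (Ioc 0 x)), g y < ∞ :=
      ae_lt_top hg (prim_ne_top_of_le hT hx)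
    rw [prim, ← integral_toReal hg.aemeasurable hae]
    refine setIntegral_congr_fun measurableSet_Ioc fun y hy => ?_
    rw [indicator_of_mem (show y ∈ Ioc 0 T from ⟨hy.1, hy.2.trans hx⟩)]
  · rw [prim_of_nonpos g h0.le, intervalIntegral.integral_of_ge h0.le, ENNReal.toReal_zero]
    rw [setIntegral_eq_zero_of_forall_eq_zero, neg_zero]
    intro y hy
    rw [indicator_of_notMem (fun h => absurd hy.2 (not_le.2 h.1))]

theorem continuousOn_prim_toReal {g : ℝ → ℝ≥0∞} (hg : Measurable g) {T : ℝ}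
    (hT : prim g T ≠ ∞) : ContinuousOn (fun x => (prim g x).toReal) (Iic T) := by
  have hi := integrable_indicator_toReal hg hT
  exact ((intervalIntegral.continuous_primitive (fun a b => hi.intervalIntegrable) 0).continuousOn
    (s := Iic T)).congr fun x hx => prim_toReal_eq hg hT hx

theorem monotoneOn_prim_toReal {g : ℝ → ℝ≥0∞} {T : ℝ}
    (hT : prim g T ≠ ∞) : MonotoneOn (fun x => (prim g x).toReal) (Iic T) := fun _ _ _ hy h =>
  ENNReal.toReal_mono (prim_ne_top_of_le hT hy) (prim_mono g h)

/-- Since `g` may vanish, the primitive need not be injective, so the substitution is proved as an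
identity of finite measures on the rays `Iic l`. The preimage of such a ray in (0, T] is an interval
ending at the last point where the primitive is at most `l`, and the intermediate value theorem
gives the value of the primitive there. -/
theorem map_prim {g : ℝ → ℝ≥0∞} (hg : Measurable g) {T : ℝ} (hT : prim g T ≠ ∞) :
    Measure.map (fun x => (prim g x).toReal) ((volume.withDensity g).restrict (Ioc 0 T)) =
      volume.restrict (Ioc 0 (prim g T).toReal) := by
  have hmeas : Measurable fun x => (prim g x).toReal := (measurable_prim g).ennreal_toReal
  have hfin : IsFiniteMeasure ((volume.withDensity g).restrict (Ioc 0 T)) := by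
    constructor
    rw [Measure.restrict_apply_univ, withDensity_apply _ measurableSet_Ioc]
    exact hT.lt_top
  refine Measure.ext_of_Iic _ _ fun l => ?_
  rw [Measure.map_apply hmeas measurableSet_Iic, Measure.restrict_apply (hmeas measurableSet_Iic),
    Measure.restrict_apply measurableSet_Iic]
  rcases lt_or_ge l 0 with hl | hl
  · have h1 : (fun x => (prim g x).toReal) ⁻¹' Iic l = ∅ := by
      ext x; simpa using hl.trans_le ENNReal.toReal_nonneg
    have h2 : Iic l ∩ Ioc 0 (prim g T).toReal = ∅ := by
      ext x; simp only [mem_inter_iff, mem_Iic, mem_Ioc, mem_empty_iff_false, iff_false]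
      intro h; linarith [h.1, h.2.1]
    simp [h1, h2]
  rcases lt_or_ge T 0 with hT0 | hT0
  · simp [Ioc_eq_empty (not_lt.2 hT0.le), prim_of_nonpos g hT0.le]
  have hsub : Icc 0 T ⊆ Iic T := fun x hx => hx.2
  set S := {y | y ∈ Icc 0 T ∧ (prim g y).toReal ≤ l} with hS
  have hScl : IsClosed S :=
    ((continuousOn_prim_toReal hg hT).mono hsub).preimage_isClosed_of_isClosed isClosed_Icc
      isClosed_Iic
  have hSne : S.Nonempty := ⟨0, ⟨le_rfl, hT0⟩, by simpa [prim_of_nonpos g le_rfl] using hl⟩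
  have hSbd : BddAbove S := ⟨T, fun y hy => hy.1.2⟩
  have hy0 := hScl.csSup_mem hSne hSbd
  set y0 := sSup S
  have hset : (fun x => (prim g x).toReal) ⁻¹' Iic l ∩ Ioc 0 T = Ioc 0 y0 := by
    ext y
    simp only [mem_inter_iff, mem_preimage, mem_Iic, mem_Ioc]
    constructor
    · rintro ⟨h1, h2, h3⟩
      exact ⟨h2, le_csSup hSbd ⟨⟨h2.le, h3⟩, h1⟩⟩
    · rintro ⟨h1, h2⟩
      exact ⟨(monotoneOn_prim_toReal hT (h2.trans hy0.1.2) hy0.1.2 h2).trans hy0.2, h1,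
        h2.trans hy0.1.2⟩
  have hval : (prim g y0).toReal = min l (prim g T).toReal := by
    apply le_antisymm
    · exact le_min hy0.2 (monotoneOn_prim_toReal hT hy0.1.2 (mem_Iic.2 le_rfl) hy0.1.2)
    · have hivt := intermediate_value_Icc hT0 ((continuousOn_prim_toReal hg hT).mono hsub)
      obtain ⟨z, hz, hzl⟩ := hivt (show min l (prim g T).toReal ∈ _ by
        simp only [prim_of_nonpos g le_rfl, ENNReal.toReal_zero, mem_Icc]
        exact ⟨le_min hl ENNReal.toReal_nonneg, min_le_right _ _⟩)
      have hzS : z ∈ S := ⟨hz, by simp only at hzl; rw [hzl]; exact min_le_left _ _⟩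
      rw [← hzl]
      exact monotoneOn_prim_toReal hT hz.2 hy0.1.2 (le_csSup hSbd hzS)
  have hset2 : Iic l ∩ Ioc 0 (prim g T).toReal = Ioc 0 (min l (prim g T).toReal) := by
    ext y; simp only [mem_inter_iff, mem_Iic, mem_Ioc, le_min_iff]; tauto
  rw [hset, hset2, withDensity_apply _ measurableSet_Ioc, Real.volume_Ioc, ← hval, sub_zero,
    ENNReal.ofReal_toReal (prim_ne_top_of_le hT hy0.1.2)]
  rfl

/-- Substitution `u = ∫_0^y g`. -/
theorem lintegral_comp_prim {g : ℝ → ℝ≥0∞} (hg : Measurable g) {T : ℝ} (hT : prim g T ≠ ∞)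
    {h : ℝ → ℝ≥0∞} (hh : Measurable h) :
    ∫⁻ y in Ioc 0 T, g y * h (prim g y).toReal = ∫⁻ u in Ioc 0 (prim g T).toReal, h u := by
  have hmeas : Measurable fun x => (prim g x).toReal := (measurable_prim g).ennreal_toReal
  rw [← map_prim hg hT, lintegral_map hh hmeas, restrict_withDensity measurableSet_Ioc,
    lintegral_withDensity_eq_lintegral_mul _ hg (g := fun y => h (prim g y).toReal)
      (hh.comp hmeas)]
  rfl

theorem lintegral_rpow_Ioc {b : ℝ} (hb : 0 < b) {L : ℝ} (hL : 0 ≤ L) :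
    ∫⁻ u in Ioc 0 L, ENNReal.ofReal (u ^ (b - 1)) = ENNReal.ofReal (L ^ b / b) := by
  rw [← ofReal_integral_eq_lintegral_ofReal]
  · rw [← intervalIntegral.integral_of_le hL, integral_rpow (Or.inl (by linarith))]
    simp [Real.zero_rpow hb.ne']
  · rw [← IntegrableOn, ← intervalIntegrable_iff_integrableOn_Ioc_of_le hL]
    exact intervalIntegral.intervalIntegrable_rpow' (by linarith)
  · exact ae_restrict_of_forall_mem measurableSet_Ioc fun u hu => Real.rpow_nonneg hu.1.le _

/-- Chain rule for powers of a primitive. -/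
theorem lintegral_prim_rpow {g : ℝ → ℝ≥0∞} (hg : Measurable g) {T : ℝ} (hT : prim g T ≠ ∞)
    {b : ℝ} (hb : 0 < b) :
    ∫⁻ y in Ioc 0 T, g y * ENNReal.ofReal ((prim g y).toReal ^ (b - 1)) =
      ENNReal.ofReal ((prim g T).toReal ^ b / b) := by
  rw [lintegral_comp_prim hg hT (h := fun u => ENNReal.ofReal (u ^ (b - 1))) (by fun_prop),
    lintegral_rpow_Ioc hb ENNReal.toReal_nonneg]

/-! ### Minkowski's integral inequality -/

/-- **Minkowski's integral inequality**. -/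
theorem lintegral_rpow_lintegral_le {α β : Type*} [MeasurableSpace α] [MeasurableSpace β]
    {μ : Measure α} {ν : Measure β} [SigmaFinite μ] [SFinite ν] {f : α → β → ℝ≥0∞}
    (hf : Measurable (Function.uncurry f)) {r : ℝ} (hr : 1 ≤ r) :
    (∫⁻ x, (∫⁻ y, f x y ∂ν) ^ r ∂μ) ^ (1 / r) ≤ ∫⁻ y, (∫⁻ x, f x y ^ r ∂μ) ^ (1 / r) ∂ν := by
  have hr0 : 0 < r := by linarith
  rcases hr.eq_or_lt with rfl | hr1
  · simp only [ENNReal.rpow_one, div_one]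
    rw [lintegral_lintegral_swap hf.aemeasurable]
  set R := ∫⁻ y, (∫⁻ x, f x y ^ r ∂μ) ^ (1 / r) ∂ν with hR
  set F : α → ℝ≥0∞ := fun x => ∫⁻ y, f x y ∂ν with hF
  have hFm : Measurable F := hf.lintegral_prod_right
  -- the truncations
  let H : ℕ → α → ℝ≥0∞ := fun n =>
    (spanningSets μ n).indicator fun x => min (F x) n
  have hHm : ∀ n, Measurable (H n) := fun n =>
    (hFm.min measurable_const).indicator (measurableSet_spanningSets μ n)
  have hHF : ∀ n x, H n x ≤ F x := fun n x => by
    by_cases hx : x ∈ spanningSets μ n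
    · simp [H, hx]
    · simp [H, hx]
  have hHmono : Monotone H := by
    intro m n hmn x
    by_cases hx : x ∈ spanningSets μ m
    · have hx' := monotone_spanningSets μ hmn hx
      simp only [H, hx, hx', indicator_of_mem]
      exact min_le_min le_rfl (by exact_mod_cast hmn)
    · simp [H, hx]
  have hHsup : ∀ x, ⨆ n, H n x = F x := by
    intro x
    refine le_antisymm (iSup_le fun n => hHF n x) ?_
    refine le_of_forall_lt fun c hc => ?_
    obtain ⟨k, hk⟩ := mem_iUnion.1 ((iUnion_spanningSets μ).symm ▸ mem_univ x : x ∈ ⋃ i, _)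
    obtain ⟨n, hn⟩ := ENNReal.exists_nat_gt (ne_top_of_lt hc)
    refine lt_of_lt_of_le ?_ (le_iSup _ (max n k))
    have hx := monotone_spanningSets μ (le_max_right n k) hk
    simp only [H, hx, indicator_of_mem]
    refine lt_min hc (hn.trans_le ?_)
    exact_mod_cast le_max_left n k
  -- Truncation in height and to sets of finite measure makes these integrals finite, which allows
  -- the division by a power of `J` below.
  have hfin : ∀ n, ∫⁻ x, H n x ^ r ∂μ ≠ ∞ := by
    intro n
    have : ∫⁻ x, H n x ^ r ∂μ ≤ ∫⁻ x, (spanningSets μ n).indicator (fun _ => (n : ℝ≥0∞) ^ r) x ∂μ := by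
      refine lintegral_mono fun x => ?_
      by_cases hx : x ∈ spanningSets μ n
      · simp only [H, hx, indicator_of_mem]
        exact ENNReal.rpow_le_rpow (min_le_right _ _) hr0.le
      · simp [H, hx, hr0]
    refine ne_top_of_le_ne_top ?_ this
    rw [lintegral_indicator_const (measurableSet_spanningSets μ n)]
    exact ENNReal.mul_ne_top (ENNReal.rpow_ne_top_of_nonneg hr0.le (ENNReal.natCast_ne_top n))
      (measure_spanningSets_lt_top μ n).ne
  have hconj : r.HolderConjugate r.conjExponent := Real.HolderConjugate.conjExponent hr1
  have key : ∀ n, (∫⁻ x, H n x ^ r ∂μ) ^ (1 / r) ≤ R := by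
    intro n
    have h1 : ∫⁻ x, H n x ^ r ∂μ ≤ ∫⁻ y, ∫⁻ x, f x y * H n x ^ (r - 1) ∂μ ∂ν := by
      rw [← lintegral_lintegral_swap]
      · refine lintegral_mono fun x => ?_
        rw [lintegral_mul_const _ (hf.of_uncurry_left)]
        by_cases h0 : H n x = 0
        · simp [h0, hr0]
        by_cases ht : H n x = ∞
        · have : F x = ∞ := top_le_iff.1 (ht ▸ hHF n x)
          simp only [hF] at this
          rw [this, ht]
          rw [ENNReal.top_rpow_of_pos (by linarith : 0 < r - 1)]
          simp
        calc H n x ^ r = H n x * H n x ^ (r - 1) := by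
              rw [ENNReal.rpow_sub _ _ h0 ht, ENNReal.rpow_one, ENNReal.mul_div_cancel h0 ht]
          _ ≤ F x * H n x ^ (r - 1) := by gcongr; exact hHF n x
      · exact (hf.mul (((hHm n).pow_const _).comp measurable_fst)).aemeasurable
    have h2 : ∀ y, ∫⁻ x, f x y * H n x ^ (r - 1) ∂μ ≤
        (∫⁻ x, f x y ^ r ∂μ) ^ (1 / r) * (∫⁻ x, H n x ^ r ∂μ) ^ (1 / r.conjExponent) := by
      intro y
      have := ENNReal.lintegral_mul_le_Lp_mul_Lq μ hconj
        (hf.of_uncurry_right (y := y)).aemeasurable ((hHm n).pow_const (r - 1)).aemeasurable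
      refine this.trans (le_of_eq ?_)
      congr 2
      refine lintegral_congr fun x => ?_
      rw [← ENNReal.rpow_mul]
      congr 1
      rw [Real.conjExponent]; field_simp [(by linarith : r - 1 ≠ 0)]
    -- The duality argument: H^r ≤ F H^{r-1}, then Tonelli and Hölder in `x` for each fixed `y`.
    -- Dividing by J^{1/r'} leaves the claim for the truncation.
    have h3 : ∫⁻ x, H n x ^ r ∂μ ≤ R * (∫⁻ x, H n x ^ r ∂μ) ^ (1 / r.conjExponent) := by
      refine h1.trans ((lintegral_mono h2).trans ?_)
      rw [lintegral_mul_const]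
      exact (Measurable.lintegral_prod_left (hf.pow_const r)).pow_const _
    set J := ∫⁻ x, H n x ^ r ∂μ
    rcases eq_or_ne J 0 with hJ | hJ
    · simp [hJ, hr0]
    have hJ' := hfin n
    have he : J = J ^ (1 / r) * J ^ (1 / r.conjExponent) := by
      rw [← ENNReal.rpow_add _ _ hJ hJ', one_div, one_div, hconj.inv_add_inv_eq_one,
        ENNReal.rpow_one]
    have hne0 : J ^ (1 / r.conjExponent) ≠ 0 := by
      rw [Ne, ENNReal.rpow_eq_zero_iff]
      simp [hJ, hJ', J]
    have hnet : J ^ (1 / r.conjExponent) ≠ ∞ :=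
      ENNReal.rpow_ne_top_of_nonneg (by have := hconj.symm.pos; positivity) hJ'
    exact (ENNReal.mul_le_mul_iff_left hne0 hnet).1 (he.symm.trans_le h3)
  have hlim : ∫⁻ x, F x ^ r ∂μ = ⨆ n, ∫⁻ x, H n x ^ r ∂μ := by
    rw [← lintegral_iSup (fun n => (hHm n).pow_const r)
      (fun m n hmn x => ENNReal.rpow_le_rpow (hHmono hmn x) hr0.le)]
    refine lintegral_congr fun x => ?_
    rw [← hHsup x]
    exact (ENNReal.orderIsoRpow r hr0).map_iSup _
  rw [hlim, ← (ENNReal.orderIsoRpow r hr0).symm_apply_apply (⨆ n, ∫⁻ x, H n x ^ r ∂μ)]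
  have : ∀ a : ℝ≥0∞, a ≤ R ^ r → a ^ (1 / r) ≤ R := fun a ha => by
    rw [one_div]; exact (ENNReal.rpow_inv_le_iff hr0).2 ha
  apply this
  rw [OrderIso.symm_apply_apply]
  refine iSup_le fun n => ?_
  have := key n
  rwa [one_div, ENNReal.rpow_inv_le_iff hr0] at this

/-! ### Comparison of measures through their tails -/

/-- Comparison of integrals of monotone functions against measures with ordered tails. -/
theorem lintegral_le_of_tail_le {m m₀ : Measure ℝ} (h : ∀ t > 0, m (Ioi t) ≤ m₀ (Ioi t))
    (hfin : ∀ t > 0, m₀ (Ioi t) ≠ ∞) {f : ℝ → ℝ} (hf0 : ∀ x, 0 ≤ f x) (hfm : Measurable f)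
    (hf : MonotoneOn f (Ioi 0)) :
    ∫⁻ x in Ioi 0, ENNReal.ofReal (f x) ∂m ≤ ∫⁻ x in Ioi 0, ENNReal.ofReal (f x) ∂m₀ := by
  have hIoi : ∀ a ≥ 0, m (Ioi a) ≤ m₀ (Ioi a) := by
    intro a ha
    have hu : Ioi a = ⋃ n : ℕ, Ioi (a + 1 / (n + 1 : ℝ)) := by
      ext x
      simp only [mem_Ioi, mem_iUnion]
      constructor
      · intro hx
        obtain ⟨n, hn⟩ := exists_nat_one_div_lt (sub_pos.2 hx)
        exact ⟨n, by linarith⟩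
      · rintro ⟨n, hn⟩
        exact lt_trans (by have : (0 : ℝ) < 1 / (n + 1) := by positivity
                           linarith) hn
    have hmono : Monotone fun n : ℕ => Ioi (a + 1 / (n + 1 : ℝ)) := fun i j hij =>
      Ioi_subset_Ioi (by gcongr)
    rw [hu, hmono.measure_iUnion, hmono.measure_iUnion]
    exact iSup_mono fun n => h _ (by positivity)
  -- Closed rays are decreasing limits of open ones, and continuity from above is where finiteness
  -- of the tails is used.
  have hIci : ∀ a > 0, m (Ici a) ≤ m₀ (Ici a) := by
    intro a ha
    have hu : Ici a = ⋂ n : ℕ, Ioi (a - a / (n + 2 : ℝ)) := by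
      ext x
      simp only [mem_Ici, mem_iInter, mem_Ioi]
      constructor
      · intro hx n
        have : 0 < a / (n + 2 : ℝ) := by positivity
        linarith
      · intro hx
        by_contra hlt
        push Not at hlt
        obtain ⟨n, hn⟩ := exists_nat_gt (a / (a - x))
        have h1 := hx n
        have h2 : a / (n + 2 : ℝ) < a - x := by
          rw [div_lt_iff₀ (sub_pos.2 hlt)] at hn
          rw [div_lt_iff₀ (by positivity)]
          nlinarith
        linarith
    have hpos : ∀ n : ℕ, 0 < a - a / (n + 2 : ℝ) := by
      intro n
      rw [sub_pos, div_lt_iff₀ (by positivity)]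
      nlinarith [(Nat.cast_nonneg n : (0 : ℝ) ≤ n)]
    have hanti : Antitone fun n : ℕ => Ioi (a - a / (n + 2 : ℝ)) := fun i j hij =>
      Ioi_subset_Ioi (by gcongr)
    rw [hu, hanti.measure_iInter (fun n => measurableSet_Ioi.nullMeasurableSet)
      ⟨0, ne_top_of_le_ne_top (hfin _ (hpos 0)) (h _ (hpos 0))⟩,
      hanti.measure_iInter (fun n => measurableSet_Ioi.nullMeasurableSet) ⟨0, hfin _ (hpos 0)⟩]
    exact iInf_mono fun n => h _ (hpos n)
  rw [lintegral_eq_lintegral_meas_lt _ (Filter.Eventually.of_forall hf0) hfm.aemeasurable,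
    lintegral_eq_lintegral_meas_lt _ (Filter.Eventually.of_forall hf0) hfm.aemeasurable]
  refine lintegral_mono fun l => ?_
  have hms : MeasurableSet {x | l < f x} := measurableSet_lt measurable_const hfm
  rw [Measure.restrict_apply hms, Measure.restrict_apply hms]
  -- By the layer cake formula only superlevel sets matter. For a monotone function they are upward
  -- closed in (0, ∞), hence empty, an open ray or a closed ray.
  set U := {x | l < f x} ∩ Ioi 0 with hU
  have hup : ∀ x ∈ U, ∀ y, x ≤ y → y ∈ U := fun x hx y hxy =>
    ⟨lt_of_lt_of_le hx.1 (hf hx.2 (lt_of_lt_of_le hx.2 hxy) hxy), lt_of_lt_of_le hx.2 hxy⟩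
  rcases U.eq_empty_or_nonempty with he | hne
  · simp [he]
  have hbd : BddBelow U := ⟨0, fun x hx => hx.2.le⟩
  have ha0 : 0 ≤ sInf U := le_csInf hne fun x hx => hx.2.le
  by_cases ha : sInf U ∈ U
  · have : U = Ici (sInf U) := Subset.antisymm (fun x hx => csInf_le hbd hx)
      fun x hx => hup _ ha x hx
    rw [this]
    exact hIci _ ha.2
  · have : U = Ioi (sInf U) := by
      refine Subset.antisymm (fun x hx => lt_of_le_of_ne (csInf_le hbd hx) ?_) fun x hx => ?_
      · rintro rfl; exact ha hx
      · obtain ⟨y, hy, hyx⟩ := exists_lt_of_csInf_lt hne hx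
        exact hup y hy x hyx.le
    rw [this]
    exact hIoi _ ha0

/-! ### Beta integrals and the comparison of the constants k and k̃ -/

theorem lintegral_beta {a b : ℝ} (ha : 0 < a) (hb : 0 < b) :
    ∫⁻ x in Ioo (0 : ℝ) 1, ENNReal.ofReal (x ^ (a - 1) * (1 - x) ^ (b - 1)) =
      ENNReal.ofReal (ProbabilityTheory.beta a b) := by
  have h1 := ProbabilityTheory.lintegral_betaPDF_eq_one ha hb
  have hpos := ProbabilityTheory.beta_pos ha hb
  rw [ProbabilityTheory.lintegral_betaPDF] at h1
  have h2 : ∀ x : ℝ, ENNReal.ofReal (1 / ProbabilityTheory.beta a b * x ^ (a - 1) *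
      (1 - x) ^ (b - 1)) = ENNReal.ofReal (1 / ProbabilityTheory.beta a b) *
        ENNReal.ofReal (x ^ (a - 1) * (1 - x) ^ (b - 1)) := fun x => by
    rw [mul_assoc, ENNReal.ofReal_mul (by positivity)]
  simp_rw [h2] at h1
  rw [lintegral_const_mul' _ _ ENNReal.ofReal_ne_top, one_div, ENNReal.ofReal_inv_of_pos hpos] at h1
  have h3 : ENNReal.ofReal (ProbabilityTheory.beta a b) ≠ 0 := by simpa using hpos
  rw [← ENNReal.div_eq_inv_mul, ENNReal.div_eq_one_iff h3 ENNReal.ofReal_ne_top] at h1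
  exact h1

/-- Substitution `x = t ^ r / (1 + t ^ r)` in the beta integral. -/
theorem lintegral_rpow_mul_one_add_rpow {r a b : ℝ} (hr : 0 < r) (ha : 0 < a) (hb : 0 < b) :
    ∫⁻ t in Ioi (0 : ℝ), ENNReal.ofReal (t ^ (r * a - 1) * (1 + t ^ r) ^ (-(a + b))) =
      ENNReal.ofReal (ProbabilityTheory.beta a b / r) := by
  have hpos : ∀ t ∈ Ioi (0 : ℝ), 0 < t ^ r := fun t ht => Real.rpow_pos_of_pos ht r
  have hderiv : ∀ t ∈ Ioi (0 : ℝ), HasDerivWithinAt (fun t : ℝ => t ^ r / (1 + t ^ r))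
      (r * t ^ (r - 1) / (1 + t ^ r) ^ 2) (Ioi 0) t := by
    intro t ht
    have h1 := Real.hasDerivAt_rpow_const (p := r) (Or.inl (ne_of_gt ht))
    have h2 := h1.const_add 1
    have h3 := h1.div h2 (by have := hpos t ht; positivity)
    refine (h3.congr_deriv ?_).hasDerivWithinAt
    ring
  have hinj : InjOn (fun t : ℝ => t ^ r / (1 + t ^ r)) (Ioi 0) := by
    intro s hs t ht hst
    have h1 := hpos s hs
    have h2 := hpos t ht
    simp only at hst
    rw [div_eq_div_iff (by positivity) (by positivity)] at hst
    have : s ^ r = t ^ r := by linarith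
    exact (Real.rpow_left_inj (le_of_lt hs) (le_of_lt ht) hr.ne').1 this
  have himg : (fun t : ℝ => t ^ r / (1 + t ^ r)) '' Ioi 0 = Ioo 0 1 := by
    ext x
    constructor
    · rintro ⟨t, ht, rfl⟩
      have h1 := hpos t ht
      exact ⟨by positivity, by simp only; rw [div_lt_one (by positivity)]; linarith⟩
    · rintro ⟨h0, h1⟩
      have hx : 0 < x / (1 - x) := div_pos h0 (by linarith)
      refine ⟨(x / (1 - x)) ^ (1 / r), Real.rpow_pos_of_pos hx _, ?_⟩
      simp only
      rw [← Real.rpow_mul hx.le, one_div_mul_cancel hr.ne', Real.rpow_one]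
      field_simp [(by linarith : 1 - x ≠ 0)]
      ring
  have key := lintegral_image_eq_lintegral_abs_deriv_mul measurableSet_Ioi hderiv hinj
    (fun x => ENNReal.ofReal (x ^ (a - 1) * (1 - x) ^ (b - 1)))
  rw [himg, lintegral_beta ha hb] at key
  rw [div_eq_inv_mul, ENNReal.ofReal_mul (by positivity), key,
    ← lintegral_const_mul' _ _ ENNReal.ofReal_ne_top]
  refine setLIntegral_congr_fun measurableSet_Ioi fun t ht => ?_
  have h1 := hpos t ht
  have ht0 : (0 : ℝ) < t := ht
  have h2 : 0 < 1 + t ^ r := by positivity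
  rw [abs_of_nonneg (by positivity), ← ENNReal.ofReal_mul (by positivity),
    ← ENNReal.ofReal_mul (by positivity)]
  congr 1
  have e1 : 1 - t ^ r / (1 + t ^ r) = (1 + t ^ r)⁻¹ := by field_simp; ring
  rw [e1, Real.div_rpow h1.le h2.le, Real.inv_rpow h2.le, ← Real.rpow_neg h2.le,
    ← Real.rpow_mul ht0.le]
  have e2 : t ^ (r * a - 1) = t ^ (r - 1) * t ^ (r * (a - 1)) := by
    rw [← Real.rpow_add ht0]; congr 1; ring
  have e3 : (1 + t ^ r) ^ (-(a + b)) =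
      ((1 + t ^ r) ^ 2)⁻¹ * ((1 + t ^ r) ^ (a - 1))⁻¹ * (1 + t ^ r) ^ (-(b - 1)) := by
    rw [← Real.rpow_natCast, ← Real.rpow_neg h2.le, ← Real.rpow_neg h2.le, ← Real.rpow_add h2,
      ← Real.rpow_add h2]
    congr 1; push_cast; ring
  rw [e2, e3]
  field_simp

theorem beta_add_one_sub_one {a b : ℝ} (ha : 0 < a) (hb : 1 < b) :
    ProbabilityTheory.beta (a + 1) (b - 1) = a / (b - 1) * ProbabilityTheory.beta a b := by
  have h1 : Real.Gamma b = (b - 1) * Real.Gamma (b - 1) := by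
    rw [← Real.Gamma_add_one (by linarith)]; congr 1; ring
  rw [ProbabilityTheory.beta, ProbabilityTheory.beta, Real.Gamma_add_one ha.ne', h1,
    show a + 1 + (b - 1) = a + b by ring]
  field_simp [(by linarith : b - 1 ≠ 0)]

theorem integral_beta {a b : ℝ} (ha : 0 ≤ a) (hb : 0 ≤ b) :
    ∫ x in (0 : ℝ)..1, x ^ a * (1 - x) ^ b = ProbabilityTheory.beta (a + 1) (b + 1) := by
  have hcont : Continuous fun x : ℝ => x ^ a * (1 - x) ^ b :=
    (Real.continuous_rpow_const ha).mul
      ((Real.continuous_rpow_const hb).comp (continuous_const.sub continuous_id))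
  have h := lintegral_beta (a := a + 1) (b := b + 1) (by linarith) (by linarith)
  simp only [add_sub_cancel_right] at h
  rw [setLIntegral_congr Ioo_ae_eq_Ioc, ← ofReal_integral_eq_lintegral_ofReal] at h
  · rw [intervalIntegral.integral_of_le zero_le_one]
    have h0 := ProbabilityTheory.beta_pos (α := a + 1) (β := b + 1) (by linarith) (by linarith)
    rwa [ENNReal.ofReal_eq_ofReal_iff _ h0.le] at h
    refine setIntegral_nonneg measurableSet_Ioc fun x hx => ?_
    exact mul_nonneg (Real.rpow_nonneg hx.1.le _) (Real.rpow_nonneg (by linarith [hx.2]) _)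
  · exact (hcont.intervalIntegrable 0 1).1
  · refine ae_restrict_of_forall_mem measurableSet_Ioc fun x hx => ?_
    exact mul_nonneg (Real.rpow_nonneg hx.1.le _) (Real.rpow_nonneg (by linarith [hx.2]) _)

/-- On [0, θ] one has (1 - x)^b ≥ (1 - θ)^b ≥ (1 - θ)^b (x/θ)^b, so the integrand dominates its
value at θ times (x/θ)^{a+b}. The surplus factor is inserted so that the bound and its mirror image
on [θ, 1] carry the same denominator a + b + 1. -/
theorem half_beta_lower_bound {a b : ℝ} (ha : 0 ≤ a) (hb : 0 ≤ b) {θ : ℝ} (hθ : 0 < θ)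
    (hθ1 : θ < 1) :
    θ ^ a * (1 - θ) ^ b * (θ / (a + b + 1)) ≤ ∫ x in (0 : ℝ)..θ, x ^ a * (1 - x) ^ b := by
  have hcont : Continuous fun x : ℝ => x ^ a * (1 - x) ^ b :=
    (Real.continuous_rpow_const ha).mul
      ((Real.continuous_rpow_const hb).comp (continuous_const.sub continuous_id))
  have hcont2 : Continuous fun x : ℝ => θ ^ a * (1 - θ) ^ b * (x / θ) ^ (a + b) :=
    continuous_const.mul ((Real.continuous_rpow_const (by linarith)).comp
      (continuous_id.div_const θ))
  have h1 : ∫ x in (0 : ℝ)..θ, θ ^ a * (1 - θ) ^ b * (x / θ) ^ (a + b) =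
      θ ^ a * (1 - θ) ^ b * (θ / (a + b + 1)) := by
    rw [intervalIntegral.integral_const_mul,
      intervalIntegral.integral_comp_div (fun x => x ^ (a + b)) hθ.ne',
      integral_rpow (Or.inl (by linarith))]
    rw [zero_div, div_self hθ.ne', Real.one_rpow, Real.zero_rpow (by linarith)]
    simp [div_eq_mul_inv]
  rw [← h1]
  refine intervalIntegral.integral_mono_on hθ.le (hcont2.intervalIntegrable _ _)
    (hcont.intervalIntegrable _ _) fun x hx => ?_
  have hx1 : x / θ ≤ 1 := (div_le_one hθ).2 hx.2
  have hx0 : 0 ≤ x / θ := div_nonneg hx.1 hθ.le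
  have e1 : x ^ a = θ ^ a * (x / θ) ^ a := by
    rw [← Real.mul_rpow hθ.le hx0, mul_div_cancel₀ _ hθ.ne']
  have e2 : (1 - θ) ^ b * (x / θ) ^ b ≤ (1 - x) ^ b :=
    calc (1 - θ) ^ b * (x / θ) ^ b ≤ (1 - θ) ^ b * 1 := by
          have := Real.rpow_nonneg (show 0 ≤ 1 - θ by linarith) b
          gcongr
          exact Real.rpow_le_one hx0 hx1 hb
      _ ≤ (1 - x) ^ b := by
          rw [mul_one]
          exact Real.rpow_le_rpow (by linarith) (by linarith [hx.2]) hb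
  rw [e1, Real.rpow_add_of_nonneg hx0 ha hb]
  calc θ ^ a * (1 - θ) ^ b * ((x / θ) ^ a * (x / θ) ^ b)
      = θ ^ a * (x / θ) ^ a * ((1 - θ) ^ b * (x / θ) ^ b) := by ring
    _ ≤ _ := by
      have := Real.rpow_nonneg hθ.le a
      have := Real.rpow_nonneg hx0 a
      gcongr

/-- Entropy bound for the generalized binomial coefficient. -/
theorem Gamma_div_le {a b : ℝ} (ha : 0 < a) (hb : 0 < b) :
    Real.Gamma (a + b + 1) / (Real.Gamma (a + 1) * Real.Gamma (b + 1)) ≤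
      ((a + b) / a) ^ a * ((a + b) / b) ^ b := by
  -- The maximum point of x^a (1 - x)^b.
  set θ := a / (a + b) with hθ
  have hab : 0 < a + b := by linarith
  have h0 : 0 < θ := by positivity
  have h1θ : 1 - θ = b / (a + b) := by rw [hθ]; field_simp; ring
  have h1 : θ < 1 := by rw [hθ, div_lt_one hab]; linarith
  have hcont : Continuous fun x : ℝ => x ^ a * (1 - x) ^ b :=
    (Real.continuous_rpow_const ha.le).mul
      ((Real.continuous_rpow_const hb.le).comp (continuous_const.sub continuous_id))
  have hsplit := intervalIntegral.integral_add_adjacent_intervals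
    (hcont.intervalIntegrable (μ := volume) 0 θ) (hcont.intervalIntegrable (μ := volume) θ 1)
  rw [integral_beta ha.le hb.le] at hsplit
  have hA := half_beta_lower_bound ha.le hb.le h0 h1
  have hB := half_beta_lower_bound hb.le ha.le (θ := 1 - θ) (by linarith) (by linarith)
  have hrefl : ∫ x in (0 : ℝ)..(1 - θ), x ^ b * (1 - x) ^ a =
      ∫ x in θ..1, x ^ a * (1 - x) ^ b := by
    have := intervalIntegral.integral_comp_sub_left (fun x : ℝ => x ^ b * (1 - x) ^ a) 1
      (a := θ) (b := 1)
    simp only [sub_self] at this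
    rw [← this]
    congr 1; ext x; rw [sub_sub_cancel, mul_comm]
  rw [hrefl, sub_sub_cancel] at hB
  -- The two halves contribute θ and 1 - θ, which add up to 1. The remaining factor a + b + 1 is
  -- absorbed by Γ(a+b+2) = (a+b+1) Γ(a+b+1), so the final bound has no extra constant.
  have hlow : θ ^ a * (1 - θ) ^ b / (a + b + 1) ≤ ProbabilityTheory.beta (a + 1) (b + 1) := by
    rw [← hsplit]
    refine le_trans (le_of_eq ?_) (add_le_add hA hB)
    rw [show b + a + 1 = a + b + 1 by ring]
    field_simp; ring
  have hG : Real.Gamma (a + 1 + (b + 1)) = (a + b + 1) * Real.Gamma (a + b + 1) := by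
    rw [← Real.Gamma_add_one (by linarith)]; congr 1; ring
  have hg1 := Real.Gamma_pos_of_pos (show 0 < a + 1 by linarith)
  have hg2 := Real.Gamma_pos_of_pos (show 0 < b + 1 by linarith)
  have hg3 := Real.Gamma_pos_of_pos (show 0 < a + b + 1 by linarith)
  rw [ProbabilityTheory.beta, hG] at hlow
  have e1 : ((a + b) / a) ^ a = (θ ^ a)⁻¹ := by
    rw [← Real.inv_rpow h0.le, hθ, inv_div]
  have e2 : ((a + b) / b) ^ b = ((1 - θ) ^ b)⁻¹ := by
    rw [← Real.inv_rpow (by linarith), h1θ, inv_div]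
  have hp1 : 0 < θ ^ a := Real.rpow_pos_of_pos h0 _
  have hp2 : 0 < (1 - θ) ^ b := Real.rpow_pos_of_pos (by linarith) _
  rw [e1, e2, ← mul_inv, div_le_iff₀ (by positivity), ← div_eq_inv_mul, le_div_iff₀ (by positivity)]
  rw [div_le_div_iff₀ (by positivity) (by positivity)] at hlow
  have hc : 0 < a + b + 1 := by linarith
  nlinarith

/-- With a = p/(q-p) and b = q(p-1)/(q-p), the Gamma quotient is a generalized binomial coefficient,
(a+b)/a = 1 + q/p*, (a+b)/b = 1 + p*/q, and the outer exponent turns a and b into 1/q and 1/p*. Thus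
the entropy bound gives k̃ exactly; for p = q there is equality. -/
theorem kConst_le_kTilde {p q : ℝ} (hp : 1 < p) (hpq : p ≤ q) : kConst q p ≤ kTilde q p := by
  have hps : pStar p = p / (p - 1) := rfl
  have hp1 : 0 < p - 1 := by linarith
  have hp0 : 0 < p := by linarith
  have hq0 : 0 < q := by linarith
  rw [kConst, kTilde]
  split_ifs with h
  · have hqp : 0 < q - p := by linarith
    set a := p / (q - p) with ha
    set b := (p * (q - 1) / (q - p)) - 1 with hb
    have ha0 : 0 < a := by positivity
    have hb' : b = q * (p - 1) / (q - p) := by rw [hb]; field_simp; ring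
    have hb0 : 0 < b := by rw [hb']; positivity
    have e1 : p * q / (q - p) = a + b + 1 := by rw [ha, hb]; field_simp; ring
    have e2 : q / (q - p) = a + 1 := by rw [ha]; field_simp; ring
    have e3 : p * (q - 1) / (q - p) = b + 1 := by rw [hb]; ring
    rw [e1, e2, e3]
    have hex : 1 / p - 1 / q = (q - p) / (p * q) := by field_simp
    have hex0 : 0 < 1 / p - 1 / q := by rw [hex]; positivity
    refine (Real.rpow_le_rpow ?_ (Gamma_div_le ha0 hb0) hex0.le).trans (le_of_eq ?_)
    · have hg1 := Real.Gamma_pos_of_pos (show 0 < a + 1 by linarith)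
      have hg2 := Real.Gamma_pos_of_pos (show 0 < b + 1 by linarith)
      have hg3 := Real.Gamma_pos_of_pos (show 0 < a + b + 1 by linarith)
      positivity
    · rw [Real.mul_rpow (by positivity) (by positivity), ← Real.rpow_mul (by positivity),
        ← Real.rpow_mul (by positivity)]
      congr 2
      · rw [ha, hb', hps]; field_simp
      · rw [ha, hex]; field_simp
      · rw [ha, hb', hps]; field_simp; ring
      · rw [hb', hex, hps]; field_simp
  · have : q = p := le_antisymm (not_lt.1 h) hpq
    subst this
    refine le_of_eq ?_
    congr 2
    · rw [hps]; field_simp; ring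
    · rw [hps]; field_simp; ring

/-! ### Monotone transport on the half-line -/

section Transport

variable {a : ℝ → ℝ}

theorem hasDerivAt_integral_of_continuousOn_Ioi (hc : ContinuousOn a (Ioi 0))
    (hi : IntegrableOn a (Ioi 0)) {t : ℝ} (ht : 0 < t) :
    HasDerivAt (fun t => ∫ x in (0 : ℝ)..t, a x) (a t) t := by
  refine intervalIntegral.integral_hasDerivAt_right ?_ ?_ (hc.continuousAt (Ioi_mem_nhds ht))
  · rw [intervalIntegrable_iff_integrableOn_Ioc_of_le ht.le]
    exact hi.mono_set Ioc_subset_Ioi_self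
  · exact hc.stronglyMeasurableAtFilter isOpen_Ioi t ht

theorem strictMonoOn_integral_of_pos (hc : ContinuousOn a (Ioi 0))
    (hi : IntegrableOn a (Ioi 0)) (hpos : ∀ t > 0, 0 < a t) :
    StrictMonoOn (fun t => ∫ x in (0 : ℝ)..t, a x) (Ioi 0) := by
  refine strictMonoOn_of_deriv_pos (convex_Ioi 0) (fun t ht =>
    (hasDerivAt_integral_of_continuousOn_Ioi hc hi ht).continuousAt.continuousWithinAt) ?_
  intro t ht
  rw [interior_Ioi] at ht
  rw [(hasDerivAt_integral_of_continuousOn_Ioi hc hi ht).deriv]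
  exact hpos t ht

theorem image_integral_of_pos (hc : ContinuousOn a (Ioi 0))
    (hi : IntegrableOn a (Ioi 0)) (hpos : ∀ t > 0, 0 < a t) :
    (fun t => ∫ x in (0 : ℝ)..t, a x) '' Ioi 0 = Ioo 0 (∫ x in Ioi 0, a x) := by
  have hmono := strictMonoOn_integral_of_pos hc hi hpos
  have hlim := intervalIntegral_tendsto_integral_Ioi 0 hi Filter.tendsto_id
  have hIoc : ∀ t : ℝ, IntervalIntegrable a volume 0 (max t 0) := fun t => by
    rw [intervalIntegrable_iff_integrableOn_Ioc_of_le (le_max_right _ _)]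
    exact hi.mono_set Ioc_subset_Ioi_self
  ext y
  constructor
  · rintro ⟨t, ht, rfl⟩
    have ht0 : (0 : ℝ) < t := ht
    constructor
    · refine intervalIntegral.intervalIntegral_pos_of_pos_on ?_ (fun x hx => hpos x hx.1) ht0
      simpa [max_eq_left ht0.le] using hIoc t
    · refine lt_of_lt_of_le (hmono ht (show (0 : ℝ) < t + 1 by linarith) (by linarith))
        (ge_of_tendsto hlim ?_)
      filter_upwards [Filter.eventually_ge_atTop (t + 1)] with u hu
      exact hmono.monotoneOn (show (0 : ℝ) < t + 1 by linarith)
        (show (0 : ℝ) < u by linarith) hu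
  · rintro ⟨h0, h1⟩
    obtain ⟨R, hR, hR0⟩ := ((hlim.eventually (lt_mem_nhds h1)).and
      (Filter.eventually_gt_atTop (0 : ℝ))).exists
    simp only [id] at hR
    have hcont : ContinuousOn (fun t => ∫ x in (0 : ℝ)..t, a x) (Icc 0 R) := by
      have := intervalIntegral.continuousOn_primitive_interval (μ := volume) (f := a) (a := 0)
        (b := R) (by
          rw [uIcc_of_le hR0.le, integrableOn_Icc_iff_integrableOn_Ioc]
          exact hi.mono_set Ioc_subset_Ioi_self)
      rwa [uIcc_of_le hR0.le] at this
    obtain ⟨u, hu, huy⟩ := intermediate_value_Icc hR0.le hcont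
      (show y ∈ Icc _ _ from ⟨by simpa using h0.le, hR.le⟩)
    refine ⟨u, lt_of_le_of_ne hu.1 ?_, huy⟩
    rintro rfl
    simp at huy
    linarith

/-- Monotone transport between two continuous positive densities of equal mass on `(0, ∞)`. -/
theorem exists_transport {e : ℝ → ℝ} (hac : ContinuousOn a (Ioi 0))
    (hai : IntegrableOn a (Ioi 0)) (hapos : ∀ t > 0, 0 < a t) (hec : ContinuousOn e (Ioi 0))
    (hei : IntegrableOn e (Ioi 0)) (hepos : ∀ t > 0, 0 < e t)
    (hmass : ∫ x in Ioi 0, a x = ∫ x in Ioi 0, e x) :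
    ∃ T : ℝ → ℝ, (∀ t > 0, 0 < T t) ∧ (∀ t > 0, HasDerivAt T (a t / e (T t)) t) ∧
      InjOn T (Ioi 0) ∧ T '' Ioi 0 = Ioi 0 := by
  set A := fun t => ∫ x in (0 : ℝ)..t, a x with hA
  set E := fun t => ∫ x in (0 : ℝ)..t, e x with hE
  set M := ∫ x in Ioi 0, e x
  have hAim : A '' Ioi 0 = Ioo 0 M := hmass ▸ image_integral_of_pos hac hai hapos
  have hEim : E '' Ioi 0 = Ioo 0 M := image_integral_of_pos hec hei hepos
  have hAmono := strictMonoOn_integral_of_pos hac hai hapos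
  have hEmono := strictMonoOn_integral_of_pos hec hei hepos
  -- The transport map is E⁻¹ ∘ A, with A and E the two distribution functions. Equal masses make
  -- their ranges coincide, and the inverse function rule gives its derivative.
  set S := Function.invFunOn E (Ioi 0) with hS
  have hSmem : ∀ y ∈ Ioo 0 M, S y ∈ Ioi (0 : ℝ) := fun y hy =>
    Function.invFunOn_mem (by rw [← hEim] at hy; exact hy)
  have hES : ∀ y ∈ Ioo 0 M, E (S y) = y := fun y hy =>
    Function.invFunOn_eq (by rw [← hEim] at hy; exact hy)
  have hSE : ∀ u ∈ Ioi (0 : ℝ), S (E u) = u := fun u hu =>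
    hEmono.injOn (hSmem _ (hEim ▸ mem_image_of_mem E hu)) hu
      (hES _ (hEim ▸ mem_image_of_mem E hu))
  have hSmono : StrictMonoOn S (Ioo 0 M) := by
    intro y hy z hz hyz
    by_contra h
    push Not at h
    have := hEmono.monotoneOn (hSmem z hz) (hSmem y hy) h
    change E (S z) ≤ E (S y) at this
    rw [hES y hy, hES z hz] at this
    linarith
  have hSim : S '' Ioo 0 M = Ioi 0 := by
    ext u
    constructor
    · rintro ⟨y, hy, rfl⟩; exact hSmem y hy
    · intro hu
      exact ⟨E u, hEim ▸ mem_image_of_mem E hu, hSE u hu⟩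
  have hAmem : ∀ t > 0, A t ∈ Ioo 0 M := fun t ht => hAim ▸ mem_image_of_mem A ht
  refine ⟨fun t => S (A t), fun t ht => hSmem _ (hAmem t ht), fun t ht => ?_, ?_, ?_⟩
  · have hy := hAmem t ht
    have hnhds : Ioo 0 M ∈ nhds (A t) := Ioo_mem_nhds hy.1 hy.2
    have hScont : ContinuousAt S (A t) :=
      hSmono.continuousAt_of_image_mem_nhds hnhds (by
        rw [hSim]; exact Ioi_mem_nhds (hSmem _ hy))
    have hSd : HasDerivAt S (e (S (A t)))⁻¹ (A t) :=
      HasDerivAt.of_local_left_inverse hScont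
        (hasDerivAt_integral_of_continuousOn_Ioi hec hei (hSmem _ hy))
        (hepos _ (hSmem _ hy)).ne' (by filter_upwards [hnhds] with z hz using hES z hz)
    have := hSd.comp t (hasDerivAt_integral_of_continuousOn_Ioi hac hai ht)
    rw [div_eq_inv_mul]
    exact this
  · exact hSmono.injOn.comp hAmono.injOn fun t ht => hAmem t ht
  · have := image_image S A (Ioi 0)
    rw [hAim, hSim] at this
    exact this.symm

end Transport

/-! ### Bliss' inequality -/

/-- The integral of the derivative of a nonincreasing nonnegative function. -/
theorem lintegral_Ioi_le_of_hasDerivAt {P D : ℝ → ℝ}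
    (hP : ∀ t > 0, HasDerivAt P (-D t) t) (hD : ∀ t > 0, 0 ≤ D t) (hP0 : ∀ t > 0, 0 ≤ P t)
    {y : ℝ} (hy : 0 < y) : ∫⁻ t in Ioi y, ENNReal.ofReal (D t) ≤ ENNReal.ofReal (P y) := by
  have hu : Ioi y = ⋃ n : ℕ, Ioc y (y + n) := by
    ext x
    simp only [mem_Ioi, mem_iUnion, mem_Ioc]
    refine ⟨fun hx => ?_, fun ⟨n, hn, _⟩ => hn⟩
    obtain ⟨n, hn⟩ := exists_nat_ge (x - y)
    exact ⟨n, hx, by linarith⟩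
  have hmono : Monotone fun n : ℕ => Ioc y (y + n) := fun i j hij =>
    Ioc_subset_Ioc_right (by gcongr)
  rw [hu, setLIntegral_iUnion_of_directed _ hmono.directed_le]
  refine iSup_le fun n => ?_
  have hle : y ≤ y + n := by simp
  have hpos : ∀ t ∈ Icc y (y + n), 0 < t := fun t ht => lt_of_lt_of_le hy ht.1
  have hcont : ContinuousOn (fun t => -P t) (Icc y (y + n)) := fun t ht =>
    (hP t (hpos t ht)).continuousAt.neg.continuousWithinAt
  have hder : ∀ t ∈ Ioo y (y + n), HasDerivAt (fun t => -P t) (D t) t := fun t ht => by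
    
    have h := (hP t (hpos t (Ioo_subset_Icc_self ht))).neg
    rw [neg_neg] at h
    exact h
  have hnn : ∀ t ∈ Ioo y (y + n), 0 ≤ D t := fun t ht =>
    hD t (hpos t (Ioo_subset_Icc_self ht))
  have hint := intervalIntegral.integrableOn_deriv_of_nonneg hcont hder hnn
  have hftc := intervalIntegral.integral_eq_sub_of_hasDerivAt_of_le hle hcont hder
    ((intervalIntegrable_iff_integrableOn_Ioc_of_le hle).2 hint)
  rw [← ofReal_integral_eq_lintegral_ofReal hint
    (ae_restrict_of_forall_mem measurableSet_Ioc fun t ht => hD t (hpos t (Ioc_subset_Icc_self ht))),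
    ← intervalIntegral.integral_of_le hle, hftc]
  refine ENNReal.ofReal_le_ofReal ?_
  have := hP0 (y + n) (hpos _ ⟨hle, le_rfl⟩)
  linarith

/-- The arithmetic-geometric mean inequality behind Bliss' inequality. -/
theorem transport_pointwise {q r n s κ c F t T : ℝ} (hn : 1 ≤ n)
    (h1 : q * (1 / n) = r) (h2 : (s - 1) * (1 / n) = κ) (h3 : (r + 1) * (1 / n) = r - κ)
    (hs : s = q - r) (hc : 0 < c) (hF : 0 < F) (ht : 0 < t) (hT : 0 < T) :
    c ^ (1 / n) * (F ^ q * t ^ (-s) * (1 + T ^ (-r))) ≤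
      1 / n * (F ^ s * (T ^ (-κ) * t ^ (κ - s) *
        (t * (c * (F ^ q * t ^ (-s)) / (T ^ r * (1 + T ^ r) ^ (-n))) / T + (n - 1)))) := by
  have hn0 : 0 < n := by linarith
  have hTr : 0 < T ^ r := Real.rpow_pos_of_pos hT r
  set w := 1 + T ^ r with hw
  have hw0 : 0 < w := by positivity
  -- For the transport map T of the application, this is t T'(t) / T(t). The mean inequality is
  -- applied to it with weight 1/n and to 1 with weight 1 - 1/n.
  set E := t * (c * (F ^ q * t ^ (-s)) / (T ^ r * w ^ (-n))) / T with hE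
  have hE0 : 0 < E := by positivity
  have hag := Real.geom_mean_le_arith_mean2_weighted (w₁ := 1 / n) (w₂ := 1 - 1 / n) (p₁ := E)
    (p₂ := 1) (by positivity) (by rw [sub_nonneg, div_le_one hn0]; exact hn) hE0.le zero_le_one
    (by ring)
  rw [Real.one_rpow, mul_one, mul_one] at hag
  have hw1 : 1 + T ^ (-r) = T ^ (-r) * w := by
    rw [hw, mul_add, ← Real.rpow_add hT]; simp [add_comm]
  have hid : c ^ (1 / n) * (F ^ q * t ^ (-s) * (1 + T ^ (-r))) =
      F ^ s * (T ^ (-κ) * t ^ (κ - s) * E ^ (1 / n)) := by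
    rw [hw1]
    -- Both sides are products of powers, so after taking logarithms the identity is linear in the
    -- logarithms of F, t, T and w, with coefficients matched by the exponent relations.
    apply Real.log_injOn_pos
    · exact mem_Ioi.2 (by positivity)
    · exact mem_Ioi.2 (by positivity)
    have hlE : Real.log E = Real.log t + (Real.log c + (q * Real.log F + -s * Real.log t) -
        (r * Real.log T + -n * Real.log w)) - Real.log T := by
      rw [hE, Real.log_div (by positivity) (by positivity), Real.log_mul (by positivity)
        (by positivity), Real.log_div (by positivity) (by positivity), Real.log_mul (by positivity)
        (by positivity), Real.log_mul (by positivity) (by positivity), Real.log_mul (by positivity)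
        (by positivity), Real.log_rpow hF, Real.log_rpow ht, Real.log_rpow hT, Real.log_rpow hw0]
    rw [Real.log_mul (by positivity) (by positivity), Real.log_mul (by positivity) (by positivity),
      Real.log_mul (by positivity) (by positivity), Real.log_mul (by positivity) (by positivity),
      Real.log_mul (by positivity) (by positivity), Real.log_mul (by positivity) (by positivity),
      Real.log_mul (by positivity) (by positivity),
      Real.log_rpow hF, Real.log_rpow hF, Real.log_rpow ht, Real.log_rpow ht, Real.log_rpow hT,
      Real.log_rpow hT, Real.log_rpow hE0, Real.log_rpow hc, hlE]
    have h4 : n * (1 / n) = 1 := by field_simp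
    subst hs
    linear_combination (-Real.log F) * h1 + Real.log t * h2 + Real.log T * h3 - Real.log w * h4
  rw [hid]
  calc F ^ s * (T ^ (-κ) * t ^ (κ - s) * E ^ (1 / n))
      ≤ F ^ s * (T ^ (-κ) * t ^ (κ - s) * (1 / n * E + (1 - 1 / n))) := by gcongr
    _ = _ := by field_simp

/-- An integration by parts without boundary terms: F^s is s ∫_0^t G F^{s-1} by the chain rule, and
Tonelli's theorem moves the integration onto `D`, whose tails are controlled by `P`. -/
theorem lintegral_prim_rpow_mul_le {G : ℝ → ℝ≥0∞} (hG : Measurable G)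
    (hfin : ∀ t, prim G t ≠ ∞) {s : ℝ} (hs : 0 < s) {D P : ℝ → ℝ≥0∞} (hD : Measurable D)
    (hDP : ∀ y > 0, ∫⁻ t in Ioi y, D t ≤ P y) :
    ∫⁻ t in Ioi 0, ENNReal.ofReal ((prim G t).toReal ^ s) * D t ≤
      ENNReal.ofReal s *
        ∫⁻ y in Ioi 0, G y * (ENNReal.ofReal ((prim G y).toReal ^ (s - 1)) * P y) := by
  set Q : ℝ → ℝ≥0∞ := fun y => G y * ENNReal.ofReal ((prim G y).toReal ^ (s - 1)) with hQ
  have hQm : Measurable Q := hG.mul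
    ((measurable_prim G).ennreal_toReal.pow_const (s - 1)).ennreal_ofReal
  have h1 : ∀ t, ENNReal.ofReal ((prim G t).toReal ^ s) =
      ENNReal.ofReal s * ∫⁻ y in Ioi 0, (Iic t).indicator Q y := by
    intro t
    rw [lintegral_indicator measurableSet_Iic, Measure.restrict_restrict measurableSet_Iic,
      inter_comm, Ioi_inter_Iic, lintegral_prim_rpow hG (hfin t) hs, ← ENNReal.ofReal_mul hs.le,
      mul_div_cancel₀ _ hs.ne']
  have h2 : ∀ t y, (Iic t).indicator Q y * D t = Q y * (Ici y).indicator D t := by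
    intro t y
    by_cases h : y ≤ t <;> simp [indicator, h]
  have hm : Measurable (Function.uncurry fun t y => Q y * (Ici y).indicator D t) := by
    refine (hQm.comp measurable_snd).mul ?_
    have : (fun z : ℝ × ℝ => (Ici z.2).indicator D z.1) =
        {z : ℝ × ℝ | z.2 ≤ z.1}.indicator fun z => D z.1 := by
      ext z; simp [indicator]
    rw [this]
    exact (hD.comp measurable_fst).indicator (measurableSet_le measurable_snd measurable_fst)
  calc ∫⁻ t in Ioi 0, ENNReal.ofReal ((prim G t).toReal ^ s) * D t
      = ENNReal.ofReal s * ∫⁻ t in Ioi 0, ∫⁻ y in Ioi 0, Q y * (Ici y).indicator D t := by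
        rw [← lintegral_const_mul' _ _ ENNReal.ofReal_ne_top]
        refine lintegral_congr fun t => ?_
        rw [h1, mul_assoc, ← lintegral_mul_const _ (hQm.indicator measurableSet_Iic)]
        congr 1
        exact lintegral_congr fun y => h2 t y
    _ = ENNReal.ofReal s * ∫⁻ y in Ioi 0, ∫⁻ t in Ioi 0, Q y * (Ici y).indicator D t := by
        rw [lintegral_lintegral_swap hm.aemeasurable]
    _ ≤ _ := by
        gcongr ENNReal.ofReal s * ?_
        refine setLIntegral_mono' measurableSet_Ioi fun y hy => ?_
        rw [lintegral_const_mul _ (hD.indicator measurableSet_Ici), ← mul_assoc]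
        gcongr
        rw [lintegral_indicator measurableSet_Ici]
        calc ∫⁻ t in Ici y, D t ∂(volume.restrict (Ioi 0)) ≤ ∫⁻ t in Ici y, D t :=
              lintegral_mono' (Measure.restrict_mono_measure Measure.restrict_le_self _) le_rfl
          _ = ∫⁻ t in Ioi y, D t := setLIntegral_congr Ioi_ae_eq_Ici.symm
          _ ≤ P y := hDP y hy

theorem integrableOn_of_lintegral_eq {f : ℝ → ℝ} {S : Set ℝ} (hS : MeasurableSet S)
    (hf : ContinuousOn f S) (h0 : ∀ x ∈ S, 0 ≤ f x) {m : ℝ} (hm : 0 ≤ m)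
    (h : ∫⁻ x in S, ENNReal.ofReal (f x) = ENNReal.ofReal m) :
    IntegrableOn f S ∧ ∫ x in S, f x = m := by
  have hae : 0 ≤ᵐ[volume.restrict S] f := ae_restrict_of_forall_mem hS h0
  have hi : IntegrableOn f S := by
    refine ⟨hf.aestronglyMeasurable hS, ?_⟩
    rw [hasFiniteIntegral_iff_ofReal hae, h]
    exact ENNReal.ofReal_lt_top
  refine ⟨hi, ?_⟩
  rw [← ofReal_integral_eq_lintegral_ofReal hi hae, ENNReal.ofReal_eq_ofReal_iff
    (setIntegral_nonneg hS h0) hm] at h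
  exact h

/-- The integral `∫_0^∞ (1 + t ^ (q / p - 1)) ^ (-q / (q / p - 1)) dt`. -/
noncomputable def blissInt (q p : ℝ) : ℝ :=
  ProbabilityTheory.beta (1 / (q / p - 1)) (q / (q / p - 1) - 1 / (q / p - 1)) / (q / p - 1)

variable {p q : ℝ}

theorem blissInt_pos (hp : 1 < p) (hpq : p < q) : 0 < blissInt q p := by
  have hr : 0 < q / p - 1 := by rw [sub_pos, one_lt_div (by linarith)]; exact hpq
  refine div_pos (ProbabilityTheory.beta_pos (by positivity) ?_) hr
  rw [← sub_div]; exact div_pos (by linarith) hr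

theorem lintegral_blissInt (hp : 1 < p) (hpq : p < q) :
    ∫⁻ t in Ioi (0 : ℝ), ENNReal.ofReal ((1 + t ^ (q / p - 1)) ^ (-(q / (q / p - 1)))) =
      ENNReal.ofReal (blissInt q p) := by
  have hr : 0 < q / p - 1 := by rw [sub_pos, one_lt_div (by linarith)]; exact hpq
  have hb : 0 < q / (q / p - 1) - 1 / (q / p - 1) := by
    rw [← sub_div]; exact div_pos (by linarith) hr
  have := lintegral_rpow_mul_one_add_rpow hr (one_div_pos.2 hr) hb
  rw [blissInt, ← this]
  refine setLIntegral_congr_fun measurableSet_Ioi fun t ht => ?_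
  rw [mul_one_div_cancel hr.ne', sub_self, Real.rpow_zero, one_mul]
  congr 3; ring

/-- This is the mass of the extremal density. Compared with `lintegral_blissInt` the extra factor
shifts both Beta parameters by one, which multiplies the value by p*/q. -/
theorem lintegral_blissInt' (hp : 1 < p) (hpq : p < q) :
    ∫⁻ t in Ioi (0 : ℝ), ENNReal.ofReal
        (t ^ (q / p - 1) * (1 + t ^ (q / p - 1)) ^ (-(q / (q / p - 1)))) =
      ENNReal.ofReal (pStar p / q * blissInt q p) := by
  have hp0 : 0 < p := by linarith
  have hp1 : 0 < p - 1 := by linarith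
  have hr : 0 < q / p - 1 := by rw [sub_pos, one_lt_div hp0]; exact hpq
  have hb : 1 < q / (q / p - 1) - 1 / (q / p - 1) := by
    rw [← sub_div, one_lt_div hr, sub_lt_sub_iff_right, div_lt_iff₀ hp0]; nlinarith
  have := lintegral_rpow_mul_one_add_rpow hr (a := 1 / (q / p - 1) + 1)
    (b := q / (q / p - 1) - 1 / (q / p - 1) - 1) (by positivity) (by linarith)
  rw [beta_add_one_sub_one (by positivity) hb] at this
  have hps : pStar p / q = 1 / (q / p - 1) / (q / (q / p - 1) - 1 / (q / p - 1) - 1) := by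
    have : pStar p = p / (p - 1) := rfl
    rw [this]
    have h1 : q / (q / p - 1) - 1 / (q / p - 1) - 1 = (q - q / p) / (q / p - 1) := by
      rw [show q - q / p = q - 1 - (q / p - 1) by ring, sub_div, sub_div, div_self hr.ne']
    rw [h1, show q - q / p = q * (p - 1) / p by field_simp]
    have h2 : q ≠ 0 := by linarith
    have h3 : q - p ≠ 0 := by linarith
    field_simp
  rw [blissInt, hps, ← mul_div_assoc, ← this]
  refine setLIntegral_congr_fun measurableSet_Ioi fun t ht => ?_
  congr 3
  · rw [mul_add, mul_one_div_cancel hr.ne']; ring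
  · ring

variable {p q : ℝ}

-- The transport proof. With F the primitive of `G`, the density F^q t^{-s} is transported onto u^r
-- (1 + u^r)^{-n}. Integrating `transport_pointwise`, then using parts and Hölder's inequality,
-- yields an inequality in which both sides are explicit in ‖G‖_p and the unknown integral I, and
-- which can be solved for I. Boundedness and bounded support of `G` make I finite; positivity of F
-- makes the densities positive.
set_option maxHeartbeats 1000000 in
theorem bliss_of_bounded (hp : 1 < p) (hpq : p < q) {G : ℝ → ℝ≥0∞} (hG : Measurable G) {C R : ℝ}
    (hC : 0 < C) (hR : 0 < R) (hGC : ∀ y, G y ≤ ENNReal.ofReal C) (hGR : ∀ y > R, G y = 0)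
    (hpos : ∀ t > 0, 0 < prim G t) :
    ∫⁻ t in Ioi 0, ENNReal.ofReal ((prim G t).toReal ^ q * t ^ (-(q / pStar p + 1))) ≤
      ENNReal.ofReal (pStar p / q * blissInt q p ^ (1 - q / p)) *
        (∫⁻ t in Ioi 0, G t ^ p) ^ (q / p) := by
  have hp0 : 0 < p := by linarith
  have hq0 : 0 < q := by linarith
  have hps : pStar p = p / (p - 1) := rfl
  have hp1 : 0 < p - 1 := by linarith
  have hpsp : 0 < pStar p := by rw [hps]; positivity
  have hconj : p.HolderConjugate (pStar p) := Real.HolderConjugate.conjExponent hp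
  set N := blissInt q p with hN
  have hNpos : 0 < N := blissInt_pos hp hpq
  have hNint := lintegral_blissInt hp hpq
  have hMint := lintegral_blissInt' hp hpq
  rw [← hN] at hNint hMint
  have hr : 0 < q / p - 1 := by rw [sub_pos, one_lt_div hp0]; exact hpq
  set r := q / p - 1 with hrdef
  set n := q / r with hn
  have hn0 : 0 < n := by positivity
  have hn1 : 1 < n := by
    rw [hn, one_lt_div hr, hrdef, sub_lt_iff_lt_add, div_lt_iff₀ hp0]; nlinarith
  have hsq : q / pStar p = q - q / p := by rw [hps]; field_simp
  set s := q / pStar p + 1 with hs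
  have hs1 : 1 < s := by rw [hs]; have : 0 < q / pStar p := by positivity
                         linarith
  have hs' : s = q - r := by rw [hs, hsq, hrdef]; ring
  set κ := r / pStar p with hκ
  have hκ0 : 0 < κ := by positivity
  have i1 : q * (1 / n) = r := by rw [hn]; field_simp
  have i2 : (s - 1) * (1 / n) = κ := by rw [hs, hn, hκ]; field_simp; ring
  have i3 : (r + 1) * (1 / n) = r - κ := by
    have : r + 1 = q - (s - 1) := by rw [hs, hsq, hrdef]; ring
    rw [this, sub_mul, i1, i2]
  set M := pStar p / q * N with hM
  have hMpos : 0 < M := by positivity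
  -- the primitive
  have hfin : ∀ t, prim G t ≠ ∞ := fun t => by
    refine ne_top_of_le_ne_top ?_ (setLIntegral_mono' (s := Ioc 0 t) measurableSet_Ioc
      fun y _ => hGC y)
    rw [setLIntegral_const, Real.volume_Ioc]
    exact ENNReal.mul_ne_top ENNReal.ofReal_ne_top ENNReal.ofReal_ne_top
  set F := fun t => (prim G t).toReal with hF
  have hFpos : ∀ t > 0, 0 < F t := fun t ht => ENNReal.toReal_pos (hpos t ht).ne' (hfin t)
  have hF1 : ∀ t > 0, F t ≤ C * t := fun t ht => by
    refine ENNReal.toReal_le_of_le_ofReal (by positivity) ?_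
    refine (setLIntegral_mono' (s := Ioc 0 t) measurableSet_Ioc fun y _ => hGC y).trans ?_
    rw [setLIntegral_const, Real.volume_Ioc, ENNReal.ofReal_mul hC.le, sub_zero]
  have hF2 : ∀ t > 0, F t ≤ C * R := fun t ht => by
    rcases le_total t R with h | h
    · exact (hF1 t ht).trans (by gcongr)
    · have : prim G t = prim G R := by
        rw [prim, prim, ← Ioc_union_Ioc_eq_Ioc hR.le h, lintegral_union measurableSet_Ioc
          (Ioc_disjoint_Ioc_of_le le_rfl), setLIntegral_eq_zero measurableSet_Ioc
          (fun y hy => hGR y hy.1), add_zero]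
      rw [hF]; simp only; rw [this]; exact hF1 R hR
  have hFcont : ContinuousOn F (Ioi 0) := fun t _ =>
    ((continuousOn_prim_toReal hG (hfin (t + 1))).continuousAt
      (Iic_mem_nhds (by linarith))).continuousWithinAt
  have hFmeas : Measurable F := (measurable_prim G).ennreal_toReal
  set a₀ := fun t => F t ^ q * t ^ (-s) with ha₀
  have ha₀pos : ∀ t > 0, 0 < a₀ t := fun t ht =>
    mul_pos (Real.rpow_pos_of_pos (hFpos t ht) _) (Real.rpow_pos_of_pos ht _)
  have hid : ∀ b : ℝ, ContinuousOn (fun t : ℝ => t ^ b) (Ioi 0) := fun b t ht =>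
    (Real.continuousAt_rpow_const t b (Or.inl (ne_of_gt ht))).continuousWithinAt
  have ha₀cont : ContinuousOn a₀ (Ioi 0) :=
    (hFcont.rpow_const fun t _ => Or.inr hq0.le).mul (hid _)
  -- Near 0 the bound F ≤ C t leaves the exponent q - s = r > -1; near infinity F is bounded and -s
  -- < -1.
  have ha₀int : IntegrableOn a₀ (Ioi 0) := by
    rw [← Ioc_union_Ioi_eq_Ioi zero_le_one]
    have hm1 := (ha₀cont.mono (fun t ht => ht.1 : Ioc (0 : ℝ) 1 ⊆ Ioi 0)).aestronglyMeasurable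
      (μ := volume) measurableSet_Ioc
    have hm2 := (ha₀cont.mono (Ioi_subset_Ioi zero_le_one)).aestronglyMeasurable
      (μ := volume) measurableSet_Ioi
    refine IntegrableOn.union ?_ ?_
    · have hi : IntegrableOn (fun t : ℝ => C ^ q * t ^ r) (Ioc 0 1) :=
        (intervalIntegral.intervalIntegrable_rpow' (a := 0) (b := 1)
          (by linarith : -1 < r)).1.const_mul _
      refine Integrable.mono' hi hm1 (ae_restrict_of_forall_mem measurableSet_Ioc fun t ht => ?_)
      rw [Real.norm_of_nonneg (ha₀pos t ht.1).le]
      calc F t ^ q * t ^ (-s) ≤ (C * t) ^ q * t ^ (-s) := by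
            have := Real.rpow_nonneg ht.1.le (-s)
            have := (hFpos t ht.1).le
            gcongr
            exact hF1 t ht.1
        _ = C ^ q * t ^ r := by
            rw [Real.mul_rpow hC.le ht.1.le, mul_assoc, ← Real.rpow_add ht.1]
            congr 2; linarith
    · have hi : IntegrableOn (fun t : ℝ => (C * R) ^ q * t ^ (-s)) (Ioi 1) :=
        (integrableOn_Ioi_rpow_of_lt (by linarith) zero_lt_one).const_mul _
      refine Integrable.mono' hi hm2 (ae_restrict_of_forall_mem measurableSet_Ioi fun t ht => ?_)
      have ht0 : 0 < t := lt_trans zero_lt_one ht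
      rw [Real.norm_of_nonneg (ha₀pos t ht0).le]
      have := Real.rpow_nonneg ht0.le (-s)
      have := (hFpos t ht0).le
      simp only [ha₀]
      gcongr
      exact hF2 t ht0
  set I := ∫ t in Ioi 0, a₀ t with hI
  have hIpos : 0 < I := by
    rw [hI, setIntegral_pos_iff_support_of_nonneg_ae
      (ae_restrict_of_forall_mem measurableSet_Ioi fun t ht => (ha₀pos t ht).le) ha₀int]
    have : Function.support a₀ ∩ Ioi 0 = Ioi 0 :=
      inter_eq_right.2 fun t ht => (ha₀pos t ht).ne'
    rw [this]; simp
  have hIl : ∫⁻ t in Ioi 0, ENNReal.ofReal (a₀ t) = ENNReal.ofReal I :=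
    (ofReal_integral_eq_lintegral_ofReal ha₀int
      (ae_restrict_of_forall_mem measurableSet_Ioi fun t ht => (ha₀pos t ht).le)).symm
  -- The normalisation that gives the two densities the same mass.
  set c := M / I with hc
  have hc0 : 0 < c := by positivity
  -- the extremal density
  set e := fun u : ℝ => u ^ r * (1 + u ^ r) ^ (-n) with he
  have hepos : ∀ u > 0, 0 < e u := fun u hu => by
    have := Real.rpow_pos_of_pos hu r
    simp only [he]; positivity
  have hecont : ContinuousOn e (Ioi 0) := by
    refine (hid r).mul ((continuousOn_const.add (hid r)).rpow_const fun t ht => Or.inl ?_)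
    exact (add_pos one_pos (Real.rpow_pos_of_pos ht r)).ne'
  obtain ⟨heint, heM⟩ := integrableOn_of_lintegral_eq measurableSet_Ioi hecont
    (fun u hu => (hepos u hu).le) hMpos.le hMint
  obtain ⟨T, hTpos, hTder, hTinj, hTim⟩ := exists_transport (a := fun t => c * a₀ t)
    (continuousOn_const.mul ha₀cont) (ha₀int.const_mul c)
    (fun t ht => mul_pos hc0 (ha₀pos t ht)) hecont heint hepos (by
      rw [integral_const_mul, heM, ← hI, hc]; field_simp)
  have hTcont : ContinuousOn T (Ioi 0) := fun t ht => (hTder t ht).continuousAt.continuousWithinAt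
  -- change of variables
  have hcv : ∀ g : ℝ → ℝ, (∀ u > 0, 0 ≤ g u) →
      ∫⁻ t in Ioi 0, ENNReal.ofReal (a₀ t * g (T t)) =
        ENNReal.ofReal (1 / c) * ∫⁻ u in Ioi 0, ENNReal.ofReal (e u * g u) := by
    intro g hg
    have := lintegral_image_eq_lintegral_abs_deriv_mul measurableSet_Ioi
      (fun t ht => (hTder t ht).hasDerivWithinAt) hTinj (fun u => ENNReal.ofReal (e u * g u))
    rw [hTim] at this
    rw [this, ← lintegral_const_mul' _ _ ENNReal.ofReal_ne_top]
    refine setLIntegral_congr_fun measurableSet_Ioi fun t ht => ?_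
    have h1 := ha₀pos t ht
    have h2 := hepos _ (hTpos t ht)
    have h3 := hg _ (hTpos t ht)
    rw [abs_of_nonneg (by positivity), ← ENNReal.ofReal_mul (by positivity),
      ← ENNReal.ofReal_mul (by positivity)]
    congr 1
    field_simp
  have hJ2 : ∫⁻ t in Ioi 0, ENNReal.ofReal (a₀ t * T t ^ (-r)) = ENNReal.ofReal (N / c) := by
    rw [hcv (fun u => u ^ (-r)) (fun u hu => Real.rpow_nonneg (le_of_lt hu) _),
      show N / c = 1 / c * N by ring, ENNReal.ofReal_mul (by positivity), ← hNint]
    congr 1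
    refine setLIntegral_congr_fun measurableSet_Ioi fun u hu => ?_
    have : u ^ r * u ^ (-r) = 1 := by rw [← Real.rpow_add hu]; simp
    simp only [he]
    rw [mul_right_comm, this, one_mul]
  have hJ1 : ∫⁻ t in Ioi 0, ENNReal.ofReal (a₀ t * (1 + T t ^ (-r))) =
      ENNReal.ofReal ((M + N) / c) := by
    have hm : AEMeasurable (fun t => ENNReal.ofReal (a₀ t)) (volume.restrict (Ioi 0)) :=
      (ha₀cont.aemeasurable measurableSet_Ioi).ennreal_ofReal
    rw [add_div, ENNReal.ofReal_add (by positivity) (by positivity), ← hJ2,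
      show M / c = I by rw [hc]; field_simp, ← hIl, ← lintegral_add_left' hm]
    refine setLIntegral_congr_fun measurableSet_Ioi fun t ht => ?_
    have h1 := ha₀pos t ht
    have h2 := Real.rpow_nonneg (hTpos t ht).le (-r)
    rw [← ENNReal.ofReal_add (by positivity) (by positivity), mul_add, mul_one]
  -- the weight
  set P := fun t => T t ^ (-κ) * t ^ (-(s - 1 - κ)) with hP
  -- The exponents in `P` do two jobs: its negative derivative is κ times the expression multiplying
  -- F^s in `transport_pointwise`, up to the factor 1/n, and (F^{s-1} P)^{p*} equals F^q t^{-s}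
  -- T^{-r}, whose integral is known by change of variables.
  set D := fun t => κ * (T t ^ (-κ) * t ^ (κ - s) *
    (t * (c * a₀ t / e (T t)) / T t + (n - 1))) with hD
  have hPpos : ∀ t > 0, 0 < P t := fun t ht => mul_pos (Real.rpow_pos_of_pos (hTpos t ht) _)
    (Real.rpow_pos_of_pos ht _)
  have hDpos : ∀ t > 0, 0 ≤ D t := fun t ht => by
    have h1 := ha₀pos t ht
    have h2 := hTpos t ht
    have h3 := hepos _ h2
    have h4 : 0 < n - 1 := by linarith
    have h5 : 0 < t := ht
    simp only [hD]; positivity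
  have hPder : ∀ t > 0, HasDerivAt P (-D t) t := fun t ht => by
    have ht0 : 0 < t := ht
    have h2 := hTpos t ht
    have d1 := (hTder t ht).rpow_const (p := -κ) (Or.inl h2.ne')
    have d2 := Real.hasDerivAt_rpow_const (x := t) (p := -(s - 1 - κ)) (Or.inl ht0.ne')
    refine (d1.mul d2).congr_deriv ?_
    have e1 : T t ^ (-κ - 1) = T t ^ (-κ) / T t := by rw [Real.rpow_sub h2, Real.rpow_one]
    have e2 : t ^ (-(s - 1 - κ)) = t ^ (κ - s) * t := by
      rw [show -(s - 1 - κ) = κ - s + 1 by ring, Real.rpow_add ht0, Real.rpow_one]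
    have e3 : -(s - 1 - κ) - 1 = κ - s := by ring
    have e4 : s - 1 - κ = κ * (n - 1) := by
      rw [← i2]; field_simp
    rw [e3, e1, e2, e4]
    simp only [hD]
    ring
  have hDP : ∀ y > 0, ∫⁻ t in Ioi y, ENNReal.ofReal (-deriv P t) ≤ ENNReal.ofReal (P y) := by
    intro y hy
    refine le_trans (le_of_eq ?_) (lintegral_Ioi_le_of_hasDerivAt hPder hDpos
      (fun t ht => (hPpos t ht).le) hy)
    refine setLIntegral_congr_fun measurableSet_Ioi fun t ht => ?_
    rw [(hPder t (lt_trans hy ht)).deriv, neg_neg]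
  have hton := lintegral_prim_rpow_mul_le hG hfin (s := s) (by linarith)
    (measurable_deriv P).neg.ennreal_ofReal hDP
  have hPcont : ContinuousOn P (Ioi 0) := fun t ht => (hPder t ht).continuousAt.continuousWithinAt
  set X := (∫⁻ t in Ioi 0, G t ^ p) ^ (1 / p) with hX
  have hhol : ∫⁻ y in Ioi 0, G y * (ENNReal.ofReal (F y ^ (s - 1)) * ENNReal.ofReal (P y)) ≤
      X * ENNReal.ofReal (N / c) ^ (1 / pStar p) := by
    refine (ENNReal.lintegral_mul_le_Lp_mul_Lq _ hconj hG.aemeasurable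
      ((hFmeas.pow_const _).ennreal_ofReal.aemeasurable.mul
        (hPcont.aemeasurable measurableSet_Ioi).ennreal_ofReal)).trans (le_of_eq ?_)
    rw [← hJ2]
    congr 2
    refine setLIntegral_congr_fun measurableSet_Ioi fun t ht => ?_
    have ht0 : (0 : ℝ) < t := ht
    have h1 := hFpos t ht
    have h2 := hTpos t ht
    have h3 := hPpos t ht
    rw [Pi.mul_apply, ← ENNReal.ofReal_mul (by positivity), ENNReal.ofReal_rpow_of_nonneg (by positivity)
      hpsp.le]
    congr 1
    simp only [hP, ha₀]
    rw [Real.mul_rpow (by positivity) (by positivity), Real.mul_rpow (by positivity)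
      (by positivity), ← Real.rpow_mul h1.le, ← Real.rpow_mul h2.le, ← Real.rpow_mul ht0.le]
    have e1 : (s - 1) * pStar p = q := by rw [hs]; field_simp; ring
    have e2 : -κ * pStar p = -r := by rw [hκ]; field_simp
    have e3 : -(s - 1 - κ) * pStar p = -s := by
      rw [show -(s - 1 - κ) * pStar p = -((s - 1) * pStar p) - -κ * pStar p by ring, e1, e2, hs']
      ring
    rw [e1, e2, e3]; ring
  -- integrate the pointwise inequality
  have hpw : ENNReal.ofReal (c ^ (1 / n)) * ENNReal.ofReal ((M + N) / c) ≤
      ENNReal.ofReal (1 / (n * κ)) *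
        (ENNReal.ofReal s * (X * ENNReal.ofReal (N / c) ^ (1 / pStar p))) := by
    refine le_trans ?_ (mul_le_mul' le_rfl (hton.trans (mul_le_mul' le_rfl hhol)))
    rw [← hJ1, ← lintegral_const_mul' _ _ ENNReal.ofReal_ne_top,
      ← lintegral_const_mul' _ _ ENNReal.ofReal_ne_top]
    refine setLIntegral_mono' measurableSet_Ioi fun t ht => ?_
    have h1 := hFpos t ht
    have h2 := hDpos t ht
    rw [Pi.neg_apply, (hPder t ht).deriv, neg_neg, ← ENNReal.ofReal_mul (by positivity),
      ← ENNReal.ofReal_mul (by positivity), ← ENNReal.ofReal_mul (by positivity)]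
    refine ENNReal.ofReal_le_ofReal ((transport_pointwise hn1.le i1 i2 i3 hs' hc0 h1 ht
      (hTpos t ht)).trans (le_of_eq ?_))
    simp only [hD, ha₀, he, hF]
    field_simp
  rcases eq_or_ne (∫⁻ t in Ioi 0, G t ^ p) ∞ with hinf | hninf
  · rw [hinf, ENNReal.top_rpow_of_pos (by positivity), ENNReal.mul_top]
    · exact le_top
    · simp only [ne_eq, ENNReal.ofReal_eq_zero, not_le]; positivity
  set Y := (∫⁻ t in Ioi 0, G t ^ p).toReal with hY
  have hYe : ∫⁻ t in Ioi 0, G t ^ p = ENNReal.ofReal Y := (ENNReal.ofReal_toReal hninf).symm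
  have hY0 : 0 ≤ Y := ENNReal.toReal_nonneg
  have hre : c ^ (1 / n) * ((M + N) / c) ≤
      1 / (n * κ) * (s * (Y ^ (1 / p) * (N / c) ^ (1 / pStar p))) := by
    rw [hX, hYe, ENNReal.ofReal_rpow_of_nonneg hY0 (by positivity),
      ENNReal.ofReal_rpow_of_nonneg (by positivity) (by positivity),
      ← ENNReal.ofReal_mul (by positivity), ← ENNReal.ofReal_mul (by positivity),
      ← ENNReal.ofReal_mul (by positivity), ← ENNReal.ofReal_mul (by positivity)] at hpw
    exact (ENNReal.ofReal_le_ofReal_iff (by positivity)).1 hpw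
  have hnκ : n * κ = s - 1 := by rw [← i2]; field_simp
  -- Since nκ = s - 1 and M/N = 1/(s - 1), the factor s/(s - 1) appears on both sides and cancels,
  -- so no constant is lost.
  have hMN : M + N = N * (s / (s - 1)) := by
    have : pStar p / q = 1 / (s - 1) := by
      rw [show s - 1 = q / pStar p by rw [hs]; ring, one_div_div]
    have h1 : s - 1 ≠ 0 := by linarith
    rw [hM, this]; field_simp; ring
  rw [hnκ, hMN] at hre
  have hss : 0 < s / (s - 1) := div_pos (by linarith) (by linarith)
  have hre2 : c ^ (1 / n) * (N / c) ≤ Y ^ (1 / p) * (N / c) ^ (1 / pStar p) := by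
    have : (s / (s - 1)) * (c ^ (1 / n) * (N / c)) ≤
        (s / (s - 1)) * (Y ^ (1 / p) * (N / c) ^ (1 / pStar p)) := by
      calc _ = c ^ (1 / n) * (N * (s / (s - 1)) / c) := by ring
        _ ≤ _ := hre
        _ = _ := by ring
    exact le_of_mul_le_mul_left this hss
  have hre3 : c ^ (1 / n) * (N / c) ^ (1 / p) ≤ Y ^ (1 / p) := by
    have hz : 0 < (N / c) ^ (1 / pStar p) := by positivity
    refine le_of_mul_le_mul_right ?_ hz
    refine le_trans (le_of_eq ?_) hre2
    have h1 : 1 / p + 1 / pStar p = 1 := by rw [one_div, one_div, hconj.inv_add_inv_eq_one]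
    rw [mul_assoc, ← Real.rpow_add (by positivity), h1, Real.rpow_one]
  -- Raising to the power q gives c^{q/n} = c^{q/p-1}, so exactly one power of 1/c = I/M survives.
  have hre4 : c⁻¹ * N ^ (q / p) ≤ Y ^ (q / p) := by
    have := Real.rpow_le_rpow (by positivity) hre3 hq0.le
    rw [← Real.rpow_mul hY0, Real.mul_rpow (by positivity) (by positivity),
      ← Real.rpow_mul hc0.le, ← Real.rpow_mul (by positivity), one_div_mul_eq_div,
      one_div_mul_eq_div, Real.div_rpow hNpos.le hc0.le] at this
    refine le_trans (le_of_eq ?_) this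
    have e1 : q / n = r := by rw [← i1]; ring
    rw [e1, hrdef, Real.rpow_sub hc0, Real.rpow_one]
    have : 0 < c ^ (q / p) := by positivity
    field_simp
  have hfinal : I ≤ pStar p / q * N ^ (1 - q / p) * Y ^ (q / p) := by
    have e1 : I = M * c⁻¹ := by rw [hc]; field_simp
    rw [e1, hM, Real.rpow_sub hNpos, Real.rpow_one]
    have hz : 0 < N ^ (q / p) := by positivity
    calc pStar p / q * N * c⁻¹ = pStar p / q * (N / N ^ (q / p)) * (c⁻¹ * N ^ (q / p)) := by
          field_simp
      _ ≤ _ := by gcongr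
  rw [hIl, hYe, ENNReal.ofReal_rpow_of_nonneg hY0 (by positivity),
    ← ENNReal.ofReal_mul (by positivity)]
  exact ENNReal.ofReal_le_ofReal hfinal

variable {p q : ℝ}

/-- **Bliss' inequality** with the sharp constant. -/
theorem bliss (hp : 1 < p) (hpq : p < q) {G : ℝ → ℝ≥0∞} (hG : Measurable G) :
    ∫⁻ t in Ioi 0, prim G t ^ q * ENNReal.ofReal (t ^ (-(q / pStar p + 1))) ≤
      ENNReal.ofReal (pStar p / q * blissInt q p ^ (1 - q / p)) *
        (∫⁻ t in Ioi 0, G t ^ p) ^ (q / p) := by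
  have hp0 : 0 < p := by linarith
  have hq0 : 0 < q := by linarith
  set K := ENNReal.ofReal (pStar p / q * blissInt q p ^ (1 - q / p)) with hK
  set X := (∫⁻ t in Ioi 0, G t ^ p) ^ (1 / p) with hX
  have hXq : (∫⁻ t in Ioi 0, G t ^ p) ^ (q / p) = X ^ q := by
    rw [hX, ← ENNReal.rpow_mul]; congr 1; ring
  rw [hXq]
  -- Truncations in height and support, to which the bounded case applies; monotone convergence
  -- removes them at the end.
  let H : ℕ → ℝ → ℝ≥0∞ := fun k => (Iic (k : ℝ)).indicator fun y => min (G y) k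
  have hHm : ∀ k, Measurable (H k) := fun k =>
    (hG.min measurable_const).indicator measurableSet_Iic
  have hHG : ∀ k y, H k y ≤ G y := fun k y => by
    by_cases h : y ∈ Iic (k : ℝ) <;> simp [H, h]
  have hHmono : Monotone H := by
    intro i j hij y
    have hc : (i : ℝ) ≤ j := by exact_mod_cast hij
    by_cases h : y ≤ (i : ℝ)
    · simp only [H, indicator, mem_Iic, h, h.trans hc, if_true]
      exact min_le_min le_rfl (by exact_mod_cast hij)
    · simp [H, indicator, h]
  have hHsup : ∀ y, ⨆ k, H k y = G y := by
    intro y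
    refine le_antisymm (iSup_le fun k => hHG k y) (le_of_forall_lt fun c hc => ?_)
    obtain ⟨i, hi⟩ := ENNReal.exists_nat_gt (ne_top_of_lt hc)
    obtain ⟨j, hj⟩ := exists_nat_ge y
    refine lt_of_lt_of_le ?_ (le_iSup _ (max i j))
    have h : y ≤ ((max i j : ℕ) : ℝ) := hj.trans (by exact_mod_cast le_max_right i j)
    simp only [H, indicator, mem_Iic, h, if_true]
    exact lt_min hc (hi.trans_le (by exact_mod_cast le_max_left i j))
  have hprim : ∀ t, prim G t = ⨆ k, prim (H k) t := fun t => by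
    rw [prim, ← funext hHsup, lintegral_iSup hHm hHmono]; rfl
  have hw : Measurable fun t : ℝ => ENNReal.ofReal (t ^ (-(q / pStar p + 1))) := by fun_prop
  have key : ∀ k, ∫⁻ t in Ioi 0, prim (H k) t ^ q * ENNReal.ofReal (t ^ (-(q / pStar p + 1))) ≤
      K * X ^ q := by
    intro k
    have hε : ∀ ε : ℝ, 0 < ε → ∫⁻ t in Ioi 0, prim (H k) t ^ q *
        ENNReal.ofReal (t ^ (-(q / pStar p + 1))) ≤ K * (X + ENNReal.ofReal ε) ^ q := by
      intro ε hε
      -- A small bump at the origin makes the primitive positive everywhere. It costs at most ε in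
      -- the L^p norm and is removed by letting ε tend to 0.
      set E : ℝ → ℝ≥0∞ := (Ioc (0 : ℝ) 1).indicator fun _ => ENNReal.ofReal ε with hE
      have hEm : Measurable E := measurable_const.indicator measurableSet_Ioc
      set Q : ℝ → ℝ≥0∞ := H k + E with hQ
      have hQm : Measurable Q := (hHm k).add hEm
      have hQC : ∀ y, Q y ≤ ENNReal.ofReal (k + ε) := by
        intro y
        rw [ENNReal.ofReal_add (by positivity) hε.le]
        refine add_le_add ?_ ?_
        · by_cases h : y ∈ Iic (k : ℝ) <;> simp [H, h]
        · by_cases h : y ∈ Ioc (0 : ℝ) 1 <;> simp [hE, h]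
      have hQR : ∀ y > max (k : ℝ) 1, Q y = 0 := by
        intro y hy
        have h1 : ¬ y ≤ (k : ℝ) := not_le.2 (lt_of_le_of_lt (le_max_left _ _) hy)
        have h2 : ¬ y ≤ 1 := not_le.2 (lt_of_le_of_lt (le_max_right _ _) hy)
        simp [hQ, H, hE, indicator, h1, h2]
      have hQpos : ∀ t > 0, 0 < prim Q t := by
        intro t ht
        have ht1 : 0 < min t 1 := lt_min ht one_pos
        calc 0 < ENNReal.ofReal ε * ENNReal.ofReal (min t 1) := by
              refine ENNReal.mul_pos ?_ ?_ <;> simpa using by assumption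
          _ = ∫⁻ y in Ioc 0 (min t 1), ENNReal.ofReal ε := by simp
          _ ≤ ∫⁻ y in Ioc 0 (min t 1), Q y := by
              refine setLIntegral_mono' measurableSet_Ioc fun y hy => ?_
              have h : 0 < y ∧ y ≤ 1 := ⟨hy.1, hy.2.trans (min_le_right _ _)⟩
              simp [hQ, hE, indicator, h]
          _ ≤ prim Q t := prim_mono Q (min_le_left _ _)
      have hfin : ∀ t, prim Q t ≠ ∞ := fun t => by
        refine ne_top_of_le_ne_top ?_ (setLIntegral_mono' (s := Ioc 0 t) measurableSet_Ioc
          fun y _ => hQC y)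
        rw [setLIntegral_const, Real.volume_Ioc]
        exact ENNReal.mul_ne_top ENNReal.ofReal_ne_top ENNReal.ofReal_ne_top
      have hb := bliss_of_bounded hp hpq hQm (by positivity) (by positivity) hQC hQR hQpos
      rw [← hK] at hb
      calc _ ≤ ∫⁻ t in Ioi 0, ENNReal.ofReal ((prim Q t).toReal ^ q *
            t ^ (-(q / pStar p + 1))) := by
            refine setLIntegral_mono' measurableSet_Ioi fun t ht => ?_
            rw [ENNReal.ofReal_mul (by positivity), ← ENNReal.ofReal_rpow_of_nonneg (by positivity)
              hq0.le, ENNReal.ofReal_toReal (hfin t)]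
            gcongr
            exact lintegral_mono fun y => le_self_add
        _ ≤ K * (∫⁻ t in Ioi 0, Q t ^ p) ^ (q / p) := hb
        _ = K * ((∫⁻ t in Ioi 0, Q t ^ p) ^ (1 / p)) ^ q := by
            rw [← ENNReal.rpow_mul, one_div_mul_eq_div]
        _ ≤ K * (X + ENNReal.ofReal ε) ^ q := by
            gcongr
            refine (ENNReal.lintegral_Lp_add_le (hHm k).aemeasurable hEm.aemeasurable hp.le).trans
              (add_le_add ?_ ?_)
            · rw [hX]; gcongr; exact hHG k _
            · have : ∀ y, E y ^ p = (Ioc (0 : ℝ) 1).indicator (fun _ => ENNReal.ofReal ε ^ p) y := by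
                intro y; by_cases h : y ∈ Ioc (0 : ℝ) 1 <;> simp [hE, h, hp0]
              simp_rw [this]
              rw [lintegral_indicator_const measurableSet_Ioc]
              have h1 : (volume.restrict (Ioi (0 : ℝ))) (Ioc 0 1) ≤ 1 :=
                (Measure.restrict_le_self _).trans (by simp)
              calc _ ≤ (ENNReal.ofReal ε ^ p * 1) ^ (1 / p) := by gcongr
                _ = ENNReal.ofReal ε := by
                  rw [mul_one, ← ENNReal.rpow_mul, mul_one_div_cancel hp0.ne', ENNReal.rpow_one]
    have hlim : Filter.Tendsto (fun ε : ℝ => K * (X + ENNReal.ofReal ε) ^ q)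
        (nhdsWithin 0 (Ioi 0)) (nhds (K * (X + ENNReal.ofReal 0) ^ q)) := by
      refine Filter.Tendsto.mono_left ?_ nhdsWithin_le_nhds
      refine ENNReal.Tendsto.const_mul ?_ (Or.inr ENNReal.ofReal_ne_top)
      exact ((ENNReal.continuous_rpow_const.comp
        (continuous_const.add ENNReal.continuous_ofReal)).tendsto 0)
    rw [ENNReal.ofReal_zero, add_zero] at hlim
    exact ge_of_tendsto hlim (by filter_upwards [self_mem_nhdsWithin] with ε h using hε ε h)
  have hmonoP : Monotone fun k t => prim (H k) t := fun i j hij t =>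
    lintegral_mono (hHmono hij)
  calc ∫⁻ t in Ioi 0, prim G t ^ q * ENNReal.ofReal (t ^ (-(q / pStar p + 1)))
      = ∫⁻ t in Ioi 0, ⨆ k, prim (H k) t ^ q * ENNReal.ofReal (t ^ (-(q / pStar p + 1))) := by
        refine lintegral_congr fun t => ?_
        rw [← ENNReal.iSup_mul, hprim]
        congr 1
        exact (ENNReal.orderIsoRpow q hq0).map_iSup _
    _ = ⨆ k, ∫⁻ t in Ioi 0, prim (H k) t ^ q * ENNReal.ofReal (t ^ (-(q / pStar p + 1))) := by
        refine lintegral_iSup (fun k => ((measurable_prim _).pow_const q).mul hw) ?_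
        intro i j hij t
        simp only
        gcongr
        exact hmonoP hij t
    _ ≤ K * X ^ q := iSup_le key

/-- The sharp constant in terms of `blissInt`. -/
theorem kConst_rpow (hp : 1 < p) (hpq : p < q) :
    kConst q p ^ q = blissInt q p ^ (1 - q / p) := by
  have hp0 : 0 < p := by linarith
  have hq0 : 0 < q := by linarith
  have hqp : 0 < q - p := by linarith
  have hr : 0 < q / p - 1 := by rw [sub_pos, one_lt_div hp0]; exact hpq
  have e1 : 1 / (q / p - 1) = p / (q - p) := by field_simp
  have e2 : q / (q / p - 1) - 1 / (q / p - 1) = p * (q - 1) / (q - p) := by field_simp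
  have e3 : p * q / (q - p) = p / (q - p) + p * (q - 1) / (q - p) := by field_simp; ring
  have e4 : q / (q - p) = p / (q - p) + 1 := by field_simp; ring
  have e5 : p * (q - 1) / (q - p) = p * (q - 1) / (q - p) := rfl
  have ha : 0 < p / (q - p) := by positivity
  have hb : 0 < p * (q - 1) / (q - p) := by
    have : 0 < q - 1 := by linarith
    positivity
  have hbl : blissInt q p = (Real.Gamma (p * q / (q - p)) /
      (Real.Gamma (q / (q - p)) * Real.Gamma (p * (q - 1) / (q - p))))⁻¹ := by
    rw [blissInt, ProbabilityTheory.beta, e2, e1, ← e3, e4, Real.Gamma_add_one ha.ne', inv_div]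
    have : q / p - 1 = (p / (q - p))⁻¹ := by rw [← e1, one_div, inv_inv]
    rw [this, div_inv_eq_mul]; ring
  have hg1 := Real.Gamma_pos_of_pos ha
  have hg2 := Real.Gamma_pos_of_pos hb
  have hg3 := Real.Gamma_pos_of_pos (show 0 < p * q / (q - p) by positivity)
  have hg4 := Real.Gamma_pos_of_pos (show 0 < q / (q - p) by positivity)
  rw [kConst, if_pos hpq, hbl, ← Real.rpow_mul (by positivity), Real.inv_rpow (by positivity),
    ← Real.rpow_neg (by positivity)]
  congr 1
  field_simp
  ring

theorem kConst_pos (hp : 1 < p) (hpq : p ≤ q) : 0 < kConst q p := by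
  have hp0 : 0 < p := by linarith
  have hq0 : 0 < q := by linarith
  have hps : pStar p = p / (p - 1) := rfl
  have hp1 : 0 < p - 1 := by linarith
  have hpsp : 0 < pStar p := by rw [hps]; positivity
  rw [kConst]
  split_ifs with h
  · have hqp : 0 < q - p := by linarith
    have hq1 : 0 < q - 1 := by linarith
    have hg3 := Real.Gamma_pos_of_pos (show 0 < p * q / (q - p) by positivity)
    have hg4 := Real.Gamma_pos_of_pos (show 0 < q / (q - p) by positivity)
    have hg2 := Real.Gamma_pos_of_pos (show 0 < p * (q - 1) / (q - p) by positivity)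
    positivity
  · positivity

/-! ### The interval (0, D) and its exhaustion -/

section openInt

variable {D : EReal}

theorem isOpen_openInt (a b : EReal) : IsOpen (openInt a b) :=
  (isOpen_lt continuous_const continuous_coe_real_ereal).inter
    (isOpen_lt continuous_coe_real_ereal continuous_const)

theorem measurableSet_openInt (a b : EReal) : MeasurableSet (openInt a b) :=
  (isOpen_openInt a b).measurableSet

theorem mem_openInt_coe {a x : ℝ} : x ∈ openInt (a : EReal) D ↔ a < x ∧ (x : EReal) < D := by
  rw [openInt, mem_ofPred_eq, EReal.coe_lt_coe_iff]

theorem mem_openInt_zero {x : ℝ} : x ∈ openInt 0 D ↔ 0 < x ∧ (x : EReal) < D := by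
  rw [← EReal.coe_zero, mem_openInt_coe]

theorem mem_openInt_of_le {x y : ℝ} (hy : y ∈ openInt 0 D) (hx : 0 < x) (hxy : x ≤ y) :
    x ∈ openInt 0 D := by
  rw [mem_openInt_zero] at *
  exact ⟨hx, lt_of_le_of_lt (EReal.coe_le_coe_iff.2 hxy) hy.2⟩

theorem Ioc_subset_openInt {T : ℝ} (hT : T ∈ openInt 0 D) : Ioc 0 T ⊆ openInt 0 D := fun _ hy =>
  mem_openInt_of_le hT hy.1 hy.2

theorem openInt_subset_openInt {y : ℝ} (hy : 0 ≤ y) :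
    openInt (y : EReal) D ⊆ openInt 0 D := fun x hx => by
  rw [mem_openInt_coe] at hx
  exact mem_openInt_zero.2 ⟨lt_of_le_of_lt hy hx.1, hx.2⟩

theorem Ioi_inter_openInt {y : ℝ} (hy : 0 ≤ y) : Ioi y ∩ openInt 0 D = openInt (y : EReal) D := by
  ext x
  rw [mem_inter_iff, mem_Ioi, mem_openInt_zero, mem_openInt_coe]
  exact ⟨fun h => ⟨h.1, h.2.2⟩, fun h => ⟨h.1, lt_of_le_of_lt hy h.1, h.2⟩⟩

/-- Finiteness of φ is assumed only at interior points, so statements on (0, D) are proved on the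
intervals (0, u n] and passed to the limit. This also treats finite and infinite `D` at once. -/
theorem exists_seq_openInt (hD : 0 < D) :
    ∃ u : ℕ → ℝ, Monotone u ∧ (∀ n, u n ∈ openInt 0 D) ∧ ∀ x ∈ openInt 0 D, ∃ n, x < u n := by
  induction D with
  | bot => simp at hD
  | top =>
    refine ⟨fun n : ℕ => (n : ℝ) + 1, fun i j hij => by simp only; gcongr, fun n => ?_, fun x _ => ?_⟩
    · exact mem_openInt_zero.2 ⟨by positivity, EReal.coe_lt_top _⟩
    · obtain ⟨n, hn⟩ := exists_nat_gt x
      exact ⟨n, by linarith⟩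
  | coe d =>
    have hd : 0 < d := by exact_mod_cast hD
    refine ⟨fun n : ℕ => d - d / ((n : ℝ) + 2), fun i j hij => ?_, fun n => ?_, fun x hx => ?_⟩
    · simp only; gcongr
    · have h1 : d / (n + 2 : ℝ) < d := by
        rw [div_lt_iff₀ (by positivity)]; nlinarith [(Nat.cast_nonneg n : (0 : ℝ) ≤ n)]
      have h2 : 0 < d / (n + 2 : ℝ) := by positivity
      exact mem_openInt_zero.2 ⟨by linarith, EReal.coe_lt_coe_iff.2 (by linarith)⟩
    · have hx' := mem_openInt_zero.1 hx
      have hxd : x < d := by exact_mod_cast hx'.2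
      obtain ⟨n, hn⟩ := exists_nat_gt (d / (d - x))
      refine ⟨n, ?_⟩
      rw [div_lt_iff₀ (sub_pos.2 hxd)] at hn
      have : d / (n + 2 : ℝ) < d - x := by
        rw [div_lt_iff₀ (by positivity)]; nlinarith
      linarith

theorem lintegral_openInt_of_seq {u : ℕ → ℝ} (hmono : Monotone u) (hmem : ∀ n, u n ∈ openInt 0 D)
    (hcof : ∀ x ∈ openInt 0 D, ∃ n, x < u n) (m : Measure ℝ) (f : ℝ → ℝ≥0∞) :
    ∫⁻ x in openInt 0 D, f x ∂m = ⨆ n, ∫⁻ x in Ioc 0 (u n), f x ∂m := by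
  have : openInt 0 D = ⋃ n, Ioc 0 (u n) := by
    ext x
    rw [mem_iUnion]
    constructor
    · intro hx
      obtain ⟨n, hn⟩ := hcof x hx
      exact ⟨n, (mem_openInt_zero.1 hx).1, hn.le⟩
    · rintro ⟨n, hn⟩
      exact Ioc_subset_openInt (hmem n) hn
  have hm : Monotone fun n => Ioc 0 (u n) := fun i j hij => Ioc_subset_Ioc_right (hmono hij)
  rw [this, setLIntegral_iUnion_of_directed _ hm.directed_le]

theorem ae_restrict_openInt {P : ℝ → Prop} {m : Measure ℝ} (hD : 0 < D)
    (h : ∀ T ∈ openInt 0 D, ∀ᵐ x ∂(m.restrict (Ioc 0 T)), P x) :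
    ∀ᵐ x ∂(m.restrict (openInt 0 D)), P x := by
  obtain ⟨u, -, hmem, hcof⟩ := exists_seq_openInt hD
  have : openInt 0 D ⊆ ⋃ n, Ioc 0 (u n) := fun x hx => by
    obtain ⟨n, hn⟩ := hcof x hx
    exact mem_iUnion.2 ⟨n, (mem_openInt_zero.1 hx).1, hn.le⟩
  refine ae_restrict_of_ae_restrict_of_subset this ?_
  rw [ae_restrict_iUnion_iff]
  exact fun n => h _ (hmem n)

end openInt

theorem lrNorm_eq {E : Type*} [ENorm E] (D : EReal) (m : Measure ℝ) {r : ℝ} (hr : 0 < r)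
    (f : ℝ → E) : lrNorm D m r f = (∫⁻ x in openInt 0 D, ‖f x‖ₑ ^ r ∂m) ^ (1 / r) := by
  rw [lrNorm, eLpNorm_eq_lintegral_rpow_enorm_toReal (by simpa using hr) ENNReal.ofReal_ne_top,
    ENNReal.toReal_ofReal hr.le]

/-! ### The weights v and v̂ -/

section Weights

variable {p : ℝ} {ν : Measure ℝ} {D : EReal}

theorem measurable_dens : Measurable (dens ν) := Measure.measurable_rnDeriv _ _

theorem measurable_vhat : Measurable (vhat p ν) := measurable_dens.pow_const _

theorem phi_eq_prim : phi p ν = prim (vhat p ν) := rfl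

theorem phi_mono : Monotone (phi p ν) := prim_mono _

/-- The exponent in v̂ is negative, so positivity amounts to v < ∞, and this holds almost everywhere
because `ν` is σ-finite. -/
theorem ae_vhat_pos (hp : 1 < p) [SigmaFinite ν] : ∀ᵐ x, 0 < vhat p ν x := by
  filter_upwards [Measure.rnDeriv_lt_top ν volume] with x hx
  have hp1 : 0 < 1 / (p - 1) := by have : 0 < p - 1 := by linarith
                                   positivity
  rw [vhat, ENNReal.rpow_neg, ENNReal.inv_pos]
  exact ENNReal.rpow_ne_top_of_nonneg hp1.le hx.ne

theorem ae_vhat_lt_top (hD : 0 < D) (hφ : ∀ x ∈ openInt 0 D, phi p ν x < ∞) :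
    ∀ᵐ x ∂(volume.restrict (openInt 0 D)), vhat p ν x < ∞ :=
  ae_restrict_openInt hD fun T hT => ae_lt_top measurable_vhat (hφ T hT).ne

theorem ae_dens_pos (hp : 1 < p) (hD : 0 < D) (hφ : ∀ x ∈ openInt 0 D, phi p ν x < ∞) :
    ∀ᵐ x ∂(volume.restrict (openInt 0 D)), 0 < dens ν x := by
  filter_upwards [ae_vhat_lt_top hD hφ] with x hx
  have hp1 : 0 < 1 / (p - 1) := by have : 0 < p - 1 := by linarith
                                   positivity
  rw [pos_iff_ne_zero]
  intro h
  rw [vhat, h, ENNReal.rpow_neg, ENNReal.zero_rpow_of_pos hp1] at hx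
  simp at hx

/-- The exponents add up as -p/(p-1) + 1 = -1/(p-1). For this reason v̂ is the natural derivative of
a test function: its p-energy on (0, x] is φ(x). -/
theorem vhat_rpow_mul_dens (hp : 1 < p) {x : ℝ} (h0 : 0 < dens ν x) (h1 : dens ν x < ∞) :
    vhat p ν x ^ p * dens ν x = vhat p ν x := by
  have hp1 : p - 1 ≠ 0 := by linarith
  rw [vhat, ← ENNReal.rpow_mul]
  nth_rw 2 [← ENNReal.rpow_one (dens ν x)]
  rw [← ENNReal.rpow_add _ _ h0.ne' h1.ne]
  congr 1
  field_simp
  ring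

theorem ae_vhat_rpow_mul_dens (hp : 1 < p) [SigmaFinite ν] (hD : 0 < D)
    (hφ : ∀ x ∈ openInt 0 D, phi p ν x < ∞) :
    ∀ᵐ x ∂(volume.restrict (openInt 0 D)), vhat p ν x ^ p * dens ν x = vhat p ν x := by
  filter_upwards [ae_dens_pos hp hD hφ, ae_restrict_of_ae (Measure.rnDeriv_lt_top ν volume)]
    with x h0 h1 using vhat_rpow_mul_dens hp h0 h1

theorem phi_zero : phi p ν 0 = 0 := prim_of_nonpos _ le_rfl

theorem phi_lt_phi (hp : 1 < p) [SigmaFinite ν] {x y : ℝ} (hx : 0 ≤ x) (hxy : x < y)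
    (hfin : phi p ν y < ∞) : phi p ν x < phi p ν y := by
  have hsplit : phi p ν y = phi p ν x + ∫⁻ z in Ioc x y, vhat p ν z := by
    rw [phi, phi, ← Ioc_union_Ioc_eq_Ioc hx hxy.le, lintegral_union measurableSet_Ioc
      (Ioc_disjoint_Ioc_of_le le_rfl)]
  have hpos : 0 < ∫⁻ z in Ioc x y, vhat p ν z := by
    rw [lintegral_pos_iff_support measurable_vhat]
    have : volume.restrict (Ioc x y) (Function.support (vhat p ν)) =
        volume.restrict (Ioc x y) univ :=
      measure_congr (by
        filter_upwards [ae_restrict_of_ae (ae_vhat_pos (ν := ν) hp)] with z hz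
        exact eq_true hz.ne')
    rw [this]
    simpa using hxy
  have hx' : phi p ν x ≠ ∞ := ne_top_of_le_ne_top hfin.ne (phi_mono hxy.le)
  rw [hsplit]
  exact ENNReal.lt_add_right hx' hpos.ne'

theorem phi_pos (hp : 1 < p) [SigmaFinite ν] (hφ : ∀ x ∈ openInt 0 D, phi p ν x < ∞) {x : ℝ}
    (hx : x ∈ openInt 0 D) : 0 < phi p ν x := by
  have := phi_lt_phi hp le_rfl (mem_openInt_zero.1 hx).1 (hφ x hx)
  rwa [phi_zero] at this

end Weights

/-! ### Reduction of the optimal constant to primitives -/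

section OptConst

variable {p q : ℝ} {μ ν : Measure ℝ} {D : EReal}

/-- A weighted Hardy inequality for primitives bounds the optimal constant. -/
theorem optConst_le (hp : 1 < p) (hq : 1 < q) {C : ℝ≥0∞}
    (h : ∀ g : ℝ → ℝ≥0∞, Measurable g → (∫⁻ x in openInt 0 D, prim g x ^ q ∂μ) ^ (1 / q) ≤
      C * (∫⁻ x in openInt 0 D, g x ^ p * dens ν x) ^ (1 / p)) :
    optConst p q D μ ν ≤ C := by
  refine sInf_le fun f hf hf0 => ?_
  have hp0 : 0 < p := by linarith
  have hq0 : 0 < q := by linarith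
  rw [lrNorm_eq D μ hq0, lrNorm_eq D ν hp0]
  have hgm : Measurable fun x => ‖deriv f x‖ₑ := (measurable_deriv f).enorm
  have h1 : ∀ x ∈ openInt 0 D, ‖f x‖ₑ ≤ prim (fun x => ‖deriv f x‖ₑ) x := by
    intro x hx
    have hx' := mem_openInt_zero.1 hx
    have := (hf x hx'.1.le hx'.2.le).integral_deriv_eq_sub
    rw [hf0, sub_zero, intervalIntegral.integral_of_le hx'.1.le] at this
    rw [← this]
    exact enorm_integral_le_lintegral_enorm _
  calc (∫⁻ x in openInt 0 D, ‖f x‖ₑ ^ q ∂μ) ^ (1 / q)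
      ≤ (∫⁻ x in openInt 0 D, prim (fun x => ‖deriv f x‖ₑ) x ^ q ∂μ) ^ (1 / q) := by
        refine ENNReal.rpow_le_rpow (setLIntegral_mono' (measurableSet_openInt _ _) fun x hx => ?_)
          (by positivity)
        exact ENNReal.rpow_le_rpow (h1 x hx) hq0.le
    _ ≤ C * (∫⁻ x in openInt 0 D, ‖deriv f x‖ₑ ^ p * dens ν x) ^ (1 / p) := h _ hgm
    _ ≤ C * (∫⁻ x in openInt 0 D, ‖deriv f x‖ₑ ^ p ∂ν) ^ (1 / p) := by
        refine mul_le_mul' le_rfl (ENNReal.rpow_le_rpow ?_ (by positivity))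
        have h2 : ∫⁻ x in openInt 0 D, ‖deriv f x‖ₑ ^ p * dens ν x =
            ∫⁻ x in openInt 0 D, ‖deriv f x‖ₑ ^ p ∂(volume.withDensity (dens ν)) := by
          rw [restrict_withDensity (measurableSet_openInt _ _),
            lintegral_withDensity_eq_lintegral_mul _ measurable_dens (hgm.pow_const p)]
          simp only [Pi.mul_apply, mul_comm]
        rw [h2]
        exact lintegral_mono' (Measure.restrict_mono_measure (Measure.withDensity_rnDeriv_le ν volume) _)
          le_rfl

theorem lintegral_prim_rpow_eq_zero (hp : 1 < p) (hq0 : 0 < q) (hD : 0 < D)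
    (hφ : ∀ x ∈ openInt 0 D, phi p ν x < ∞) {g : ℝ → ℝ≥0∞} (hg : Measurable g)
    (hY0 : ∫⁻ x in openInt 0 D, g x ^ p * dens ν x = 0) :
    ∫⁻ x in openInt 0 D, prim g x ^ q ∂μ = 0 := by
  have hp0 : 0 < p := by linarith
  have hae : ∀ᵐ x ∂(volume.restrict (openInt 0 D)), g x = 0 := by
    have := (lintegral_eq_zero_iff ((hg.pow_const p).mul measurable_dens)).1 hY0
    filter_upwards [this, ae_dens_pos hp hD hφ] with x hx hx'
    simp only [Pi.mul_apply, Pi.zero_apply, mul_eq_zero, hx'.ne', or_false] at hx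
    exact (ENNReal.rpow_eq_zero_iff_of_pos hp0).1 hx
  have hz : ∀ x ∈ openInt 0 D, prim g x = 0 := fun x hx => by
    rw [prim, lintegral_eq_zero_iff hg]
    exact ae_restrict_of_ae_restrict_of_subset (Ioc_subset_openInt hx) hae
  rw [setLIntegral_congr_fun (measurableSet_openInt _ _)
    (g := fun _ => 0) (fun x hx => by simp [hz x hx, hq0])]
  simp

/-- Primitives of integrable functions satisfy the inequality with the optimal constant and only
the absolutely continuous part of `ν`. -/
theorem le_optConst_mul (hp : 1 < p) (hq : 1 < q) [SigmaFinite ν] (hD : 0 < D)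
    (hφ : ∀ x ∈ openInt 0 D, phi p ν x < ∞) {g : ℝ → ℝ≥0∞}
    (hg : Measurable g) (hint : ∫⁻ y, g y ≠ ∞)
    (hY : ∫⁻ x in openInt 0 D, g x ^ p * dens ν x ≠ ∞) :
    (∫⁻ x in openInt 0 D, prim g x ^ q ∂μ) ^ (1 / q) ≤
      optConst p q D μ ν * (∫⁻ x in openInt 0 D, g x ^ p * dens ν x) ^ (1 / p) := by
  have hp0 : 0 < p := by linarith
  have hq0 : 0 < q := by linarith
  set Y := ∫⁻ x in openInt 0 D, g x ^ p * dens ν x with hYdef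
  rcases eq_or_ne Y 0 with hY0 | hY0
  · rw [lintegral_prim_rpow_eq_zero hp hq0 hD hφ hg hY0, ENNReal.zero_rpow_of_pos (by positivity)]
    exact zero_le
  -- The set `sᶜ` is Lebesgue null and carries the singular part. The decreasing open sets `V k`
  -- contain it and shrink to a null set, so cutting `g` off on them loses nothing in the limit.
  obtain ⟨s, hsm, hs1, hs2⟩ := Measure.mutuallySingular_singularPart ν volume
  have hU : ∀ k : ℕ, ∃ U ⊇ sᶜ, IsOpen U ∧ volume U < ((k : ℝ≥0∞) + 1)⁻¹ := fun k =>
    sᶜ.exists_isOpen_lt_of_lt _ (by rw [hs2]; simp)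
  choose U hUs hUo hUv using hU
  set V : ℕ → Set ℝ := fun k => ⋂ j ∈ Finset.range (k + 1), U j with hV
  have hVo : ∀ k, IsOpen (V k) := fun k => isOpen_biInter_finset fun j _ => hUo j
  have hVs : ∀ k, sᶜ ⊆ V k := fun k => subset_iInter₂ fun j _ => hUs j
  have hVanti : Antitone V := fun i j hij =>
    biInter_subset_biInter_left fun l hl => by
      simp only [Finset.coe_range, mem_Iio, Finset.mem_range] at *; omega
  have hVv : volume (⋂ k, V k) = 0 := by
    refine le_antisymm (le_of_forall_pos_le_add fun ε hε => ?_) zero_le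
    obtain ⟨n, hn⟩ := ENNReal.exists_inv_nat_lt hε.ne'
    rw [zero_add]
    calc volume (⋂ k, V k) ≤ volume (U n) := measure_mono
          ((iInter_subset _ n).trans (biInter_subset_of_mem (by simp)))
      _ ≤ ((n : ℝ≥0∞) + 1)⁻¹ := (hUv n).le
      _ ≤ (n : ℝ≥0∞)⁻¹ := ENNReal.inv_le_inv.2 le_self_add
      _ ≤ ε := hn.le
  let G : ℕ → ℝ → ℝ≥0∞ := fun k => (V k)ᶜ.indicator g
  have hGm : ∀ k, Measurable (G k) := fun k => hg.indicator (hVo k).measurableSet.compl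
  have hGg : ∀ k x, G k x ≤ g x := fun k x => indicator_le_self _ _ _
  have hGmono : Monotone G := fun i j hij =>
    indicator_le_indicator_of_subset (compl_subset_compl.2 (hVanti hij)) fun _ => zero_le
  have hGint : ∀ k, ∫⁻ y, G k y ≠ ∞ := fun k => ne_top_of_le_ne_top hint (lintegral_mono (hGg k))
  have hlim : ∀ x, prim g x = ⨆ k, prim (G k) x := fun x => by
    simp only [prim]
    rw [← lintegral_iSup hGm hGmono]
    refine lintegral_congr_ae (ae_restrict_of_ae ?_)
    have : ∀ᵐ y, y ∉ ⋂ k, V k := measure_eq_zero_iff_ae_notMem.1 hVv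
    filter_upwards [this] with y hy
    simp only [mem_iInter, not_forall] at hy
    obtain ⟨k, hk⟩ := hy
    refine le_antisymm ?_ (iSup_le fun k => hGg k y)
    refine le_trans (le_of_eq ?_) (le_iSup _ k)
    simp only [G]
    rw [indicator_of_mem (by simpa using hk)]
  have key : ∀ k, (∫⁻ x in openInt 0 D, prim (G k) x ^ q ∂μ) ^ (1 / q) ≤
      optConst p q D μ ν * Y ^ (1 / p) := by
    intro k
    set h : ℝ → ℝ := fun y => (G k y).toReal with hh
    have hhi : Integrable h := integrable_toReal_of_lintegral_ne_top (hGm k).aemeasurable (hGint k)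
    set f : ℝ → ℝ := fun x => ∫ y in (0 : ℝ)..x, h y with hf
    have hfin : ∀ᵐ y, G k y < ∞ := ae_lt_top (hGm k) (hGint k)
    have hfac : IsAC D f := fun T hT _ =>
      hhi.intervalIntegrable.absolutelyContinuousOnInterval_intervalIntegral (by simp)
    have hfn : ∀ x ∈ openInt 0 D, ‖f x‖ₑ = prim (G k) x := by
      intro x hx
      have hx0 := (mem_openInt_zero.1 hx).1.le
      simp only [hf]
      rw [intervalIntegral.integral_of_le hx0, hh, integral_toReal (hGm k).aemeasurable
        (ae_restrict_of_ae hfin), Real.enorm_of_nonneg ENNReal.toReal_nonneg,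
        ENNReal.ofReal_toReal]
      · rfl
      · exact ne_top_of_le_ne_top (hGint k) (setLIntegral_le_lintegral _ _)
    -- On the open set `V k` the integrand vanishes, so the derivative exists and is 0 at every
    -- point, not merely almost everywhere. Hence it vanishes almost everywhere for the singular
    -- part.
    have hfd0 : ∀ x ∈ V k, deriv f x = 0 := by
      intro x hx
      have hz : h =ᶠ[nhds x] fun _ => 0 := by
        filter_upwards [(hVo k).mem_nhds hx] with y hy
        simp [hh, G, hy]
      have hd := intervalIntegral.integral_hasDerivAt_right (a := 0)
        hhi.intervalIntegrable hhi.aestronglyMeasurable.stronglyMeasurableAtFilter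
        (continuousAt_const.congr hz.symm)
      rw [hd.deriv, hz.self_of_nhds]
    have hfd : ∀ᵐ x, deriv f x = h x := by
      filter_upwards [LocallyIntegrable.ae_hasDerivAt_integral hhi.locallyIntegrable] with x hx
      exact (hx 0).deriv
    have hnorm : ∫⁻ x in openInt 0 D, ‖deriv f x‖ₑ ^ p ∂ν ≤ Y := by
      have hdm : Measurable fun x => ‖deriv f x‖ₑ ^ p := (measurable_deriv f).enorm.pow_const p
      have hν : ν = ν.singularPart volume + volume.withDensity (dens ν) :=
        Measure.haveLebesgueDecomposition_add ν volume
      have hz : ∫⁻ x in openInt 0 D, ‖deriv f x‖ₑ ^ p ∂(ν.singularPart volume) = 0 := by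
        rw [lintegral_eq_zero_iff hdm]
        refine ae_restrict_of_ae ?_
        have : ∀ᵐ x ∂(ν.singularPart volume), x ∉ s := measure_eq_zero_iff_ae_notMem.1 hs1
        filter_upwards [this] with x hx
        simp [hfd0 x (hVs k hx), hp0]
      conv_lhs => rw [hν]
      rw [Measure.restrict_add, lintegral_add_measure, hz, zero_add,
        restrict_withDensity (measurableSet_openInt _ _),
        lintegral_withDensity_eq_lintegral_mul _ measurable_dens hdm, hYdef]
      refine lintegral_mono_ae ?_
      filter_upwards [ae_restrict_of_ae hfd, ae_restrict_of_ae hfin] with x hx hx'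
      rw [Pi.mul_apply, hx, mul_comm]
      gcongr
      rw [hh, Real.enorm_of_nonneg ENNReal.toReal_nonneg, ENNReal.ofReal_toReal hx'.ne]
      exact hGg k x
    have hYp0 : Y ^ (1 / p) ≠ 0 := by
      rw [Ne, ENNReal.rpow_eq_zero_iff_of_pos (by positivity)]; exact hY0
    have hYpt : Y ^ (1 / p) ≠ ∞ := ENNReal.rpow_ne_top_of_nonneg (by positivity) hY
    rw [← ENNReal.div_le_iff hYp0 hYpt]
    -- Dividing by the positive finite number Y^{1/p} turns the claim into a lower bound for an
    -- infimum, which can be checked for each admissible constant.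
    refine le_sInf fun C hC => ?_
    rw [ENNReal.div_le_iff hYp0 hYpt]
    have := hC f hfac (by simp [hf])
    rw [lrNorm_eq D μ hq0, lrNorm_eq D ν hp0] at this
    calc (∫⁻ x in openInt 0 D, prim (G k) x ^ q ∂μ) ^ (1 / q)
        = (∫⁻ x in openInt 0 D, ‖f x‖ₑ ^ q ∂μ) ^ (1 / q) := by
          congr 1
          exact setLIntegral_congr_fun (measurableSet_openInt _ _) fun x hx => by
            simp only [hfn x hx]
      _ ≤ C * (∫⁻ x in openInt 0 D, ‖deriv f x‖ₑ ^ p ∂ν) ^ (1 / p) := this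
      _ ≤ C * Y ^ (1 / p) := by gcongr
  have hmonoP : Monotone fun k x => prim (G k) x := fun i j hij x =>
    lintegral_mono (hGmono hij)
  have hfinal : ∫⁻ x in openInt 0 D, prim g x ^ q ∂μ =
      ⨆ k, ∫⁻ x in openInt 0 D, prim (G k) x ^ q ∂μ := by
    rw [← lintegral_iSup (fun k => (measurable_prim _).pow_const q)
      (fun i j hij x => ENNReal.rpow_le_rpow (hmonoP hij x) hq0.le)]
    refine lintegral_congr fun x => ?_
    rw [hlim]
    exact (ENNReal.orderIsoRpow q hq0).map_iSup _
  rw [hfinal, one_div, ENNReal.rpow_inv_le_iff hq0]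
  refine iSup_le fun k => ?_
  have := key k
  rwa [one_div, ENNReal.rpow_inv_le_iff hq0] at this

end OptConst

/-! ### The upper bound by `delta` -/

variable {p q : ℝ} {μ ν : Measure ℝ} {D : EReal}

/-- No σ-finiteness of `μ` is assumed. Finite tails supply it on (0, D), as Minkowski's inequality
requires. -/
theorem sigmaFinite_restrict_openInt (hD : 0 < D)
    (h : ∀ y ∈ openInt 0 D, μ (openInt (y : EReal) D) < ∞) :
    SigmaFinite (μ.restrict (openInt 0 D)) := by
  obtain ⟨u, -, hu, -⟩ := exists_seq_openInt hD
  have hd := (mem_openInt_zero.1 (hu 0)).1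
  set d := u 0
  have hy : ∀ n : ℕ, d / (n + 1 : ℝ) ∈ openInt 0 D := fun n =>
    mem_openInt_of_le (hu 0) (by positivity) (div_le_self hd.le (by simp))
  refine ⟨⟨⟨fun n : ℕ => openInt ((d / (n + 1 : ℝ) : ℝ) : EReal) D ∪ (openInt 0 D)ᶜ,
    fun _ => trivial, fun n => ?_, ?_⟩⟩⟩
  · rw [Measure.restrict_apply ((measurableSet_openInt _ _).union
      (measurableSet_openInt _ _).compl), union_inter_distrib_right, compl_inter_self, union_empty]
    exact lt_of_le_of_lt (measure_mono inter_subset_left) (h _ (hy n))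
  · rw [eq_univ_iff_forall]
    intro x
    by_cases hx : x ∈ openInt 0 D
    · have hx' := mem_openInt_zero.1 hx
      obtain ⟨n, hn⟩ := exists_nat_gt (d / x)
      refine mem_iUnion.2 ⟨n, Or.inl (mem_openInt_coe.2 ⟨?_, hx'.2⟩)⟩
      rw [div_lt_iff₀ hx'.1] at hn
      rw [div_lt_iff₀ (by positivity)]
      nlinarith
    · exact mem_iUnion.2 ⟨0, Or.inr hx⟩

theorem rpow_dens_mul_rpow_vhat (hp : 1 < p) {x : ℝ} (h0 : 0 < dens ν x) (h1 : dens ν x < ∞) :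
    dens ν x ^ (1 / p) * vhat p ν x ^ (1 / pStar p) = 1 := by
  have hps : pStar p = p / (p - 1) := rfl
  have hp1 : p - 1 ≠ 0 := by linarith
  have hp0 : p ≠ 0 := by linarith
  rw [vhat, ← ENNReal.rpow_mul, ← ENNReal.rpow_add _ _ h0.ne' h1.ne]
  rw [show 1 / p + -(1 / (p - 1)) * (1 / pStar p) = 0 by rw [hps]; field_simp; ring,
    ENNReal.rpow_zero]

/-- The Hardy inequality with constant `delta`. -/
theorem hardy_le_delta (hp : 1 < p) (hpq : p ≤ q) [SigmaFinite ν] (hD : 0 < D)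
    (hφ : ∀ x ∈ openInt 0 D, phi p ν x < ∞) {g : ℝ → ℝ≥0∞} (hg : Measurable g) :
    (∫⁻ x in openInt 0 D, prim g x ^ q ∂μ) ^ (1 / q) ≤
      delta p q D μ ν * (∫⁻ x in openInt 0 D, g x ^ p * dens ν x) ^ (1 / p) := by
  have hp0 : 0 < p := by linarith
  have hq0 : 0 < q := by linarith
  have hps : pStar p = p / (p - 1) := rfl
  have hp1 : 0 < p - 1 := by linarith
  have hpsp : 0 < pStar p := by rw [hps]; positivity
  have hconj : p.HolderConjugate (pStar p) := Real.HolderConjugate.conjExponent hp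
  have hγ : 0 < gammaStar q p := by rw [gammaStar]; positivity
  set Y := ∫⁻ x in openInt 0 D, g x ^ p * dens ν x with hY
  rcases eq_or_ne Y 0 with hY0 | hY0
  · rw [lintegral_prim_rpow_eq_zero hp hq0 hD hφ hg hY0, ENNReal.zero_rpow_of_pos (by positivity)]
    exact zero_le
  set f₁ : ℝ → ℝ≥0∞ := fun z => phi p ν z ^ gammaStar q p with hf₁
  rw [delta]
  set Δ := ⨆ x ∈ openInt 0 D, opIIStar p q D μ ν f₁ x with hΔ
  rcases eq_or_ne Δ ∞ with hΔt | hΔt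
  · rw [hΔt, ENNReal.top_rpow_of_pos (by positivity), ENNReal.top_mul]
    · exact le_top
    · rw [Ne, ENNReal.rpow_eq_zero_iff_of_pos (by positivity)]; exact hY0
  have hf₁m : Measurable f₁ := (measurable_prim _).pow_const _
  have hf₁mono : Monotone f₁ := fun x y h => ENNReal.rpow_le_rpow (phi_mono h) hγ.le
  have hf₁pos : ∀ x ∈ openInt 0 D, f₁ x ≠ 0 := fun x hx => by
    rw [Ne, ENNReal.rpow_eq_zero_iff_of_pos hγ]; exact (phi_pos hp hφ hx).ne'
  have hf₁top : ∀ x ∈ openInt 0 D, f₁ x ≠ ∞ := fun x hx =>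
    ENNReal.rpow_ne_top_of_nonneg hγ.le (hφ x hx).ne
  set J : ℝ → ℝ≥0∞ := fun y => ∫⁻ z in openInt (y : EReal) D, f₁ z ^ (q / pStar p) ∂μ with hJ
  set K : ℝ → ℝ≥0∞ := fun y => J y ^ (pStar p / q) with hK
  have hJanti : Antitone J := fun x y h => lintegral_mono_set fun z hz => by
    rw [mem_openInt_coe] at *
    exact ⟨lt_of_le_of_lt h hz.1, hz.2⟩
  have hKanti : Antitone K := fun x y h => ENNReal.rpow_le_rpow (hJanti h) (by positivity)
  have hKm : Measurable K := hKanti.measurable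
  have hKJ : ∀ y, K y ^ (q / pStar p) = J y := fun y => by
    rw [hK, ← ENNReal.rpow_mul, div_mul_div_cancel₀ hq0.ne', div_self hpsp.ne', ENNReal.rpow_one]
  set F := prim (fun y => vhat p ν y * K y) with hF
  have hFle : ∀ x ∈ openInt 0 D, F x ≤ Δ * f₁ x := fun x hx => by
    rw [← ENNReal.div_le_iff (hf₁pos x hx) (hf₁top x hx)]
    exact le_iSup₂_of_le x hx le_rfl
  have hFtop : ∀ x ∈ openInt 0 D, F x < ∞ := fun x hx =>
    lt_of_le_of_lt (hFle x hx) (ENNReal.mul_lt_top hΔt.lt_top (hf₁top x hx).lt_top)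
  -- Finiteness of ∫_0^y v̂ K with v̂ > 0 forces K < ∞ at some point of (0, y], and K is decreasing.
  have hKtop : ∀ y ∈ openInt 0 D, K y < ∞ := by
    intro y hy
    have h1 : ∀ᵐ z ∂(volume.restrict (Ioc 0 y)), vhat p ν z * K z < ∞ :=
      ae_lt_top (measurable_vhat.mul hKm) (hFtop y hy).ne
    have h2 : ∀ᵐ z ∂(volume.restrict (Ioc 0 y)), K z < ∞ := by
      filter_upwards [h1, ae_restrict_of_ae (ae_vhat_pos (ν := ν) hp)] with z hz hz'
      exact ENNReal.lt_top_of_mul_ne_top_right hz.ne hz'.ne'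
    have hne : (volume.restrict (Ioc 0 y)) ≠ 0 := by
      rw [Ne, Measure.restrict_eq_zero]
      simpa using (mem_openInt_zero.1 hy).1
    have : (ae (volume.restrict (Ioc 0 y))).NeBot := ae_neBot.2 hne
    obtain ⟨z, hz, hzy⟩ := (h2.and (ae_restrict_mem measurableSet_Ioc)).exists
    exact lt_of_le_of_lt (hKanti hzy.2) hz
  have hμfin : ∀ y ∈ openInt 0 D, μ (openInt (y : EReal) D) < ∞ := by
    intro y hy
    have h0 : f₁ y ^ (q / pStar p) ≠ 0 := by
      rw [Ne, ENNReal.rpow_eq_zero_iff_of_pos (by positivity)]; exact hf₁pos y hy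
    have h1 : f₁ y ^ (q / pStar p) * μ (openInt (y : EReal) D) ≤ J y := by
      rw [← setLIntegral_const]
      exact setLIntegral_mono' (measurableSet_openInt _ _) fun z hz =>
        ENNReal.rpow_le_rpow (hf₁mono (mem_openInt_coe.1 hz).1.le) (by positivity)
    have h2 : J y < ∞ := by
      rw [← hKJ]; exact ENNReal.rpow_lt_top_of_nonneg (by positivity) (hKtop y hy).ne
    exact ENNReal.lt_top_of_mul_ne_top_right (lt_of_le_of_lt h1 h2).ne h0
  have := sigmaFinite_restrict_openInt hD hμfin
  -- `K` does not vanish to the left of almost every point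
  have hKpos : ∀ᵐ x ∂(μ.restrict (openInt 0 D)), ∀ y, 0 < y → y < x → K y ≠ 0 := by
    -- Since K is decreasing, rational points suffice, and only countably many null sets have to be
    -- discarded.
    have h1 : ∀ r : ℚ, ∀ᵐ x ∂(μ.restrict (openInt 0 D)),
        0 < (r : ℝ) → K r = 0 → ¬ ((r : ℝ) < x) := by
      intro r
      by_cases hr : 0 < (r : ℝ) ∧ K r = 0
      · have hJ0 : J r = 0 := by rw [← hKJ, hr.2, ENNReal.zero_rpow_of_pos (by positivity)]
        have hnull : ∀ᵐ z ∂(μ.restrict (openInt ((r : ℝ) : EReal) D)), False := by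
          have := (lintegral_eq_zero_iff (hf₁m.pow_const _)).1 hJ0
          filter_upwards [this, ae_restrict_mem (measurableSet_openInt _ _)] with z hz hz'
          rw [Pi.zero_apply, ENNReal.rpow_eq_zero_iff_of_pos (by positivity)] at hz
          exact hf₁pos z (openInt_subset_openInt hr.1.le hz') hz
        rw [ae_restrict_iff' (measurableSet_openInt _ _)] at hnull
        rw [ae_restrict_iff' (measurableSet_openInt _ _)]
        filter_upwards [hnull] with x hx hxI _ _ hrx
        exact hx (mem_openInt_coe.2 ⟨hrx, (mem_openInt_zero.1 hxI).2⟩)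
      · exact Filter.Eventually.of_forall fun x h2 h3 => absurd ⟨h2, h3⟩ hr
    filter_upwards [ae_all_iff.2 h1] with x hx y hy hyx hKy
    obtain ⟨r, hr1, hr2⟩ := exists_rat_btwn hyx
    exact hx r (hy.trans hr1) (le_antisymm (hKy ▸ hKanti hr1.le) zero_le) hr2
  -- The weight K^{-p/p*} is matched to the later step: the inner integral in Minkowski's inequality
  -- produces K^{p/p*}.
  set G : ℝ → ℝ≥0∞ := fun y => g y ^ p * dens ν y * K y ^ (-(p / pStar p)) with hG
  have hGm : Measurable G := ((hg.pow_const p).mul measurable_dens).mul (hKm.pow_const _)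
  -- Hölder
  have hhol : ∀ᵐ x ∂(μ.restrict (openInt 0 D)), prim g x ^ q ≤
      (∫⁻ y in Ioi 0, (Iio x).indicator G y) ^ (q / p) * F x ^ (q / pStar p) := by
    filter_upwards [hKpos, ae_restrict_mem (measurableSet_openInt _ _)] with x hx hxI
    have hIoo : Ioo 0 x ⊆ openInt 0 D := Ioo_subset_Ioc_self.trans (Ioc_subset_openInt hxI)
    -- The end point x is dropped because K is known to be nonzero only strictly to the left of x.
    have e1 : prim g x = ∫⁻ y in Ioo 0 x, g y := (setLIntegral_congr Ioo_ae_eq_Ioc).symm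
    have e2 : ∫⁻ y in Ioi 0, (Iio x).indicator G y = ∫⁻ y in Ioo 0 x, G y := by
      rw [lintegral_indicator measurableSet_Iio, Measure.restrict_restrict measurableSet_Iio,
        inter_comm, Ioi_inter_Iio]
    have e3 : F x = ∫⁻ y in Ioo 0 x, vhat p ν y * K y := (setLIntegral_congr Ioo_ae_eq_Ioc).symm
    have h1 : ∫⁻ y in Ioo 0 x, g y ≤ ∫⁻ y in Ioo 0 x,
        (g y * dens ν y ^ (1 / p) * K y ^ (-(1 / pStar p))) *
          (vhat p ν y ^ (1 / pStar p) * K y ^ (1 / pStar p)) := by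
      refine lintegral_mono_ae ?_
      filter_upwards [ae_restrict_of_ae_restrict_of_subset hIoo (ae_dens_pos hp hD hφ),
        ae_restrict_of_ae (Measure.rnDeriv_lt_top ν volume),
        ae_restrict_mem measurableSet_Ioo] with y h0 ht hy
      have hk0 := hx y hy.1 hy.2
      have hkt := (hKtop y (hIoo hy)).ne
      have h3 : K y ^ (-(1 / pStar p)) * K y ^ (1 / pStar p) = 1 := by
        rw [← ENNReal.rpow_add _ _ hk0 hkt, neg_add_cancel, ENNReal.rpow_zero]
      calc g y = g y * (dens ν y ^ (1 / p) * vhat p ν y ^ (1 / pStar p)) *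
            (K y ^ (-(1 / pStar p)) * K y ^ (1 / pStar p)) := by
            rw [h3, rpow_dens_mul_rpow_vhat hp h0 ht, mul_one, mul_one]
        _ ≤ _ := le_of_eq (by ring)
    have h2 := ENNReal.lintegral_mul_le_Lp_mul_Lq (volume.restrict (Ioo 0 x)) hconj
      (f := fun y => g y * dens ν y ^ (1 / p) * K y ^ (-(1 / pStar p)))
      (g := fun y => vhat p ν y ^ (1 / pStar p) * K y ^ (1 / pStar p))
      ((hg.mul (measurable_dens.pow_const _)).mul (hKm.pow_const _)).aemeasurable
      ((measurable_vhat.pow_const _).mul (hKm.pow_const _)).aemeasurable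
    have h3 : ∀ y, (g y * dens ν y ^ (1 / p) * K y ^ (-(1 / pStar p))) ^ p = G y := fun y => by
      rw [ENNReal.mul_rpow_of_nonneg _ _ hp0.le, ENNReal.mul_rpow_of_nonneg _ _ hp0.le,
        ← ENNReal.rpow_mul, ← ENNReal.rpow_mul, one_div_mul_cancel hp0.ne', ENNReal.rpow_one, hG]
      simp only
      congr 2; ring
    have h4 : ∀ y, (vhat p ν y ^ (1 / pStar p) * K y ^ (1 / pStar p)) ^ pStar p =
        vhat p ν y * K y := fun y => by
      rw [ENNReal.mul_rpow_of_nonneg _ _ hpsp.le, ← ENNReal.rpow_mul, ← ENNReal.rpow_mul,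
        one_div_mul_cancel hpsp.ne', ENNReal.rpow_one, ENNReal.rpow_one]
    simp only [h3, h4] at h2
    rw [e1, e2, e3]
    calc (∫⁻ y in Ioo 0 x, g y) ^ q ≤ ((∫⁻ y in Ioo 0 x, G y) ^ (1 / p) *
          (∫⁻ y in Ioo 0 x, vhat p ν y * K y) ^ (1 / pStar p)) ^ q :=
          ENNReal.rpow_le_rpow (h1.trans h2) hq0.le
      _ = _ := by
          rw [ENNReal.mul_rpow_of_nonneg _ _ hq0.le, ← ENNReal.rpow_mul, ← ENNReal.rpow_mul,
            one_div_mul_eq_div, one_div_mul_eq_div]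
  -- Minkowski
  have hFm : Measurable F := measurable_prim _
  set k : ℝ → ℝ → ℝ≥0∞ := fun x y => (Iio x).indicator G y * F x ^ (p / pStar p) with hk
  have hkm : Measurable (Function.uncurry k) := by
    have : (fun z : ℝ × ℝ => (Iio z.1).indicator G z.2) =
        {z : ℝ × ℝ | z.2 < z.1}.indicator fun z => G z.2 := by
      ext z; simp [indicator]
    refine Measurable.mul ?_ ((hFm.pow_const _).comp measurable_fst)
    change Measurable fun z : ℝ × ℝ => (Iio z.1).indicator G z.2
    rw [this]
    exact (hGm.comp measurable_snd).indicator (measurableSet_lt measurable_snd measurable_fst)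
  have hr : 1 ≤ q / p := (one_le_div hp0).2 hpq
  have hmink := lintegral_rpow_lintegral_le (μ := μ.restrict (openInt 0 D))
    (ν := volume.restrict (Ioi 0)) hkm hr
  have hl : ∫⁻ x in openInt 0 D, prim g x ^ q ∂μ ≤
      ∫⁻ x in openInt 0 D, (∫⁻ y in Ioi 0, k x y) ^ (q / p) ∂μ := by
    refine lintegral_mono_ae ?_
    filter_upwards [hhol] with x hx
    refine hx.trans (le_of_eq ?_)
    rw [hk]
    simp only
    rw [lintegral_mul_const _ (hGm.indicator measurableSet_Iio),
      ENNReal.mul_rpow_of_nonneg _ _ (by positivity), ← ENNReal.rpow_mul]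
    congr 2
    field_simp
  have hrr : ∫⁻ y in Ioi 0, (∫⁻ x in openInt 0 D, k x y ^ (q / p) ∂μ) ^ (1 / (q / p)) ≤
      Δ ^ (p / pStar p) * Y := by
    have hpt : ∀ y ∈ Ioi (0 : ℝ), (∫⁻ x in openInt 0 D, k x y ^ (q / p) ∂μ) ^ (1 / (q / p)) ≤
        Δ ^ (p / pStar p) * (openInt 0 D).indicator (fun y => g y ^ p * dens ν y) y := by
      intro y hy
      -- Only x > y contributes, and F ≤ Δ f₁ turns the integral of F^{q/p*} over (y, D) into
      -- Δ^{q/p*} J(y), a power of K(y).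
      have hint : ∫⁻ x in openInt 0 D, k x y ^ (q / p) ∂μ ≤
          G y ^ (q / p) * (Δ ^ (q / pStar p) * J y) := by
        have e1 : ∀ x, k x y ^ (q / p) =
            (Ioi y).indicator (fun x => G y ^ (q / p) * F x ^ (q / pStar p)) x := by
          intro x
          by_cases h : y < x
          · simp only [hk, indicator, mem_Iio, mem_Ioi, h, if_true]
            rw [ENNReal.mul_rpow_of_nonneg _ _ (by positivity), ← ENNReal.rpow_mul]
            congr 2
            field_simp
          · have : 0 < q / p := by positivity
            simp [hk, indicator, h, this]
        simp_rw [e1]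
        rw [lintegral_indicator measurableSet_Ioi, Measure.restrict_restrict measurableSet_Ioi,
          Ioi_inter_openInt (le_of_lt hy), lintegral_const_mul _ (hFm.pow_const _), hJ]
        simp only
        rw [← lintegral_const_mul _ (hf₁m.pow_const _)]
        gcongr G y ^ (q / p) * ?_
        refine setLIntegral_mono' (measurableSet_openInt _ _) fun x hx => ?_
        rw [← ENNReal.mul_rpow_of_nonneg _ _ (by positivity)]
        exact ENNReal.rpow_le_rpow (hFle x (openInt_subset_openInt (le_of_lt hy) hx))
          (by positivity)
      refine (ENNReal.rpow_le_rpow hint (by positivity)).trans ?_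
      have e2 : (G y ^ (q / p) * (Δ ^ (q / pStar p) * J y)) ^ (1 / (q / p)) =
          G y * (Δ ^ (p / pStar p) * K y ^ (p / pStar p)) := by
        have e3 : ∀ a b c : ℝ≥0∞, (a ^ (q / p) * (b ^ (q / pStar p) * c ^ (q / pStar p))) ^
            (1 / (q / p)) = a * (b ^ (p / pStar p) * c ^ (p / pStar p)) := by
          intro a b c
          have h1 : q / p * (1 / (q / p)) = 1 := by field_simp
          have h2 : q / pStar p * (1 / (q / p)) = p / pStar p := by field_simp
          rw [ENNReal.mul_rpow_of_nonneg _ _ (by positivity),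
            ENNReal.mul_rpow_of_nonneg _ _ (by positivity), ← ENNReal.rpow_mul,
            ← ENNReal.rpow_mul, ← ENNReal.rpow_mul, h1, h2, ENNReal.rpow_one]
        rw [← hKJ, e3]
      rw [e2]
      have hpp : 0 < p / pStar p := by positivity
      by_cases hyI : y ∈ openInt 0 D
      · rw [indicator_of_mem hyI]
        by_cases hk0 : K y = 0
        · rw [hk0, ENNReal.zero_rpow_of_pos hpp, mul_zero, mul_zero]
          exact zero_le
        · have : K y ^ (-(p / pStar p)) * K y ^ (p / pStar p) = 1 := by
            rw [← ENNReal.rpow_add _ _ hk0 (hKtop y hyI).ne, neg_add_cancel, ENNReal.rpow_zero]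
          refine le_of_eq ?_
          calc G y * (Δ ^ (p / pStar p) * K y ^ (p / pStar p))
              = Δ ^ (p / pStar p) * (g y ^ p * dens ν y) *
                (K y ^ (-(p / pStar p)) * K y ^ (p / pStar p)) := by rw [hG]; ring
            _ = _ := by rw [this, mul_one]
      · have : openInt (y : EReal) D = ∅ := by
          rw [eq_empty_iff_forall_notMem]
          intro z hz
          have hz' := mem_openInt_coe.1 hz
          exact hyI (mem_openInt_zero.2 ⟨hy, lt_trans (EReal.coe_lt_coe_iff.2 hz'.1) hz'.2⟩)
        have hk0 : K y = 0 := by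
          have h1 : 0 < pStar p / q := by positivity
          simp only [hK, hJ, this, Measure.restrict_empty, lintegral_zero_measure,
            ENNReal.zero_rpow_of_pos h1]
        rw [hk0, ENNReal.zero_rpow_of_pos hpp, mul_zero, mul_zero]
        exact zero_le
    refine (setLIntegral_mono' measurableSet_Ioi hpt).trans ?_
    have hgd : Measurable fun y => g y ^ p * dens ν y := (hg.pow_const p).mul measurable_dens
    rw [lintegral_const_mul _ (hgd.indicator (measurableSet_openInt _ _)),
      lintegral_indicator (measurableSet_openInt _ _),
      Measure.restrict_restrict (measurableSet_openInt _ _)]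
    gcongr
    exact lintegral_mono_set inter_subset_left
  have hfin := (ENNReal.rpow_le_rpow hl (by positivity : (0 : ℝ) ≤ 1 / (q / p))).trans
    (hmink.trans hrr)
  calc (∫⁻ x in openInt 0 D, prim g x ^ q ∂μ) ^ (1 / q)
      = ((∫⁻ x in openInt 0 D, prim g x ^ q ∂μ) ^ (1 / (q / p))) ^ (1 / p) := by
        rw [← ENNReal.rpow_mul]; congr 1; field_simp
    _ ≤ (Δ ^ (p / pStar p) * Y) ^ (1 / p) := ENNReal.rpow_le_rpow hfin (by positivity)
    _ = Δ ^ (1 / pStar p) * Y ^ (1 / p) := by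
        rw [ENNReal.mul_rpow_of_nonneg _ _ (by positivity), ← ENNReal.rpow_mul]
        congr 2; field_simp

theorem optConst_le_delta (hp : 1 < p) (hpq : p ≤ q) [SigmaFinite ν] (hD : 0 < D)
    (hφ : ∀ x ∈ openInt 0 D, phi p ν x < ∞) : optConst p q D μ ν ≤ delta p q D μ ν :=
  optConst_le hp (by linarith) fun _ hg => hardy_le_delta hp hpq hD hφ hg

/-! ### Tail estimates from B and the bound of `delta` by k̃ B -/

variable {p q : ℝ} {μ ν : Measure ℝ} {D : EReal}

/-- If some value of φ exceeds `t`, continuity gives a point y with φ(y) = t. The superlevel set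
then lies in (y, D), and the definition of B at y applies. -/
theorem measure_phi_gt_le (hq : 0 < q)
    (hφ : ∀ x ∈ openInt 0 D, phi p ν x < ∞) {t : ℝ} (ht : 0 < t) :
    ENNReal.ofReal t ^ (1 / pStar p) *
      μ ({x | t < (phi p ν x).toReal} ∩ openInt 0 D) ^ (1 / q) ≤ constB p q D μ ν := by
  rcases ({x | t < (phi p ν x).toReal} ∩ openInt 0 D).eq_empty_or_nonempty with he | ⟨x, hxt, hx⟩
  · simp [he, hq]
  have hx0 := (mem_openInt_zero.1 hx).1
  have hcont : ContinuousOn (fun x => (phi p ν x).toReal) (Icc 0 x) :=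
    (continuousOn_prim_toReal measurable_vhat (hφ x hx).ne).mono fun y hy => hy.2
  obtain ⟨y, hy, hyt⟩ := intermediate_value_Icc hx0.le hcont
    (show t ∈ Icc _ _ by
      simp only [phi_zero, ENNReal.toReal_zero]
      exact ⟨ht.le, le_of_lt hxt⟩)
  simp only at hyt
  have hy0 : 0 < y := by
    refine lt_of_le_of_ne hy.1 ?_
    rintro rfl
    rw [phi_zero, ENNReal.toReal_zero] at hyt
    exact ht.ne hyt
  have hyI := mem_openInt_of_le hx hy0 hy.2
  have hsub : {x | t < (phi p ν x).toReal} ∩ openInt 0 D ⊆ openInt (y : EReal) D := by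
    rintro z ⟨hz1, hz2⟩
    refine mem_openInt_coe.2 ⟨?_, (mem_openInt_zero.1 hz2).2⟩
    by_contra hle
    have : (phi p ν z).toReal ≤ (phi p ν y).toReal :=
      ENNReal.toReal_mono (hφ y hyI).ne (phi_mono (not_lt.1 hle))
    rw [hyt] at this
    exact absurd hz1 (not_lt.2 this)
  calc _ ≤ phi p ν y ^ (1 / pStar p) * μ (openInt (y : EReal) D) ^ (1 / q) := by
        rw [← hyt, ENNReal.ofReal_toReal (hφ y hyI).ne, hyt]
        gcongr
    _ ≤ constB p q D μ ν := le_iSup₂_of_le y hyI le_rfl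

theorem lintegral_Ioi_rpow_tail {b α t : ℝ} (hb : 0 ≤ b) (hα : 0 < α) (ht : 0 < t) :
    ∫⁻ u in Ioi t, ENNReal.ofReal (b * α * u ^ (-α - 1)) = ENNReal.ofReal (b * t ^ (-α)) := by
  have hi : IntegrableOn (fun u : ℝ => b * α * u ^ (-α - 1)) (Ioi t) :=
    (integrableOn_Ioi_rpow_of_lt (by linarith) ht).const_mul _
  rw [← ofReal_integral_eq_lintegral_ofReal hi, integral_const_mul,
    integral_Ioi_rpow_of_lt (by linarith) ht]
  · congr 1
    rw [sub_add_cancel]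
    field_simp
  · refine ae_restrict_of_forall_mem measurableSet_Ioi fun u hu => ?_
    have : 0 < u := lt_trans ht hu
    positivity

/-- Integrals over `(0, D)` of monotone functions of `φ`, compared with the extremal power tail. -/
theorem lintegral_comp_phi_le (hp : 1 < p) (hq : 0 < q)
    (hφ : ∀ x ∈ openInt 0 D, phi p ν x < ∞) {b : ℝ} (hb : 0 ≤ b)
    (hB : constB p q D μ ν ≤ ENNReal.ofReal (b ^ (1 / q))) {f : ℝ → ℝ} (hf0 : ∀ x, 0 ≤ f x)
    (hfm : Measurable f) (hf : MonotoneOn f (Ioi 0)) (hf00 : f 0 = 0) :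
    ∫⁻ x in openInt 0 D, ENNReal.ofReal (f (phi p ν x).toReal) ∂μ ≤
      ∫⁻ t in Ioi 0, ENNReal.ofReal (f t) *
        ENNReal.ofReal (b * (q / pStar p) * t ^ (-(q / pStar p) - 1)) := by
  have hps : pStar p = p / (p - 1) := rfl
  have hp1 : 0 < p - 1 := by linarith
  have hpsp : 0 < pStar p := by rw [hps]; positivity
  have hα : 0 < q / pStar p := by positivity
  have hφm : Measurable fun x => (phi p ν x).toReal := (measurable_prim _).ennreal_toReal
  -- The density on (0, ∞) whose tail beyond `t` equals b t^{-q/p*}, the largest tail that the bound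
  -- on B permits.
  set w : ℝ → ℝ≥0∞ := fun t => ENNReal.ofReal (b * (q / pStar p) * t ^ (-(q / pStar p) - 1))
    with hw
  have hwm : Measurable w := by fun_prop
  set m := Measure.map (fun x => (phi p ν x).toReal) (μ.restrict (openInt 0 D)) with hm
  have htail : ∀ t > 0, (volume.withDensity w) (Ioi t) =
      ENNReal.ofReal (b * t ^ (-(q / pStar p))) := fun t ht => by
    rw [withDensity_apply _ measurableSet_Ioi]
    exact lintegral_Ioi_rpow_tail hb hα ht
  have hle : ∀ t > 0, m (Ioi t) ≤ (volume.withDensity w) (Ioi t) := by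
    intro t ht
    rw [htail t ht, hm, Measure.map_apply hφm measurableSet_Ioi,
      Measure.restrict_apply (hφm measurableSet_Ioi)]
    have h1 := (measure_phi_gt_le (μ := μ) hq hφ ht).trans hB
    have h2 := ENNReal.rpow_le_rpow h1 hq.le
    rw [ENNReal.mul_rpow_of_nonneg _ _ hq.le, ← ENNReal.rpow_mul, ← ENNReal.rpow_mul,
      one_div_mul_cancel hq.ne', ENNReal.rpow_one, ENNReal.ofReal_rpow_of_nonneg (by positivity) hq.le,
      ← Real.rpow_mul hb, one_div_mul_cancel hq.ne', Real.rpow_one, one_div_mul_eq_div,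
      ENNReal.ofReal_rpow_of_pos ht] at h2
    have h3 : 0 < t ^ (q / pStar p) := Real.rpow_pos_of_pos ht _
    rw [Real.rpow_neg ht.le, ← div_eq_mul_inv, ENNReal.ofReal_div_of_pos h3,
      ENNReal.le_div_iff_mul_le (Or.inl (by simpa using h3)) (Or.inl ENNReal.ofReal_ne_top),
      mul_comm]
    exact h2
  have key := lintegral_le_of_tail_le hle (fun t ht => by rw [htail t ht]; exact ENNReal.ofReal_ne_top)
    hf0 hfm hf
  -- Vanishing at 0 makes a possible mass of the image measure at 0 irrelevant.
  have hfi : ∀ g : ℝ → ℝ≥0∞, Measurable g → g 0 = 0 →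
      ∫⁻ x in openInt 0 D, g (phi p ν x).toReal ∂μ = ∫⁻ t in Ioi 0, g t ∂m := by
    intro g hg hg0
    rw [hm, setLIntegral_map measurableSet_Ioi hg hφm, ← lintegral_indicator
      (hφm measurableSet_Ioi)]
    refine lintegral_congr fun x => ?_
    by_cases hx : 0 < (phi p ν x).toReal
    · rw [indicator_of_mem (by exact hx)]
    · rw [indicator_of_notMem (by exact hx), le_antisymm (not_lt.1 hx) ENNReal.toReal_nonneg, hg0]
  rw [hfi (fun t => ENNReal.ofReal (f t)) hfm.ennreal_ofReal (by simp [hf00])]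
  refine key.trans (le_of_eq ?_)
  rw [restrict_withDensity measurableSet_Ioi,
    lintegral_withDensity_eq_lintegral_mul _ hwm hfm.ennreal_ofReal]
  refine lintegral_congr fun t => ?_
  rw [Pi.mul_apply, mul_comm]

theorem kTilde_pos (hp : 1 < p) (hq : 0 < q) : 0 < kTilde q p := by
  have hps : pStar p = p / (p - 1) := rfl
  have hp1 : 0 < p - 1 := by linarith
  have hpsp : 0 < pStar p := by rw [hps]; positivity
  rw [kTilde]; positivity

/-- The tail comparison bounds the inner integral by an explicit power of φ(y), and the chain rule
integrates that power. For a general exponent γ in (0, 1) the computation yields (1-γ)^{-1/q}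
γ^{-1/p*} B; the choice γ* minimises this factor, and the minimum is k̃. -/
theorem delta_le (hp : 1 < p) (hpq : p ≤ q) [SigmaFinite ν]
    (hφ : ∀ x ∈ openInt 0 D, phi p ν x < ∞) :
    delta p q D μ ν ≤ ENNReal.ofReal (kTilde q p) * constB p q D μ ν := by
  have hp0 : 0 < p := by linarith
  have hq0 : 0 < q := by linarith
  have hps : pStar p = p / (p - 1) := rfl
  have hp1 : 0 < p - 1 := by linarith
  have hpsp : 0 < pStar p := by rw [hps]; positivity
  rcases eq_or_ne (constB p q D μ ν) ∞ with hBt | hBt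
  · rw [hBt, ENNReal.mul_top (by simpa using kTilde_pos hp hq0)]
    exact le_top
  set β := (constB p q D μ ν).toReal with hβ
  have hβ0 : 0 ≤ β := ENNReal.toReal_nonneg
  have hBβ : constB p q D μ ν = ENNReal.ofReal β := (ENNReal.ofReal_toReal hBt).symm
  set b := β ^ q with hb
  have hb0 : 0 ≤ b := by positivity
  have hbβ : b ^ (1 / q) = β := by
    rw [hb, ← Real.rpow_mul hβ0, mul_one_div_cancel hq0.ne', Real.rpow_one]
  set γ := gammaStar q p with hγ
  have hγe : γ = q / (pStar p + q) := rfl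
  have hγ0 : 0 < γ := by rw [hγe]; positivity
  have hγ1' : 1 - γ = pStar p / (pStar p + q) := by rw [hγe]; field_simp; ring
  have hγ1 : 0 < 1 - γ := by rw [hγ1']; positivity
  set α := q / pStar p with hα
  have hα0 : 0 < α := by positivity
  set c := (b / (1 - γ)) ^ (pStar p / q) with hc
  have hc0 : 0 ≤ c := by positivity
  have inner : ∀ y ∈ openInt 0 D,
      (∫⁻ z in openInt (y : EReal) D, (phi p ν z ^ γ) ^ α ∂μ) ^ (pStar p / q) ≤
        ENNReal.ofReal c * ENNReal.ofReal ((phi p ν y).toReal ^ (γ - 1)) := by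
    intro y hy
    have hy0 := (mem_openInt_zero.1 hy).1
    set a := (phi p ν y).toReal with ha
    have ha0 : 0 < a := ENNReal.toReal_pos (phi_pos hp hφ hy).ne' (hφ y hy).ne
    -- Cutting the power off below a = φ(y) restricts to z > y, because φ is strictly increasing,
    -- and keeps the function monotone.
    set f : ℝ → ℝ := (Ioi a).indicator fun t => t ^ (γ * α) with hf
    have hf0 : ∀ t, 0 ≤ f t := fun t =>
      indicator_nonneg (fun u hu => Real.rpow_nonneg (lt_trans ha0 hu).le _) t
    have hfm : Measurable f := Measurable.indicator (by fun_prop) measurableSet_Ioi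
    have hfmono : MonotoneOn f (Ioi 0) := by
      intro s hs t _ hst
      by_cases h : a < s
      · have h' : a < t := lt_of_lt_of_le h hst
        simp only [hf, indicator, mem_Ioi, h, h', if_true]
        exact Real.rpow_le_rpow (le_of_lt hs) hst (by positivity)
      · have : f s = 0 := by simp [hf, h]
        rw [this]; exact hf0 t
    have hf00 : f 0 = 0 := by simp [hf, ha0.le]
    have h1 := lintegral_comp_phi_le hp hq0 hφ hb0 (hBβ.trans (by rw [hbβ])).le hf0 hfm hfmono hf00
    have h2 : ∫⁻ z in openInt (y : EReal) D, (phi p ν z ^ γ) ^ α ∂μ ≤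
        ∫⁻ x in openInt 0 D, ENNReal.ofReal (f (phi p ν x).toReal) ∂μ := by
      calc _ ≤ ∫⁻ x in openInt (y : EReal) D, ENNReal.ofReal (f (phi p ν x).toReal) ∂μ := by
            refine setLIntegral_mono' (measurableSet_openInt _ _) fun z hz => ?_
            have hzI := openInt_subset_openInt hy0.le hz
            have hlt : a < (phi p ν z).toReal :=
              (ENNReal.toReal_lt_toReal (hφ y hy).ne (hφ z hzI).ne).2
                (phi_lt_phi hp hy0.le (mem_openInt_coe.1 hz).1 (hφ z hzI))
            simp only [hf]
            rw [indicator_of_mem (show _ ∈ Ioi a from hlt), ← ENNReal.rpow_mul,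
              ← ENNReal.ofReal_rpow_of_nonneg ENNReal.toReal_nonneg (by positivity),
              ENNReal.ofReal_toReal (hφ z hzI).ne]
        _ ≤ _ := lintegral_mono_set (openInt_subset_openInt hy0.le)
    have h3 : ∫⁻ t in Ioi 0, ENNReal.ofReal (f t) * ENNReal.ofReal (b * α * t ^ (-α - 1)) =
        ENNReal.ofReal (b / (1 - γ) * a ^ (-(α * (1 - γ)))) := by
      rw [← lintegral_Ioi_rpow_tail (by positivity) (by positivity : 0 < α * (1 - γ)) ha0]
      have e1 : ∀ t, ENNReal.ofReal (f t) * ENNReal.ofReal (b * α * t ^ (-α - 1)) =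
          (Ioi a).indicator (fun t => ENNReal.ofReal
            (b / (1 - γ) * (α * (1 - γ)) * t ^ (-(α * (1 - γ)) - 1))) t := by
        intro t
        by_cases h : a < t
        · have ht0 : 0 < t := lt_trans ha0 h
          simp only [hf, indicator, mem_Ioi, h, if_true]
          rw [← ENNReal.ofReal_mul (by positivity)]
          congr 1
          have : t ^ (-(α * (1 - γ)) - 1) = t ^ (γ * α) * t ^ (-α - 1) := by
            rw [← Real.rpow_add ht0]; congr 1; ring
          rw [this]
          field_simp
        · simp [hf, h]
      simp_rw [e1]
      rw [lintegral_indicator measurableSet_Ioi, Measure.restrict_restrict measurableSet_Ioi,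
        inter_eq_left.2 (Ioi_subset_Ioi ha0.le)]
    calc _ ≤ (ENNReal.ofReal (b / (1 - γ) * a ^ (-(α * (1 - γ))))) ^ (pStar p / q) :=
          ENNReal.rpow_le_rpow (h2.trans (h1.trans h3.le)) (by positivity)
      _ = _ := by
          rw [ENNReal.ofReal_rpow_of_nonneg (by positivity) (by positivity),
            ← ENNReal.ofReal_mul hc0, Real.mul_rpow (by positivity) (by positivity), ← hc,
            ← Real.rpow_mul ha0.le]
          congr 3
          rw [hα]; field_simp; ring
  have hsup : (⨆ x ∈ openInt 0 D, opIIStar p q D μ ν (fun z => phi p ν z ^ γ) x) ≤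
      ENNReal.ofReal (c / γ) := by
    refine iSup₂_le fun x hx => ?_
    have hφ0 : phi p ν x ^ γ ≠ 0 := by
      rw [Ne, ENNReal.rpow_eq_zero_iff_of_pos hγ0]; exact (phi_pos hp hφ hx).ne'
    have hφt : phi p ν x ^ γ ≠ ∞ := ENNReal.rpow_ne_top_of_nonneg hγ0.le (hφ x hx).ne
    rw [opIIStar, ENNReal.div_le_iff hφ0 hφt]
    calc _ ≤ ∫⁻ y in Ioc 0 x, ENNReal.ofReal c *
          (vhat p ν y * ENNReal.ofReal ((phi p ν y).toReal ^ (γ - 1))) := by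
          refine setLIntegral_mono' measurableSet_Ioc fun y hy => ?_
          rw [mul_left_comm]
          gcongr
          exact inner y (Ioc_subset_openInt hx hy)
      _ = ENNReal.ofReal c * ENNReal.ofReal ((phi p ν x).toReal ^ γ / γ) := by
          rw [lintegral_const_mul' _ _ ENNReal.ofReal_ne_top]
          congr 1
          exact lintegral_prim_rpow measurable_vhat (hφ x hx).ne hγ0
      _ = ENNReal.ofReal (c / γ) * phi p ν x ^ γ := by
          rw [← ENNReal.ofReal_toReal (hφ x hx).ne, ENNReal.ofReal_rpow_of_nonneg
            ENNReal.toReal_nonneg hγ0.le, ← ENNReal.ofReal_mul hc0, ENNReal.ofReal_toReal (hφ x hx).ne,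
            ← ENNReal.ofReal_mul (by positivity)]
          congr 1; ring
  rw [delta]
  refine (ENNReal.rpow_le_rpow hsup (by positivity)).trans (le_of_eq ?_)
  rw [hBβ, ENNReal.ofReal_rpow_of_nonneg (by positivity) (by positivity),
    ← ENNReal.ofReal_mul (kTilde_pos hp hq0).le]
  congr 1
  have e1 : (1 - γ)⁻¹ = 1 + q / pStar p := by rw [hγ1']; field_simp
  have e2 : γ⁻¹ = 1 + pStar p / q := by rw [hγe]; field_simp; ring
  rw [div_eq_mul_inv, Real.mul_rpow hc0 (by positivity), hc, ← Real.rpow_mul (by positivity),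
    div_eq_mul_inv b, e1, e2, kTilde, Real.mul_rpow hb0 (by positivity)]
  have e3 : pStar p / q * (1 / pStar p) = 1 / q := by field_simp
  rw [e3, hbβ]
  ring

/-! ### The upper bound by k B -/

variable {p q : ℝ} {μ ν : Measure ℝ} {D : EReal}

/-- In the variable `t = φ(x)`, a function `g` on `(0, D)` becomes a function `G` on `(0, ∞)`. -/
theorem exists_change_of_variable (hp : 1 < p) [SigmaFinite ν] (hD : 0 < D)
    (hφ : ∀ x ∈ openInt 0 D, phi p ν x < ∞) {g : ℝ → ℝ≥0∞} (hg : Measurable g) :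
    ∃ G : ℝ → ℝ≥0∞, Measurable G ∧
      (∀ x ∈ openInt 0 D, prim g x = prim G (phi p ν x).toReal) ∧
      ∫⁻ t in Ioi 0, G t ^ p ≤ ∫⁻ x in openInt 0 D, g x ^ p * dens ν x := by
  have hp0 : 0 < p := by linarith
  have hφm : Measurable fun x => (phi p ν x).toReal := (measurable_prim _).ennreal_toReal
  have hφmono : StrictMonoOn (fun x => (phi p ν x).toReal) (openInt 0 D) := fun x hx y hy hxy =>
    (ENNReal.toReal_lt_toReal (hφ x hx).ne (hφ y hy).ne).2
      (phi_lt_phi hp (mem_openInt_zero.1 hx).1.le hxy (hφ y hy))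
  have hφcont : ContinuousOn (fun x => (phi p ν x).toReal) (openInt 0 D) := by
    obtain ⟨u, -, hu, hcof⟩ := exists_seq_openInt hD
    intro x hx
    obtain ⟨n, hn⟩ := hcof x hx
    exact ((continuousOn_prim_toReal measurable_vhat (hφ _ (hu n)).ne).continuousAt
      (Iic_mem_nhds hn)).continuousWithinAt
  have hemb := hφcont.measurableEmbedding (measurableSet_openInt 0 D) hφmono.injOn
  -- φ is continuous and injective on (0, D), hence a measurable embedding there, so g/v̂ is a
  -- measurable function of t = φ(x).
  obtain ⟨G₀, hG₀m, hG₀⟩ := hemb.exists_measurable_extend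
    (g := fun x : openInt 0 D => g x / vhat p ν x)
    ((hg.div measurable_vhat).comp measurable_subtype_coe) (fun _ => ⟨0⟩)
  have hGval : ∀ x ∈ openInt 0 D, G₀ (phi p ν x).toReal = g x / vhat p ν x := fun x hx =>
    congrFun hG₀ ⟨x, hx⟩
  have him : MeasurableSet ((fun x => (phi p ν x).toReal) '' openInt 0 D) := by
    have := hemb.measurableSet_range
    rwa [range_domRestrict] at this
  -- Outside the range of φ the new function must be 0, since its p-norm is taken over the whole
  -- half-line even when φ is bounded.
  set G := ((fun x => (phi p ν x).toReal) '' openInt 0 D).indicator G₀ with hG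
  have hGm : Measurable G := hG₀m.indicator him
  have hGval' : ∀ x ∈ openInt 0 D, G (phi p ν x).toReal = g x / vhat p ν x := fun x hx => by
    rw [hG, indicator_of_mem (mem_image_of_mem _ hx), hGval x hx]
  have hae : ∀ᵐ x ∂(volume.restrict (openInt 0 D)),
      vhat p ν x * G (phi p ν x).toReal = g x := by
    filter_upwards [ae_vhat_lt_top hD hφ, ae_restrict_of_ae (ae_vhat_pos (ν := ν) hp),
      ae_restrict_mem (measurableSet_openInt _ _)] with x h1 h2 hx
    rw [hGval' x hx, ENNReal.mul_div_cancel h2.ne' h1.ne]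
  have haep : ∀ᵐ x ∂(volume.restrict (openInt 0 D)),
      vhat p ν x * G (phi p ν x).toReal ^ p = g x ^ p * dens ν x := by
    filter_upwards [ae_vhat_lt_top hD hφ, ae_restrict_of_ae (ae_vhat_pos (ν := ν) hp),
      ae_restrict_mem (measurableSet_openInt _ _), ae_vhat_rpow_mul_dens hp hD hφ]
      with x h1 h2 hx h3
    have h4 : vhat p ν x ^ p ≠ 0 := by
      rw [Ne, ENNReal.rpow_eq_zero_iff_of_pos hp0]; exact h2.ne'
    have h5 : vhat p ν x ^ p ≠ ∞ := ENNReal.rpow_ne_top_of_nonneg hp0.le h1.ne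
    rw [hGval' x hx, ENNReal.div_rpow_of_nonneg _ _ hp0.le]
    nth_rw 1 [← h3]
    rw [mul_right_comm, ENNReal.mul_div_cancel h4 h5]
  refine ⟨G, hGm, fun x hx => ?_, ?_⟩
  · have h1 := lintegral_comp_prim measurable_vhat (hφ x hx).ne hGm
    refine Eq.trans ?_ h1
    refine lintegral_congr_ae ?_
    filter_upwards [ae_restrict_of_ae_restrict_of_subset (Ioc_subset_openInt hx) hae] with y hy
    exact hy.symm
  · obtain ⟨u, humono, hu, hcof⟩ := exists_seq_openInt hD
    rw [lintegral_openInt_of_seq humono hu hcof]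
    have hsupp : ∀ t, G t ^ p =
        (⋃ n, Ioc 0 (phi p ν (u n)).toReal).indicator (fun t => G t ^ p) t := by
      intro t
      by_cases ht : t ∈ (fun x => (phi p ν x).toReal) '' openInt 0 D
      · obtain ⟨x, hx, rfl⟩ := ht
        obtain ⟨n, hn⟩ := hcof x hx
        rw [indicator_of_mem]
        exact mem_iUnion.2 ⟨n, ENNReal.toReal_pos (phi_pos hp hφ hx).ne' (hφ x hx).ne,
          (hφmono hx (hu n) hn).le⟩
      · have : G t = 0 := by rw [hG, indicator_of_notMem ht]
        simp [indicator, this, hp0]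
    have hmono : Monotone fun n => Ioc 0 (phi p ν (u n)).toReal := fun i j hij =>
      Ioc_subset_Ioc_right (hφmono.monotoneOn (hu i) (hu j) (humono hij))
    calc ∫⁻ t in Ioi 0, G t ^ p
        ≤ ∫⁻ t, (⋃ n, Ioc 0 (phi p ν (u n)).toReal).indicator (fun t => G t ^ p) t := by
          refine (setLIntegral_le_lintegral _ _).trans (le_of_eq ?_)
          exact lintegral_congr hsupp
      _ = ⨆ n, ∫⁻ t in Ioc 0 (phi p ν (u n)).toReal, G t ^ p := by
          rw [lintegral_indicator (MeasurableSet.iUnion fun n => measurableSet_Ioc),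
            setLIntegral_iUnion_of_directed _ hmono.directed_le]
      _ ≤ ⨆ n, ∫⁻ x in Ioc 0 (u n), g x ^ p * dens ν x := by
          refine iSup_mono fun n => le_of_eq ?_
          have h1 := lintegral_comp_prim measurable_vhat (hφ _ (hu n)).ne (hGm.pow_const p)
          refine h1.symm.trans (lintegral_congr_ae ?_)
          filter_upwards [ae_restrict_of_ae_restrict_of_subset (Ioc_subset_openInt (hu n)) haep]
            with y hy using hy

/-- As φ > 0, every tail of `μ` vanishes. This disposes of the product 0 · ∞ when B = 0 and the norm
on the right is infinite. -/
theorem measure_openInt_eq_zero (hp : 1 < p) (hq : 0 < q) [SigmaFinite ν] (hD : 0 < D)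
    (hφ : ∀ x ∈ openInt 0 D, phi p ν x < ∞) (hB : constB p q D μ ν = 0) :
    μ (openInt 0 D) = 0 := by
  have hps : pStar p = p / (p - 1) := rfl
  have hp1 : 0 < p - 1 := by linarith
  have hpsp : 0 < pStar p := by rw [hps]; positivity
  obtain ⟨u, -, hu, -⟩ := exists_seq_openInt hD
  have hd := (mem_openInt_zero.1 (hu 0)).1
  have hsub : openInt 0 D ⊆ ⋃ n : ℕ, openInt ((u 0 / (n + 1 : ℝ) : ℝ) : EReal) D := by
    intro x hx
    have hx' := mem_openInt_zero.1 hx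
    obtain ⟨n, hn⟩ := exists_nat_gt (u 0 / x)
    refine mem_iUnion.2 ⟨n, mem_openInt_coe.2 ⟨?_, hx'.2⟩⟩
    rw [div_lt_iff₀ hx'.1] at hn
    rw [div_lt_iff₀ (by positivity)]
    nlinarith
  refine measure_mono_null hsub (measure_iUnion_null fun n => ?_)
  have hy : u 0 / (n + 1 : ℝ) ∈ openInt 0 D :=
    mem_openInt_of_le (hu 0) (by positivity) (div_le_self hd.le (by simp))
  have h1 : phi p ν (u 0 / (n + 1 : ℝ)) ^ (1 / pStar p) *
      μ (openInt ((u 0 / (n + 1 : ℝ) : ℝ) : EReal) D) ^ (1 / q) ≤ 0 :=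
    hB ▸ le_iSup₂_of_le (f := fun x (_ : x ∈ openInt 0 D) =>
      phi p ν x ^ (1 / pStar p) * μ (openInt (x : EReal) D) ^ (1 / q)) _ hy le_rfl
  rw [nonpos_iff_eq_zero, mul_eq_zero, ENNReal.rpow_eq_zero_iff_of_pos (by positivity),
    ENNReal.rpow_eq_zero_iff_of_pos (by positivity)] at h1
  exact h1.resolve_left (phi_pos hp hφ hy).ne'

/-- In the variable t = φ(x) the primitive is an increasing function of t, so `μ` may be replaced by
the extremal power density. What remains is the left side of Bliss' inequality, and the factor q/p*
of the density cancels the p*/q in its constant. -/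
theorem hardy_le_kConst (hp : 1 < p) (hpq : p < q) [SigmaFinite ν] (hD : 0 < D)
    (hφ : ∀ x ∈ openInt 0 D, phi p ν x < ∞) (hBt : constB p q D μ ν ≠ ∞) {g : ℝ → ℝ≥0∞}
    (hg : Measurable g) :
    (∫⁻ x in openInt 0 D, prim g x ^ q ∂μ) ^ (1 / q) ≤
      ENNReal.ofReal (kConst q p) * constB p q D μ ν *
        (∫⁻ x in openInt 0 D, g x ^ p * dens ν x) ^ (1 / p) := by
  have hp0 : 0 < p := by linarith
  have hq0 : 0 < q := by linarith
  have hps : pStar p = p / (p - 1) := rfl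
  have hp1 : 0 < p - 1 := by linarith
  have hpsp : 0 < pStar p := by rw [hps]; positivity
  have hconj : p.HolderConjugate (pStar p) := Real.HolderConjugate.conjExponent hp
  have hk := kConst_pos hp hpq.le
  rcases eq_or_ne (constB p q D μ ν) 0 with hB0 | hB0
  · rw [setLIntegral_measure_zero _ _ (measure_openInt_eq_zero hp hq0 hD hφ hB0),
      ENNReal.zero_rpow_of_pos (by positivity)]
    exact zero_le
  set Y := ∫⁻ x in openInt 0 D, g x ^ p * dens ν x with hY
  rcases eq_or_ne Y ∞ with hYt | hYt
  · rw [hYt, ENNReal.top_rpow_of_pos (by positivity), ENNReal.mul_top]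
    · exact le_top
    · exact mul_ne_zero (by simpa using hk) hB0
  obtain ⟨G, hGm, hGg, hGY⟩ := exists_change_of_variable hp hD hφ hg
  -- By Hölder's inequality against the constant 1 on (0, t], using the finite p-norm of `G`.
  have hGfin : ∀ t, prim G t ≠ ∞ := by
    intro t
    have h1 := ENNReal.lintegral_mul_le_Lp_mul_Lq (volume.restrict (Ioc 0 t)) hconj
      hGm.aemeasurable (aemeasurable_const (b := (1 : ℝ≥0∞)))
    simp only [Pi.mul_apply, mul_one, ENNReal.one_rpow, lintegral_one, Measure.restrict_apply_univ,
      Real.volume_Ioc] at h1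
    refine ne_top_of_le_ne_top (ENNReal.mul_ne_top ?_ ?_) h1
    · refine ENNReal.rpow_ne_top_of_nonneg (by positivity) (ne_top_of_le_ne_top hYt (le_trans ?_ hGY))
      exact lintegral_mono_set Ioc_subset_Ioi_self
    · exact ENNReal.rpow_ne_top_of_nonneg (by positivity) ENNReal.ofReal_ne_top
  set β := (constB p q D μ ν).toReal with hβ
  have hβ0 : 0 ≤ β := ENNReal.toReal_nonneg
  have hBβ : constB p q D μ ν = ENNReal.ofReal β := (ENNReal.ofReal_toReal hBt).symm
  set b := β ^ q with hb
  have hb0 : 0 ≤ b := by positivity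
  have hbβ : b ^ (1 / q) = β := by
    rw [hb, ← Real.rpow_mul hβ0, mul_one_div_cancel hq0.ne', Real.rpow_one]
  have htail := lintegral_comp_phi_le (μ := μ) hp hq0 hφ hb0 (hBβ.trans (by rw [hbβ])).le
    (f := fun t => (prim G t).toReal ^ q) (fun t => Real.rpow_nonneg ENNReal.toReal_nonneg _)
    ((measurable_prim G).ennreal_toReal.pow_const q)
    (fun s _ t _ hst => Real.rpow_le_rpow ENNReal.toReal_nonneg
      (ENNReal.toReal_mono (hGfin t) (prim_mono G hst)) hq0.le)
    (by simp [prim_of_nonpos G le_rfl, hq0.ne'])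
  have hpt : ∀ t, ENNReal.ofReal ((prim G t).toReal ^ q) = prim G t ^ q := fun t => by
    rw [← ENNReal.ofReal_rpow_of_nonneg ENNReal.toReal_nonneg hq0.le,
      ENNReal.ofReal_toReal (hGfin t)]
  simp only [hpt] at htail
  have hmain : ∫⁻ x in openInt 0 D, prim g x ^ q ∂μ ≤
      ENNReal.ofReal ((kConst q p * β) ^ q) * Y ^ (q / p) := by
    calc ∫⁻ x in openInt 0 D, prim g x ^ q ∂μ
        = ∫⁻ x in openInt 0 D, prim G (phi p ν x).toReal ^ q ∂μ :=
          setLIntegral_congr_fun (measurableSet_openInt _ _) fun x hx => by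
            simp only [hGg x hx]
      _ ≤ ENNReal.ofReal (b * (q / pStar p)) *
          ∫⁻ t in Ioi 0, prim G t ^ q * ENNReal.ofReal (t ^ (-(q / pStar p + 1))) := by
          refine htail.trans (le_of_eq ?_)
          rw [← lintegral_const_mul' _ _ ENNReal.ofReal_ne_top]
          refine lintegral_congr fun t => ?_
          rw [ENNReal.ofReal_mul (by positivity), mul_left_comm]
          congr 4; ring
      _ ≤ ENNReal.ofReal (b * (q / pStar p)) *
          (ENNReal.ofReal (pStar p / q * blissInt q p ^ (1 - q / p)) * Y ^ (q / p)) := by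
          gcongr
          refine (bliss hp hpq hGm).trans ?_
          gcongr
      _ = _ := by
          rw [← mul_assoc, ← ENNReal.ofReal_mul (by positivity), ← kConst_rpow hp hpq,
            Real.mul_rpow hk.le hβ0, ← hb]
          congr 2
          field_simp
  refine (ENNReal.rpow_le_rpow hmain (by positivity : 0 ≤ 1 / q)).trans (le_of_eq ?_)
  rw [ENNReal.mul_rpow_of_nonneg _ _ (by positivity), ← ENNReal.rpow_mul,
    ENNReal.ofReal_rpow_of_nonneg (by positivity) (by positivity), ← Real.rpow_mul (by positivity),
    mul_one_div_cancel hq0.ne', Real.rpow_one, ENNReal.ofReal_mul hk.le, ← hBβ]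
  congr 2
  field_simp

/-- Bliss' inequality covers p < q only. For p = q the constants k and k̃ coincide, and the route
through `delta` gives the claim. -/
theorem optConst_le_kConst_mul (hp : 1 < p) (hpq : p ≤ q) [SigmaFinite ν] (hD : 0 < D)
    (hφ : ∀ x ∈ openInt 0 D, phi p ν x < ∞) :
    optConst p q D μ ν ≤ ENNReal.ofReal (kConst q p) * constB p q D μ ν := by
  rcases hpq.eq_or_lt with rfl | hlt
  · have hk : kConst p p = kTilde p p := by
      have hps : pStar p = p / (p - 1) := rfl
      have hp1 : 0 < p - 1 := by linarith
      have hp0 : 0 < p := by linarith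
      rw [kConst, kTilde, if_neg (lt_irrefl _)]
      congr 2
      · rw [hps]; field_simp; ring
      · rw [hps]; field_simp; ring
    rw [hk]
    exact (optConst_le_delta hp hpq hD hφ).trans (delta_le hp hpq hφ)
  · rcases eq_or_ne (constB p q D μ ν) ∞ with hBt | hBt
    · rw [hBt, ENNReal.mul_top (by simpa using kConst_pos hp hpq)]
      exact le_top
    · exact optConst_le hp (by linarith) fun g hg => hardy_le_kConst hp hlt hD hφ hBt hg

/-! ### The first lower bound -/

variable {p q : ℝ} {μ ν : Measure ℝ} {D : EReal}

theorem cut_coe (x₀ x : ℝ) : cut (x₀ : EReal) x = min x x₀ := by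
  rcases le_total x x₀ with h | h
  · rw [cut, min_eq_left (EReal.coe_le_coe_iff.2 h), min_eq_left h, EReal.toReal_coe]
  · rw [cut, min_eq_right (EReal.coe_le_coe_iff.2 h), min_eq_right h, EReal.toReal_coe]

theorem cut_self_of_mem {x : ℝ} (hx : x ∈ openInt 0 D) : cut D x = x := by
  rw [cut, min_eq_left (mem_openInt_zero.1 hx).2.le, EReal.toReal_coe]

theorem min_mem_openInt {x y : ℝ} (hx : x ∈ openInt 0 D) (hy : y ∈ openInt 0 D) :
    min x y ∈ openInt 0 D :=
  mem_openInt_of_le hx (lt_min (mem_openInt_zero.1 hx).1 (mem_openInt_zero.1 hy).1)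
    (min_le_left _ _)

theorem eq_or_exists_coe {x₀ : EReal} (h0 : 0 < x₀) (hD : x₀ ≤ D) :
    x₀ = D ∨ ∃ x ∈ openInt 0 D, x₀ = ((x : ℝ) : EReal) := by
  rcases hD.eq_or_lt with h | h
  · exact Or.inl h
  · right
    lift x₀ to ℝ using ⟨(lt_of_lt_of_le h le_top).ne, (lt_of_le_of_lt bot_le h0).ne'⟩
    exact ⟨x₀, ⟨h0, h⟩, rfl⟩

theorem lintegral_openInt_split {y x : ℝ} (hyx : y ≤ x) (hx : (x : EReal) < D) (f : ℝ → ℝ≥0∞) :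
    ∫⁻ z in openInt (y : EReal) D, f z ∂μ =
      (∫⁻ z in Ioc y x, f z ∂μ) + ∫⁻ z in openInt (x : EReal) D, f z ∂μ := by
  rw [← lintegral_union (measurableSet_openInt _ _)]
  · congr 2
    ext z
    rw [mem_union, mem_openInt_coe, mem_openInt_coe, mem_Ioc]
    constructor
    · rintro ⟨h1, h2⟩
      rcases le_or_gt z x with h | h
      · exact Or.inl ⟨h1, h⟩
      · exact Or.inr ⟨h, h2⟩
    · rintro (⟨h1, h2⟩ | ⟨h1, h2⟩)
      · exact ⟨h1, lt_of_le_of_lt (EReal.coe_le_coe_iff.2 h2) hx⟩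
      · exact ⟨lt_of_le_of_lt hyx h1, h2⟩
  · rw [Set.disjoint_left]
    intro z hz hz'
    exact absurd (mem_openInt_coe.1 hz').1 (not_lt.2 hz.2)

/-- Integrals of functions of `φ(· ∧ x)`. -/
theorem lintegral_phi_min_rpow {y x : ℝ} (hyx : y ≤ x) (hx : (x : EReal) < D) (r : ℝ) :
    ∫⁻ z in openInt (y : EReal) D, phi p ν (min z x) ^ r ∂μ =
      (∫⁻ z in Ioc y x, phi p ν z ^ r ∂μ) + phi p ν x ^ r * μ (openInt (x : EReal) D) := by
  rw [lintegral_openInt_split hyx hx, ← setLIntegral_const]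
  congr 1
  · exact setLIntegral_congr_fun measurableSet_Ioc fun z hz => by simp only [min_eq_left hz.2]
  · exact setLIntegral_congr_fun (measurableSet_openInt _ _) fun z hz => by
      simp only [min_eq_right (mem_openInt_coe.1 hz).1.le]

theorem prim_indicator_Ioc (g : ℝ → ℝ≥0∞) (x₀ x : ℝ) :
    prim ((Ioc 0 x₀).indicator g) x = prim g (min x x₀) := by
  rw [prim, prim, lintegral_indicator measurableSet_Ioc, Measure.restrict_restrict measurableSet_Ioc,
    Ioc_inter_Ioc, max_self, min_comm]

theorem ae_deriv_prim {g : ℝ → ℝ≥0∞} (hg : Measurable g) (hint : ∫⁻ y, g y ≠ ∞) :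
    ∀ᵐ x, 0 < x → deriv (fun x => (prim g x).toReal) x = (g x).toReal := by
  have hi : Integrable fun y => (g y).toReal :=
    integrable_toReal_of_lintegral_ne_top hg.aemeasurable hint
  filter_upwards [LocallyIntegrable.ae_hasDerivAt_integral hi.locallyIntegrable] with x hx hx0
  rw [← (hx 0).deriv]
  refine Filter.EventuallyEq.deriv_eq ?_
  filter_upwards [Ioi_mem_nhds hx0] with y hy
  rw [intervalIntegral.integral_of_le (le_of_lt hy), integral_toReal hg.aemeasurable
    (ae_restrict_of_ae (ae_lt_top hg hint))]
  rfl

theorem lintegral_indicator_vhat (x : ℝ) :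
    ∫⁻ y, (Ioc 0 x).indicator (vhat p ν) y = phi p ν x := by
  rw [lintegral_indicator measurableSet_Ioc]; rfl

theorem lintegral_indicator_vhat_rpow (hp : 1 < p) [SigmaFinite ν] (hD : 0 < D)
    (hφ : ∀ x ∈ openInt 0 D, phi p ν x < ∞) {x : ℝ} (hx : x ∈ openInt 0 D) :
    ∫⁻ y in openInt 0 D, (Ioc 0 x).indicator (vhat p ν) y ^ p * dens ν y = phi p ν x := by
  have hp0 : 0 < p := by linarith
  calc _ = ∫⁻ y in openInt 0 D, (Ioc 0 x).indicator (vhat p ν) y := by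
        refine lintegral_congr_ae ?_
        filter_upwards [ae_vhat_rpow_mul_dens hp hD hφ] with y hy
        by_cases h : y ∈ Ioc 0 x <;> simp [h, hy, hp0]
    _ = phi p ν x := by
        rw [lintegral_indicator measurableSet_Ioc, Measure.restrict_restrict measurableSet_Ioc,
          inter_eq_left.2 (Ioc_subset_openInt hx)]
        rfl

theorem ae_deriv_testFun_coe (hφ : ∀ x ∈ openInt 0 D, phi p ν x < ∞) {x : ℝ}
    (hx : x ∈ openInt 0 D) : ∀ᵐ y, 0 < y → deriv (fun y => (testFun p ν (x : EReal) y).toReal) y =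
      ((Ioc 0 x).indicator (vhat p ν) y).toReal := by
  have h := ae_deriv_prim (measurable_vhat (p := p) (ν := ν) |>.indicator
    (measurableSet_Ioc (a := (0 : ℝ)) (b := x))) (by
      rw [lintegral_indicator_vhat]; exact (hφ x hx).ne)
  have e : (fun y => (testFun p ν (x : EReal) y).toReal) =
      fun y => (prim ((Ioc 0 x).indicator (vhat p ν)) y).toReal := by
    ext y; rw [testFun, cut_coe, prim_indicator_Ioc]; rfl
  rwa [e]

theorem ae_deriv_testFun_self (hD : 0 < D) (hφ : ∀ x ∈ openInt 0 D, phi p ν x < ∞) :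
    ∀ᵐ y ∂(volume.restrict (openInt 0 D)),
      deriv (fun y => (testFun p ν D y).toReal) y = (vhat p ν y).toReal := by
  refine ae_restrict_openInt hD fun T hT => ?_
  have hne : ∀ᵐ y ∂(volume.restrict (Ioc 0 T)), y ≠ T :=
    ae_restrict_of_ae (by simp [ae_iff])
  filter_upwards [ae_restrict_of_ae (ae_deriv_testFun_coe hφ hT), ae_restrict_mem measurableSet_Ioc,
    hne] with y hy hyT hyne
  rw [indicator_of_mem hyT] at hy
  rw [← hy hyT.1]
  refine Filter.EventuallyEq.deriv_eq ?_
  filter_upwards [Ioo_mem_nhds hyT.1 (lt_of_le_of_ne hyT.2 hyne)] with z hz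
  have hzI := mem_openInt_of_le hT hz.1 hz.2.le
  rw [testFun, testFun, cut_self_of_mem hzI, cut_coe, min_eq_left hz.2.le]

theorem lrNorm_deriv_testFun (hp : 1 < p) {f : ℝ → ℝ}
    {g : ℝ → ℝ≥0∞} (h : ∀ᵐ y ∂(volume.restrict (openInt 0 D)), deriv f y = (g y).toReal)
    (hg : ∀ᵐ y ∂(volume.restrict (openInt 0 D)), g y < ∞) :
    lrNorm D (volume.withDensity (dens ν)) p (deriv f) =
      (∫⁻ y in openInt 0 D, g y ^ p * dens ν y) ^ (1 / p) := by
  have hp0 : 0 < p := by linarith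
  rw [lrNorm_eq _ _ hp0, restrict_withDensity (measurableSet_openInt _ _),
    lintegral_withDensity_eq_lintegral_mul _ measurable_dens
      ((measurable_deriv f).enorm.pow_const p)]
  congr 1
  refine lintegral_congr_ae ?_
  filter_upwards [h, hg] with y hy hgy
  rw [Pi.mul_apply, hy, Real.enorm_of_nonneg ENNReal.toReal_nonneg, ENNReal.ofReal_toReal hgy.ne,
    mul_comm]

theorem lrNorm_deriv_testFun_coe (hp : 1 < p) [SigmaFinite ν] (hD : 0 < D)
    (hφ : ∀ x ∈ openInt 0 D, phi p ν x < ∞) {x : ℝ} (hx : x ∈ openInt 0 D) :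
    lrNorm D (volume.withDensity (dens ν)) p
      (deriv fun y => (testFun p ν (x : EReal) y).toReal) = phi p ν x ^ (1 / p) := by
  rw [lrNorm_deriv_testFun hp (g := (Ioc 0 x).indicator (vhat p ν)),
    lintegral_indicator_vhat_rpow hp hD hφ hx]
  · filter_upwards [ae_restrict_of_ae (ae_deriv_testFun_coe hφ hx),
      ae_restrict_mem (measurableSet_openInt _ _)] with y hy hyI
    exact hy (mem_openInt_zero.1 hyI).1
  · filter_upwards [ae_vhat_lt_top hD hφ] with y hy
    by_cases h : y ∈ Ioc 0 x <;> simp [h, hy]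

theorem lrNorm_deriv_testFun_self (hp : 1 < p) [SigmaFinite ν] (hD : 0 < D)
    (hφ : ∀ x ∈ openInt 0 D, phi p ν x < ∞) :
    lrNorm D (volume.withDensity (dens ν)) p (deriv fun y => (testFun p ν D y).toReal) =
      (∫⁻ y in openInt 0 D, vhat p ν y) ^ (1 / p) := by
  rw [lrNorm_deriv_testFun hp (ae_deriv_testFun_self hD hφ) (ae_vhat_lt_top hD hφ)]
  congr 1
  exact lintegral_congr_ae (ae_vhat_rpow_mul_dens hp hD hφ)

theorem phi_le_lintegral_vhat {x : ℝ} (hx : x ∈ openInt 0 D) :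
    phi p ν x ≤ ∫⁻ y in openInt 0 D, vhat p ν y := lintegral_mono_set (Ioc_subset_openInt hx)

/-- The quantity in the explicit formula for `deltaBar`. -/
theorem deltaBar_bracket (hp : 1 < p) [SigmaFinite ν]
    (hφ : ∀ x ∈ openInt 0 D, phi p ν x < ∞) {x : ℝ} (hx : x ∈ openInt 0 D) :
    1 / phi p ν x ^ (q / p) * (∫⁻ z in Ioc 0 x, phi p ν z ^ q ∂μ) +
        phi p ν x ^ (q / pStar p) * μ (openInt (x : EReal) D) =
      (∫⁻ z in openInt 0 D, phi p ν (min z x) ^ q ∂μ) / phi p ν x ^ (q / p) := by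
  have hx' := mem_openInt_zero.1 hx
  have hps : pStar p = p / (p - 1) := rfl
  have hp1 : p - 1 ≠ 0 := by linarith
  rw [← EReal.coe_zero, lintegral_phi_min_rpow hx'.1.le hx'.2, ENNReal.add_div, one_div,
    ENNReal.div_eq_inv_mul]
  congr 1
  rw [mul_comm, mul_comm (phi p ν x ^ q), mul_div_assoc, ← ENNReal.rpow_sub _ _
    (phi_pos hp hφ hx).ne' (hφ x hx).ne]
  congr 2
  rw [hps]; field_simp

/-- For x₀ < D the derivative of the test function is v̂ cut off at x₀, whose p-energy is φ(x₀). The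
remaining value x₀ = D is dominated by the others. -/
theorem deltaBar_eq (hp : 1 < p) (hpq : p ≤ q) [SigmaFinite ν] (hD : 0 < D)
    (hφ : ∀ x ∈ openInt 0 D, phi p ν x < ∞) :
    deltaBar p q D μ ν = (⨆ x ∈ openInt 0 D,
      (1 / phi p ν x ^ (q / p) * (∫⁻ z in Ioc 0 x, phi p ν z ^ q ∂μ) +
        phi p ν x ^ (q / pStar p) * μ (openInt (x : EReal) D))) ^ (1 / q) := by
  have hp0 : 0 < p := by linarith
  have hq0 : 0 < q := by linarith
  set S := ⨆ x ∈ openInt 0 D, (1 / phi p ν x ^ (q / p) * (∫⁻ z in Ioc 0 x, phi p ν z ^ q ∂μ) +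
        phi p ν x ^ (q / pStar p) * μ (openInt (x : EReal) D)) with hS
  have hterm : ∀ x ∈ openInt 0 D, lrNorm D μ q (testFun p ν (x : EReal)) /
      lrNorm D (volume.withDensity (dens ν)) p
        (deriv (fun y => (testFun p ν (x : EReal) y).toReal)) =
      (1 / phi p ν x ^ (q / p) * (∫⁻ z in Ioc 0 x, phi p ν z ^ q ∂μ) +
        phi p ν x ^ (q / pStar p) * μ (openInt (x : EReal) D)) ^ (1 / q) := by
    intro x hx
    rw [lrNorm_deriv_testFun_coe hp hD hφ hx, deltaBar_bracket hp hφ hx, lrNorm_eq D μ hq0,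
      ENNReal.div_rpow_of_nonneg _ _ (by positivity), ← ENNReal.rpow_mul]
    have : q / p * (1 / q) = 1 / p := by field_simp
    rw [this]
    simp only [testFun, cut_coe, enorm_eq_self]
  rw [deltaBar]
  apply le_antisymm
  · refine iSup₂_le fun x₀ hx₀ => ?_
    rcases eq_or_exists_coe hx₀.1 hx₀.2 with rfl | ⟨x, hx, rfl⟩
    · obtain ⟨u, humono, hu, hcof⟩ := exists_seq_openInt hD
      rw [lrNorm_deriv_testFun_self hp hD hφ, lrNorm_eq _ μ hq0]
      set L := ∫⁻ y in openInt 0 x₀, vhat p ν y with hL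
      -- Exhaust the numerator by (0, u n] and decrease the denominator from the total mass L to φ(u
      -- n); what results is a part of the bracket at u n. If L = ∞ the quotient is 0, in accordance
      -- with the convention.
      have hle : (∫⁻ z in openInt 0 x₀, phi p ν z ^ q ∂μ) / L ^ (q / p) ≤ S := by
        rw [lintegral_openInt_of_seq humono hu hcof, ENNReal.iSup_div]
        refine iSup_le fun n => ?_
        refine le_trans ?_ (le_iSup₂_of_le (u n) (hu n) le_self_add)
        rw [one_div, ← ENNReal.div_eq_inv_mul]
        refine ENNReal.div_le_div_left (ENNReal.rpow_le_rpow (phi_le_lintegral_vhat (hu n)) (by positivity)) _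
      refine le_trans (le_of_eq ?_) (ENNReal.rpow_le_rpow hle (by positivity))
      rw [ENNReal.div_rpow_of_nonneg _ _ (by positivity), ← ENNReal.rpow_mul]
      have : q / p * (1 / q) = 1 / p := by field_simp
      rw [this]
      congr 2
      exact setLIntegral_congr_fun (measurableSet_openInt _ _) fun z hz => by
        simp only [testFun, cut_self_of_mem hz, enorm_eq_self]
    · rw [hterm x hx]
      exact ENNReal.rpow_le_rpow (le_iSup₂_of_le x hx le_rfl) (by positivity)
  · rw [one_div, ENNReal.rpow_inv_le_iff hq0]
    refine iSup₂_le fun x hx => ?_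
    rw [← ENNReal.rpow_inv_le_iff hq0, ← one_div, ← hterm x hx]
    exact le_iSup₂_of_le (x : EReal) ⟨(hx.1 : (0 : EReal) < x), hx.2.le⟩ le_rfl

theorem constB_le_deltaBar (hp : 1 < p) (hpq : p ≤ q) [SigmaFinite ν] (hD : 0 < D)
    (hφ : ∀ x ∈ openInt 0 D, phi p ν x < ∞) : constB p q D μ ν ≤ deltaBar p q D μ ν := by
  have hq0 : 0 < q := by linarith
  rw [deltaBar_eq hp hpq hD hφ]
  refine iSup₂_le fun x hx => ?_
  refine le_trans (le_of_eq ?_) (ENNReal.rpow_le_rpow (le_iSup₂_of_le x hx le_add_self)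
    (by positivity))
  rw [ENNReal.mul_rpow_of_nonneg _ _ (by positivity), ← ENNReal.rpow_mul]
  congr 2
  field_simp

/-- The inequality with the optimal constant is tested with g equal to v̂ on (0, x] and 0 elsewhere.
-/
theorem deltaBar_le_optConst (hp : 1 < p) (hpq : p ≤ q) [SigmaFinite ν] (hD : 0 < D)
    (hφ : ∀ x ∈ openInt 0 D, phi p ν x < ∞) : deltaBar p q D μ ν ≤ optConst p q D μ ν := by
  have hp0 : 0 < p := by linarith
  have hq0 : 0 < q := by linarith
  rw [deltaBar_eq hp hpq hD hφ, one_div, ENNReal.rpow_inv_le_iff hq0]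
  refine iSup₂_le fun x hx => ?_
  have hpos := phi_pos hp hφ hx
  have h := le_optConst_mul (μ := μ) hp (by linarith : 1 < q) hD hφ
    (measurable_vhat (p := p) (ν := ν) |>.indicator (measurableSet_Ioc (a := (0 : ℝ)) (b := x)))
    (by rw [lintegral_indicator_vhat]; exact (hφ x hx).ne)
    (by rw [lintegral_indicator_vhat_rpow hp hD hφ hx]; exact (hφ x hx).ne)
  rw [lintegral_indicator_vhat_rpow hp hD hφ hx] at h
  simp only [prim_indicator_Ioc, ← phi_eq_prim] at h
  have h2 := ENNReal.rpow_le_rpow h hq0.le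
  rw [ENNReal.mul_rpow_of_nonneg _ _ hq0.le, ← ENNReal.rpow_mul, ← ENNReal.rpow_mul,
    one_div_mul_cancel hq0.ne', ENNReal.rpow_one, one_div_mul_eq_div] at h2
  rw [deltaBar_bracket hp hφ hx, ENNReal.div_le_iff]
  · exact h2
  · rw [Ne, ENNReal.rpow_eq_zero_iff_of_pos (by positivity)]; exact hpos.ne'
  · exact ENNReal.rpow_ne_top_of_nonneg (by positivity) (hφ x hx).ne

/-! ### The explicit form of `deltaTilde` -/

variable {p q : ℝ} {μ ν : Measure ℝ} {D : EReal}

theorem prim_add (g : ℝ → ℝ≥0∞) {x y : ℝ} (hx : 0 ≤ x) (hxy : x ≤ y) :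
    prim g y = prim g x + ∫⁻ z in Ioc x y, g z := by
  rw [prim, prim, ← Ioc_union_Ioc_eq_Ioc hx hxy, lintegral_union measurableSet_Ioc
    (Ioc_disjoint_Ioc_of_le le_rfl)]

theorem setLIntegral_Ioc_mul_le {g H : ℝ → ℝ≥0∞} (hg : Measurable g) (hH : Antitone H) (x y : ℝ) :
    ∫⁻ z in Ioc x y, g z * H z ≤ (∫⁻ z in Ioc x y, g z) * H x := by
  rw [← lintegral_mul_const _ hg]
  exact setLIntegral_mono' measurableSet_Ioc fun z hz => mul_le_mul' le_rfl (hH hz.1.le)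

/-- Averages of a decreasing function against a weight decrease. -/
theorem prim_mul_prim_le {g H : ℝ → ℝ≥0∞} (hg : Measurable g) (hH : Antitone H) {x y : ℝ}
    (hx : 0 ≤ x) (hxy : x ≤ y) :
    prim g x * prim (fun z => g z * H z) y ≤ prim g y * prim (fun z => g z * H z) x := by
  have h1 : prim g x * H x ≤ prim (fun z => g z * H z) x := by
    rw [prim, ← lintegral_mul_const _ hg]
    exact setLIntegral_mono' measurableSet_Ioc fun z hz => mul_le_mul' le_rfl (hH hz.2)
  rw [prim_add _ hx hxy, prim_add g hx hxy, mul_add, add_mul]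
  refine add_le_add le_rfl ?_
  calc _ ≤ prim g x * ((∫⁻ z in Ioc x y, g z) * H x) :=
        mul_le_mul' le_rfl (setLIntegral_Ioc_mul_le hg hH x y)
    _ = (∫⁻ z in Ioc x y, g z) * (prim g x * H x) := by ring
    _ ≤ _ := mul_le_mul' le_rfl h1

/-- The factor `y ↦ (∫_{(y, D)} f^{q-1} dμ)^{p*-1}` in the operator `II`. -/
noncomputable def tailPow (p q : ℝ) (D : EReal) (μ : Measure ℝ) (f : ℝ → ℝ≥0∞) (y : ℝ) : ℝ≥0∞ :=
  (∫⁻ z in openInt (y : EReal) D, f z ^ (q - 1) ∂μ) ^ (pStar p - 1)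

theorem pStar_sub_one (hp : 1 < p) : pStar p - 1 = (p - 1)⁻¹ := by
  have hp1 : p - 1 ≠ 0 := by linarith
  have : pStar p = p / (p - 1) := rfl
  rw [this]; field_simp; ring

theorem pStar_sub_one_pos (hp : 1 < p) : 0 < pStar p - 1 := by
  rw [pStar_sub_one hp, inv_pos]; linarith

theorem antitone_tailPow (hp : 1 < p) (f : ℝ → ℝ≥0∞) : Antitone (tailPow p q D μ f) := by
  intro x y hxy
  refine ENNReal.rpow_le_rpow (lintegral_mono_set fun z hz => ?_) (pStar_sub_one_pos hp).le
  exact ⟨lt_of_le_of_lt (EReal.coe_le_coe_iff.2 hxy) hz.1, hz.2⟩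

theorem measurable_phi : Measurable (phi p ν) := phi_mono.measurable

theorem opIITilde_coe {x₀ x : ℝ} : opIITilde p q D μ ν (x₀ : EReal) (testFun p ν (x₀ : EReal)) x =
    prim (fun y => vhat p ν y * tailPow p q D μ (fun z => phi p ν (min z x₀)) y) (min x x₀) /
      phi p ν (min x x₀) := by
  simp only [opIITilde, testFun, cut_coe, prim, tailPow]

theorem f2_eq_prim {x₀ x : ℝ} (hx₀ : x₀ ∈ openInt 0 D) : f2 p q D μ ν x₀ x =
    prim (fun y => vhat p ν y * tailPow p q D μ (fun z => phi p ν (min z x₀)) y) (min x x₀) := by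
  refine setLIntegral_congr_fun measurableSet_Ioc fun y hy => ?_
  simp only [tailPow]
  rw [lintegral_phi_min_rpow (hy.2.trans (min_le_right _ _)) (mem_openInt_zero.1 hx₀).2]

theorem opIITilde_eq_f2_div {x₀ x : ℝ} (hx₀ : x₀ ∈ openInt 0 D) :
    opIITilde p q D μ ν (x₀ : EReal) (testFun p ν (x₀ : EReal)) x =
      f2 p q D μ ν x₀ x / phi p ν (min x x₀) := by
  rw [opIITilde_coe, f2_eq_prim hx₀]

theorem testFun_mul_opIITilde (hp : 1 < p) [SigmaFinite ν]
    (hφ : ∀ x ∈ openInt 0 D, phi p ν x < ∞) {x₀ x : ℝ} (hx₀ : x₀ ∈ openInt 0 D)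
    (hx : x ∈ openInt 0 D) :
    testFun p ν (x₀ : EReal) x * opIITilde p q D μ ν (x₀ : EReal) (testFun p ν (x₀ : EReal)) x =
      f2 p q D μ ν x₀ x := by
  have hm := min_mem_openInt hx hx₀
  rw [opIITilde_eq_f2_div hx₀, testFun, cut_coe,
    ENNReal.mul_div_cancel (phi_pos hp hφ hm).ne' (hφ _ hm).ne]

/-- The quotient is an average, with respect to v̂, of the decreasing function `tailPow`. It
decreases up to x₀ and is constant afterwards, so its smallest value is the one at x₀. -/
theorem f2_div_phi_le (hp : 1 < p) [SigmaFinite ν]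
    (hφ : ∀ x ∈ openInt 0 D, phi p ν x < ∞) {x₀ x : ℝ} (hx₀ : x₀ ∈ openInt 0 D)
    (hx : x ∈ openInt 0 D) :
    f2 p q D μ ν x₀ x₀ / phi p ν x₀ ≤ f2 p q D μ ν x₀ x / phi p ν (min x x₀) := by
  have hm := min_mem_openInt hx hx₀
  refine ENNReal.div_le_of_le_mul ?_
  rw [mul_comm, ← mul_div_assoc, ENNReal.le_div_iff_mul_le (Or.inl (phi_pos hp hφ hm).ne')
    (Or.inl (hφ _ hm).ne), f2_eq_prim hx₀, f2_eq_prim hx₀, min_self, mul_comm]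
  exact prim_mul_prim_le measurable_vhat (antitone_tailPow hp _) (mem_openInt_zero.1 hm).1.le
    (min_le_right _ _)

theorem iInf_opIITilde_coe (hp : 1 < p) [SigmaFinite ν]
    (hφ : ∀ x ∈ openInt 0 D, phi p ν x < ∞) {x₀ : ℝ} (hx₀ : x₀ ∈ openInt 0 D) :
    ⨅ x ∈ openInt 0 D, opIITilde p q D μ ν (x₀ : EReal) (testFun p ν (x₀ : EReal)) x =
      f2 p q D μ ν x₀ x₀ / phi p ν x₀ := by
  simp only [opIITilde_eq_f2_div hx₀]
  refine le_antisymm (iInf₂_le_of_le x₀ hx₀ ?_) (le_iInf₂ fun x hx => f2_div_phi_le hp hφ hx₀ hx)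
  rw [min_self]

theorem testFun_coe_mem_domTilde (hp : 1 < p) [SigmaFinite ν]
    (hφ : ∀ x ∈ openInt 0 D, phi p ν x < ∞) {x₀ : ℝ} (hx₀ : x₀ ∈ openInt 0 D) :
    testFun p ν (x₀ : EReal) ∈ domTilde p q D μ ν x₀ := by
  refine ⟨?_, fun x hx => ?_, fun x hx => ?_, fun h => ?_⟩
  · rw [testFun, cut_coe, min_eq_left (mem_openInt_zero.1 hx₀).1.le, phi_zero]
  · rw [testFun, cut_coe]
    have hm := min_mem_openInt hx hx₀
    exact ⟨phi_pos hp hφ hm, hφ _ hm⟩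
  · rw [testFun, testFun, cut_coe, cut_coe, min_assoc, min_self]
  · exact absurd h (mem_openInt_zero.1 hx₀).2.ne

theorem lrNorm_testFun_mul_opIITilde_coe (hp : 1 < p) [SigmaFinite ν]
    (hφ : ∀ x ∈ openInt 0 D, phi p ν x < ∞) {x₀ : ℝ} (hx₀ : x₀ ∈ openInt 0 D) :
    lrNorm D μ q (fun x => testFun p ν (x₀ : EReal) x *
      opIITilde p q D μ ν (x₀ : EReal) (testFun p ν (x₀ : EReal)) x) =
      lrNorm D μ q (f2 p q D μ ν x₀) := by
  refine eLpNorm_congr_ae ?_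
  filter_upwards [ae_restrict_mem (measurableSet_openInt _ _)] with x hx
  exact testFun_mul_opIITilde hp hφ hx₀ hx

theorem opIITilde_self {x : ℝ} (hx : x ∈ openInt 0 D) :
    opIITilde p q D μ ν D (testFun p ν D) x =
      prim (fun y => vhat p ν y * tailPow p q D μ (phi p ν) y) x / phi p ν x := by
  rw [opIITilde, testFun, cut_self_of_mem hx, prim]
  congr 1
  refine setLIntegral_congr_fun measurableSet_Ioc fun y hy => ?_
  simp only [tailPow]
  congr 2
  refine setLIntegral_congr_fun (measurableSet_openInt _ _) fun z hz => ?_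
  simp only [testFun, cut_self_of_mem (openInt_subset_openInt hy.1.le hz)]

theorem f2_le_prim (hp : 1 < p) (hpq : p ≤ q) {x₀ : ℝ} (hx₀ : x₀ ∈ openInt 0 D) (x : ℝ) :
    f2 p q D μ ν x₀ x ≤ prim (fun y => vhat p ν y * tailPow p q D μ (phi p ν) y) x := by
  rw [f2_eq_prim hx₀]
  refine le_trans (prim_mono _ (min_le_left _ _)) (lintegral_mono fun y => mul_le_mul' le_rfl ?_)
  exact ENNReal.rpow_le_rpow (lintegral_mono fun z => ENNReal.rpow_le_rpow
    (phi_mono (min_le_left _ _)) (by linarith)) (pStar_sub_one_pos hp).le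

/-- As x₀ increases to D, the truncated functions φ(· ∧ x₀) increase to φ, and monotone convergence
passes through both integrals. -/
theorem prim_tailPow_le_iSup_f2 (hp : 1 < p) (hpq : p ≤ q) {u : ℕ → ℝ} (hmono : Monotone u)
    (hmem : ∀ n, u n ∈ openInt 0 D) (hcof : ∀ x ∈ openInt 0 D, ∃ n, x < u n) {x : ℝ}
    (hx : x ∈ openInt 0 D) :
    prim (fun y => vhat p ν y * tailPow p q D μ (phi p ν) y) x ≤
      ⨆ n, f2 p q D μ ν (u n) (u n) := by
  have hq1 : 0 < q - 1 := by linarith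
  have hps := pStar_sub_one_pos hp
  have hT : Monotone fun n => tailPow p q D μ (fun z => phi p ν (min z (u n))) := fun i j hij y =>
    ENNReal.rpow_le_rpow (lintegral_mono fun z => ENNReal.rpow_le_rpow
      (phi_mono (min_le_min le_rfl (hmono hij))) hq1.le) hps.le
  have hsup : ∀ y ∈ Ioc 0 x, tailPow p q D μ (phi p ν) y =
      ⨆ n, tailPow p q D μ (fun z => phi p ν (min z (u n))) y := by
    intro y hy
    simp only [tailPow]
    have h1 : ∫⁻ z in openInt (y : EReal) D, phi p ν z ^ (q - 1) ∂μ =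
        ⨆ n, ∫⁻ z in openInt (y : EReal) D, phi p ν (min z (u n)) ^ (q - 1) ∂μ := by
      have hmeas : ∀ n, Measurable fun z => phi p ν (min z (u n)) ^ (q - 1) := fun n =>
        (measurable_phi.comp (measurable_id.min measurable_const)).pow_const _
      rw [← lintegral_iSup hmeas (fun i j hij z => ENNReal.rpow_le_rpow
        (phi_mono (min_le_min le_rfl (hmono hij))) hq1.le)]
      refine setLIntegral_congr_fun (measurableSet_openInt _ _) fun z hz => ?_
      obtain ⟨n, hn⟩ := hcof z (openInt_subset_openInt hy.1.le hz)
      refine le_antisymm (le_iSup_of_le n ?_) (iSup_le fun n =>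
        ENNReal.rpow_le_rpow (phi_mono (min_le_left _ _)) hq1.le)
      rw [min_eq_left hn.le]
    rw [h1]
    exact (ENNReal.orderIsoRpow _ hps).map_iSup _
  have hE : prim (fun y => vhat p ν y * tailPow p q D μ (phi p ν) y) x =
      ⨆ n, prim (fun y => vhat p ν y * tailPow p q D μ (fun z => phi p ν (min z (u n))) y) x := by
    simp only [prim]
    have hmeas : ∀ n, Measurable fun y =>
        vhat p ν y * tailPow p q D μ (fun z => phi p ν (min z (u n))) y := fun n =>
      measurable_vhat.mul (antitone_tailPow hp _).measurable
    rw [← lintegral_iSup hmeas (fun i j hij y => mul_le_mul' le_rfl (hT hij y))]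
    refine setLIntegral_congr_fun measurableSet_Ioc fun y hy => ?_
    simp only [hsup y hy, ENNReal.mul_iSup]
  rw [hE]
  obtain ⟨k, hk⟩ := hcof x hx
  refine iSup_le fun n => le_iSup_of_le (max n k) ?_
  rw [f2_eq_prim (hmem _), min_self]
  exact le_trans (prim_mono _ (hk.le.trans (hmono (le_max_right n k))))
    (lintegral_mono fun y => mul_le_mul' le_rfl (hT (le_max_left n k) y))

/-- When φ is unbounded, the average of `tailPow` with respect to v̂ tends to its limit at D, and
this limit is 0 because the tails are finite and shrink to the empty set. Membership in L^q serves
to make the quantities finite somewhere. -/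
theorem iInf_prim_tailPow_eq_zero (hp : 1 < p) (hpq : p ≤ q) [SigmaFinite ν] (hD : 0 < D)
    (hφ : ∀ x ∈ openInt 0 D, phi p ν x < ∞) (hL : ∫⁻ y in openInt 0 D, vhat p ν y = ∞)
    (hN : ∫⁻ x in openInt 0 D,
      prim (fun y => vhat p ν y * tailPow p q D μ (phi p ν) y) x ^ q ∂μ ≠ ∞) :
    ⨅ x ∈ openInt 0 D,
      prim (fun y => vhat p ν y * tailPow p q D μ (phi p ν) y) x / phi p ν x = 0 := by
  have hq0 : 0 < q := by linarith
  have hps := pStar_sub_one_pos hp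
  obtain ⟨u, hmono, hmem, hcof⟩ := exists_seq_openInt hD
  set E := prim (fun y => vhat p ν y * tailPow p q D μ (phi p ν) y) with hE
  set T := tailPow p q D μ (phi p ν) with hT
  have hTa : Antitone T := antitone_tailPow hp _
  set m := ⨅ x ∈ openInt 0 D, E x / phi p ν x with hm
  have hmE : ∀ x ∈ openInt 0 D, m * phi p ν x ≤ E x := fun x hx =>
    ENNReal.mul_le_of_le_div (iInf₂_le x hx)
  by_contra hm0
  rcases eq_or_ne (μ (openInt 0 D)) 0 with hμ | hμ
  · have hT0 : ∀ y, 0 ≤ y → T y = 0 := fun y hy => by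
      rw [hT, tailPow, setLIntegral_measure_zero _ _
        (measure_mono_null (openInt_subset_openInt hy) hμ), ENNReal.zero_rpow_of_pos hps]
    have hE0 : E (u 0) = 0 := by
      rw [hE, prim, setLIntegral_congr_fun measurableSet_Ioc (g := fun _ => 0)
        (fun y hy => by simp only [hT0 y hy.1.le, mul_zero])]
      simp
    have := hmE (u 0) (hmem 0)
    rw [hE0, nonpos_iff_eq_zero, mul_eq_zero] at this
    exact this.elim hm0 (phi_pos hp hφ (hmem 0)).ne'
  -- A finite L^q norm gives finiteness at a point only if `μ` does not vanish; that degenerate case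
  -- was treated before.
  obtain ⟨x₁, hx₁, hEx₁⟩ : ∃ x ∈ openInt 0 D, E x < ∞ := by
    have hae := ae_lt_top ((measurable_prim _).pow_const q) hN
    have hne : μ.restrict (openInt 0 D) ≠ 0 := by rwa [Ne, Measure.restrict_eq_zero]
    have : (ae (μ.restrict (openInt 0 D))).NeBot := ae_neBot.2 hne
    obtain ⟨x, hx, hxI⟩ := (hae.and (ae_restrict_mem (measurableSet_openInt _ _))).exists
    exact ⟨x, hxI, (ENNReal.rpow_lt_top_iff_of_pos hq0).1 hx⟩
  have hx₁' := mem_openInt_zero.1 hx₁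
  have hTx₁ : T x₁ < ∞ := by
    have hae := ae_lt_top (measurable_vhat.mul hTa.measurable) hEx₁.ne
    have hne : volume.restrict (Ioc 0 x₁) ≠ 0 := by
      rw [Ne, Measure.restrict_eq_zero]; simpa using hx₁'.1
    have : (ae (volume.restrict (Ioc 0 x₁))).NeBot := ae_neBot.2 hne
    obtain ⟨y, ⟨hy, hyI⟩, hyp⟩ := ((hae.and (ae_restrict_mem measurableSet_Ioc)).and
      (ae_restrict_of_ae (ae_vhat_pos (ν := ν) hp))).exists
    refine lt_of_le_of_lt (hTa hyI.2) ?_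
    by_contra h
    rw [not_lt, top_le_iff] at h
    rw [Pi.mul_apply, h, ENNReal.mul_top hyp.ne'] at hy
    exact lt_irrefl _ hy
  have hmtop : m ≠ ∞ := ne_top_of_le_ne_top
    (ENNReal.div_lt_top hEx₁.ne (phi_pos hp hφ hx₁).ne').ne (iInf₂_le x₁ hx₁)
  obtain ⟨y₀, hy₀, hxy, hTy⟩ : ∃ y ∈ openInt 0 D, x₁ ≤ y ∧ T y ≤ m / 2 := by
    set κ := μ.withDensity fun z => phi p ν z ^ (q - 1) with hκ
    have hTκ : ∀ y, T y = κ (openInt (y : EReal) D) ^ (pStar p - 1) := fun y => by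
      rw [hκ, withDensity_apply _ (measurableSet_openInt _ _)]; rfl
    set w : ℕ → ℝ := fun n => max x₁ (u n) with hw
    have hwmem : ∀ n, w n ∈ openInt 0 D := fun n => by
      rcases max_choice x₁ (u n) with h | h
      · simp only [hw, h, hx₁]
      · simp only [hw, h, hmem n]
    have hinter : ⋂ n, openInt (w n : EReal) D = ∅ := by
      rw [eq_empty_iff_forall_notMem]
      intro z hz
      rw [mem_iInter] at hz
      obtain ⟨n, hn⟩ := hcof z (openInt_subset_openInt (mem_openInt_zero.1 (hwmem 0)).1.le (hz 0))
      have := (mem_openInt_coe.1 (hz n)).1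
      exact absurd this (not_lt.2 (hn.le.trans (le_max_right _ _)))
    have hanti : Antitone fun n => openInt (w n : EReal) D := fun i j hij z hz =>
      ⟨lt_of_le_of_lt (EReal.coe_le_coe_iff.2 (max_le_max le_rfl (hmono hij))) hz.1, hz.2⟩
    have hfin : κ (openInt (w 0 : EReal) D) ≠ ∞ := by
      have h1 := lt_of_le_of_lt (hTa (le_max_left x₁ (u 0))) hTx₁
      rw [hTκ] at h1
      exact ((ENNReal.rpow_lt_top_iff_of_pos hps).1 h1).ne
    have hlim := tendsto_measure_iInter_atTop (μ := κ)
      (fun n => (measurableSet_openInt (w n : EReal) D).nullMeasurableSet) hanti ⟨0, hfin⟩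
    rw [hinter, measure_empty] at hlim
    have hlim2 := ((ENNReal.continuous_rpow_const (y := pStar p - 1)).tendsto 0).comp hlim
    rw [ENNReal.zero_rpow_of_pos hps] at hlim2
    obtain ⟨n, hn⟩ := (hlim2.eventually_lt_const
      (ENNReal.div_pos hm0 (by simp : (2 : ℝ≥0∞) ≠ ∞))).exists
    exact ⟨w n, hwmem n, le_max_left _ _, by rw [hTκ]; exact hn.le⟩
  have hEy₀ : E y₀ < ∞ := by
    rw [hE, prim_add _ hx₁'.1.le hxy]
    refine ENNReal.add_lt_top.2 ⟨hEx₁, lt_of_le_of_lt (setLIntegral_Ioc_mul_le measurable_vhat hTa _ _)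
      (ENNReal.mul_lt_top ?_ hTx₁)⟩
    exact lt_of_le_of_lt (lintegral_mono_set (Ioc_subset_Ioc_left hx₁'.1.le)) (hφ y₀ hy₀)
  have hm2 : m / 2 ≠ 0 := (ENNReal.div_pos hm0 (by simp)).ne'
  have hm2t : m / 2 ≠ ∞ := (ENNReal.div_lt_top hmtop (by simp)).ne
  -- Beyond y₀ the primitive grows by at most m/2 per unit of φ, while it must stay above m φ. Half
  -- of m φ is thus bounded by E(y₀), contradicting unboundedness of φ.
  have hbd : ∀ x ∈ openInt 0 D, phi p ν x ≤ E y₀ / (m / 2) := by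
    intro x hx
    rcases le_total x y₀ with h | h
    swap
    · rw [ENNReal.le_div_iff_mul_le (Or.inl hm2) (Or.inl hm2t), mul_comm]
      have h1 : E x ≤ E y₀ + m / 2 * phi p ν x := by
        rw [hE, prim_add _ (mem_openInt_zero.1 hy₀).1.le h]
        refine add_le_add le_rfl (le_trans (setLIntegral_Ioc_mul_le measurable_vhat hTa _ _) ?_)
        rw [mul_comm]
        exact mul_le_mul' hTy (lintegral_mono_set (Ioc_subset_Ioc_left (mem_openInt_zero.1 hy₀).1.le))
      have h2 := (hmE x hx).trans h1
      nth_rw 1 [← ENNReal.add_halves m] at h2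
      rw [add_mul] at h2
      exact (ENNReal.add_le_add_iff_right (ENNReal.mul_ne_top hm2t (hφ x hx).ne)).1 h2
    · refine le_trans (phi_mono h) ?_
      rw [ENNReal.le_div_iff_mul_le (Or.inl hm2) (Or.inl hm2t), mul_comm]
      refine le_trans (mul_le_mul' ?_ le_rfl) (hmE y₀ hy₀)
      exact ENNReal.half_le_self
  rw [lintegral_openInt_of_seq hmono hmem hcof] at hL
  exact (ENNReal.div_lt_top hEy₀.ne hm2).ne
    (top_le_iff.1 (hL ▸ iSup_le fun n => hbd _ (hmem n)))

/-- If the total mass L of v̂ is finite, m φ ≤ E gives m L ≤ sup E, and sup E is reached along the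
truncations; dividing by L ≥ φ(u n) gives the bound. If L = ∞ the left side is 0. -/
theorem iInf_prim_tailPow_le (hp : 1 < p) (hpq : p ≤ q) [SigmaFinite ν] (hD : 0 < D)
    (hφ : ∀ x ∈ openInt 0 D, phi p ν x < ∞)
    (hN : ∫⁻ x in openInt 0 D,
      prim (fun y => vhat p ν y * tailPow p q D μ (phi p ν) y) x ^ q ∂μ ≠ ∞) :
    ⨅ x ∈ openInt 0 D, prim (fun y => vhat p ν y * tailPow p q D μ (phi p ν) y) x / phi p ν x ≤
      ⨆ x ∈ openInt 0 D, f2 p q D μ ν x x / phi p ν x := by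
  rcases eq_or_ne (∫⁻ y in openInt 0 D, vhat p ν y) ∞ with hL | hL
  · rw [iInf_prim_tailPow_eq_zero hp hpq hD hφ hL hN]
    exact zero_le
  obtain ⟨u, hmono, hmem, hcof⟩ := exists_seq_openInt hD
  have hL0 : ∫⁻ y in openInt 0 D, vhat p ν y ≠ 0 :=
    (lt_of_lt_of_le (phi_pos hp hφ (hmem 0)) (phi_le_lintegral_vhat (hmem 0))).ne'
  set m := ⨅ x ∈ openInt 0 D,
    prim (fun y => vhat p ν y * tailPow p q D μ (phi p ν) y) x / phi p ν x with hm
  have h1 : m * ∫⁻ y in openInt 0 D, vhat p ν y ≤ ⨆ n, f2 p q D μ ν (u n) (u n) := by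
    rw [lintegral_openInt_of_seq hmono hmem hcof, ENNReal.mul_iSup]
    refine iSup_le fun n => le_trans ?_ (prim_tailPow_le_iSup_f2 hp hpq hmono hmem hcof (hmem n))
    exact ENNReal.mul_le_of_le_div (iInf₂_le (u n) (hmem n))
  rw [← ENNReal.le_div_iff_mul_le (Or.inl hL0) (Or.inl hL), ENNReal.iSup_div] at h1
  refine h1.trans (iSup_le fun n => le_iSup₂_of_le (u n) (hmem n) ?_)
  exact ENNReal.div_le_div_left (phi_le_lintegral_vhat (hmem n)) _

/-- For x₀ < D the norm and the infimum are those of `f2`. The term x₀ = D is dominated: its infimum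
is at most a supremum over interior points, and its norm is larger but enters with a nonpositive
exponent. -/
theorem deltaTilde_eq (hp : 1 < p) (hpq : p ≤ q) [SigmaFinite ν] (hD : 0 < D)
    (hφ : ∀ x ∈ openInt 0 D, phi p ν x < ∞) :
    deltaTilde p q D μ ν = ⨆ x₀ ∈ openInt 0 D, lrNorm D μ q (f2 p q D μ ν x₀) ^ (1 - q / p) *
      (f2 p q D μ ν x₀ x₀ / phi p ν x₀) ^ ((q - 1) / p) := by
  have hp0 : 0 < p := by linarith
  have hq0 : 0 < q := by linarith
  have hb : 0 < (q - 1) / p := div_pos (by linarith) hp0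
  have ha : 0 ≤ q / p - 1 := by rw [sub_nonneg, le_div_iff₀ hp0]; linarith
  apply le_antisymm
  · refine iSup₂_le fun x₀ hx₀ => iSup_le fun hdom => ?_
    rcases eq_or_exists_coe hx₀.1 hx₀.2 with rfl | ⟨x, hx, rfl⟩
    · have hN := hdom.2.2.2 rfl
      have hNeq : lrNorm x₀ μ q (fun x => testFun p ν x₀ x *
          opIITilde p q x₀ μ ν x₀ (testFun p ν x₀) x) =
          lrNorm x₀ μ q (prim (fun y => vhat p ν y * tailPow p q x₀ μ (phi p ν) y)) := by
        refine eLpNorm_congr_ae ?_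
        filter_upwards [ae_restrict_mem (measurableSet_openInt _ _)] with x hx
        rw [opIITilde_self hx, testFun, cut_self_of_mem hx,
          ENNReal.mul_div_cancel (phi_pos hp hφ hx).ne' (hφ x hx).ne]
      have hInf : ⨅ x ∈ openInt 0 x₀, opIITilde p q x₀ μ ν x₀ (testFun p ν x₀) x =
          ⨅ x ∈ openInt 0 x₀,
            prim (fun y => vhat p ν y * tailPow p q x₀ μ (phi p ν) y) x / phi p ν x :=
        iInf_congr fun x => iInf_congr fun hx => opIITilde_self hx
      rw [hNeq] at hN ⊢
      rw [hInf]
      set N := lrNorm x₀ μ q (prim (fun y => vhat p ν y * tailPow p q x₀ μ (phi p ν) y)) with hNdef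
      have hN' := hN
      rw [hNdef, lrNorm_eq _ μ hq0, ENNReal.rpow_lt_top_iff_of_pos (by positivity)] at hN'
      simp only [enorm_eq_self] at hN'
      calc _ ≤ N ^ (1 - q / p) *
            (⨆ x ∈ openInt 0 x₀, f2 p q x₀ μ ν x x / phi p ν x) ^ ((q - 1) / p) :=
            mul_le_mul' le_rfl (ENNReal.rpow_le_rpow
              (iInf_prim_tailPow_le hp hpq hD hφ hN'.ne) hb.le)
        _ = ⨆ x ∈ openInt 0 x₀, N ^ (1 - q / p) *
            (f2 p q x₀ μ ν x x / phi p ν x) ^ ((q - 1) / p) := by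
          have : (⨆ x ∈ openInt 0 x₀, f2 p q x₀ μ ν x x / phi p ν x) ^ ((q - 1) / p) =
              ⨆ x ∈ openInt 0 x₀, (f2 p q x₀ μ ν x x / phi p ν x) ^ ((q - 1) / p) :=
            (ENNReal.orderIsoRpow _ hb).map_iSup₂ _
          rw [this]
          simp only [ENNReal.mul_iSup]
        _ ≤ _ := by
          refine iSup₂_mono fun x hx => mul_le_mul' ?_ le_rfl
          have hle : lrNorm x₀ μ q (f2 p q x₀ μ ν x) ≤ N := by
            rw [hNdef, lrNorm_eq _ μ hq0, lrNorm_eq _ μ hq0]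
            refine ENNReal.rpow_le_rpow (lintegral_mono fun z => ENNReal.rpow_le_rpow ?_ hq0.le)
              (by positivity)
            simp only [enorm_eq_self]
            exact f2_le_prim hp hpq hx z
          -- The exponent 1 - q/p is nonpositive, so the inequality between the norms is reversed.
          rw [← neg_sub (q / p) 1, ENNReal.rpow_neg, ENNReal.rpow_neg]
          exact ENNReal.inv_le_inv.2 (ENNReal.rpow_le_rpow hle ha)
    · rw [lrNorm_testFun_mul_opIITilde_coe hp hφ hx, iInf_opIITilde_coe hp hφ hx]
      exact le_iSup₂_of_le x hx le_rfl
  · refine iSup₂_le fun x hx => ?_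
    rw [← lrNorm_testFun_mul_opIITilde_coe hp hφ hx, ← iInf_opIITilde_coe hp hφ hx]
    refine le_iSup₂_of_le (x : EReal) ⟨(hx.1 : (0 : EReal) < x), hx.2.le⟩ ?_
    exact le_iSup_of_le (testFun_coe_mem_domTilde hp hφ hx) le_rfl

/-! ### The second lower bound -/

variable {p q : ℝ} {μ ν : Measure ℝ} {D : EReal}

/-- The lower bound for the optimal constant from one step of the operator `II`, with the measure
`μ` replaced by a smaller finite measure `κ`. -/
theorem rpow_mul_rpow_le_optConst (hp : 1 < p) (hpq : p ≤ q) [SigmaFinite ν] (hD : 0 < D)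
    (hφ : ∀ x ∈ openInt 0 D, phi p ν x < ∞) {κ : Measure ℝ} [IsFiniteMeasure κ]
    (hκ : κ ≤ μ.restrict (openInt 0 D)) {x₀ : ℝ} (hx₀ : x₀ ∈ openInt 0 D) {e : ℝ → ℝ≥0∞}
    (he : e = prim fun y => vhat p ν y *
      (∫⁻ z in Ioi y, phi p ν (min z x₀) ^ (q - 1) ∂κ) ^ (pStar p - 1)) :
    ((∫⁻ z, e (min z x₀) ^ q ∂κ) ^ (1 / q)) ^ (1 - q / p) *
      (e x₀ / phi p ν x₀) ^ ((q - 1) / p) ≤ optConst p q D μ ν := by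
  have hp0 : 0 < p := by linarith
  have hq0 : 0 < q := by linarith
  have hq1 : 0 < q - 1 := by linarith
  have hps := pStar_sub_one_pos hp
  -- In other words h^p = T^{p*} = h T, which makes the energy of the test function linear in the
  -- tail T and opens the way to Tonelli's theorem.
  have hps' : (pStar p - 1) * p = (pStar p - 1) + 1 := by
    rw [pStar_sub_one hp]
    have hp1 : p - 1 ≠ 0 := by linarith
    field_simp; ring
  have hx₀' := (mem_openInt_zero.1 hx₀).1
  have hψ : Measurable fun z => phi p ν (min z x₀) ^ (q - 1) :=
    (measurable_phi.comp (measurable_id.min measurable_const)).pow_const _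
  set T : ℝ → ℝ≥0∞ := fun y => ∫⁻ z in Ioi y, phi p ν (min z x₀) ^ (q - 1) ∂κ with hT
  set h : ℝ → ℝ≥0∞ := fun y => T y ^ (pStar p - 1) with hh
  replace he : e = prim fun y => vhat p ν y * h y := he
  have hTa : Antitone T := fun x y hxy => lintegral_mono_set (Ioi_subset_Ioi hxy)
  have hha : Antitone h := fun x y hxy => ENNReal.rpow_le_rpow (hTa hxy) hps.le
  have hκI : ∀ᵐ z ∂κ, z ∈ openInt 0 D :=
    (Measure.absolutelyContinuous_of_le hκ).ae_le (ae_restrict_mem (measurableSet_openInt _ _))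
  set C : ℝ≥0∞ := (phi p ν x₀ ^ (q - 1) * κ univ) ^ (pStar p - 1) with hC
  have hCt : C ≠ ∞ := ENNReal.rpow_ne_top_of_nonneg hps.le (ENNReal.mul_ne_top
    (ENNReal.rpow_ne_top_of_nonneg hq1.le (hφ x₀ hx₀).ne) (measure_ne_top _ _))
  have hhC : ∀ y, h y ≤ C := fun y => by
    refine ENNReal.rpow_le_rpow ?_ hps.le
    rw [← lintegral_const]
    exact (setLIntegral_le_lintegral _ _).trans (lintegral_mono fun z =>
      ENNReal.rpow_le_rpow (phi_mono (min_le_right _ _)) hq1.le)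
  have hgm : Measurable fun y => vhat p ν y * h y := measurable_vhat.mul hha.measurable
  set g : ℝ → ℝ≥0∞ := (Ioc 0 x₀).indicator fun y => vhat p ν y * h y with hg
  have hgprim : ∀ x, prim g x = e (min x x₀) := fun x => by rw [hg, prim_indicator_Ioc, he]
  have hint : ∫⁻ y, g y ≠ ∞ := by
    rw [hg, lintegral_indicator measurableSet_Ioc]
    refine ne_top_of_le_ne_top (ENNReal.mul_ne_top (hφ x₀ hx₀).ne hCt) ?_
    rw [phi, ← lintegral_mul_const _ measurable_vhat]
    exact lintegral_mono fun y => mul_le_mul' le_rfl (hhC y)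
  have hZeq : ∫⁻ y in openInt 0 D, g y ^ p * dens ν y = ∫⁻ y in Ioc 0 x₀, vhat p ν y * h y ^ p := by
    rw [← inter_eq_left.2 (Ioc_subset_openInt hx₀), ← Measure.restrict_restrict measurableSet_Ioc,
      ← lintegral_indicator measurableSet_Ioc]
    refine lintegral_congr_ae ?_
    filter_upwards [ae_vhat_rpow_mul_dens hp hD hφ] with y hy
    by_cases hyI : y ∈ Ioc 0 x₀
    · rw [hg, indicator_of_mem hyI, indicator_of_mem hyI, ENNReal.mul_rpow_of_nonneg _ _ hp0.le,
        mul_right_comm, hy]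
    · rw [hg, indicator_of_notMem hyI, indicator_of_notMem hyI, ENNReal.zero_rpow_of_pos hp0,
        zero_mul]
  have hZt : ∫⁻ y in Ioc 0 x₀, vhat p ν y * h y ^ p ≠ ∞ := by
    refine ne_top_of_le_ne_top (ENNReal.mul_ne_top (hφ x₀ hx₀).ne
      (ENNReal.rpow_ne_top_of_nonneg hp0.le hCt)) ?_
    rw [phi, ← lintegral_mul_const _ measurable_vhat]
    exact lintegral_mono fun y => mul_le_mul' le_rfl (ENNReal.rpow_le_rpow (hhC y) hp0.le)
  have hA := le_optConst_mul (μ := μ) hp (by linarith : 1 < q) hD hφ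
    (hgm.indicator measurableSet_Ioc) hint (by rw [hZeq]; exact hZt)
  rw [hZeq] at hA
  set Z := ∫⁻ y in Ioc 0 x₀, vhat p ν y * h y ^ p with hZ
  set W := ∫⁻ z, e (min z x₀) ^ q ∂κ with hW
  set m := e x₀ / phi p ν x₀ with hm
  have hWA : W ^ (1 / q) ≤ optConst p q D μ ν * Z ^ (1 / p) := by
    refine le_trans (ENNReal.rpow_le_rpow ?_ (by positivity)) hA
    rw [hW]
    refine (lintegral_mono' hκ le_rfl).trans (le_of_eq (lintegral_congr fun z => ?_))
    rw [hgprim]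
  have hex₀ : e x₀ ≠ ∞ := by
    have := ne_top_of_le_ne_top hint (setLIntegral_le_lintegral (Ioc 0 x₀) g)
    have h2 := hgprim x₀
    rw [min_self] at h2
    rwa [← h2]
  have hemono : Monotone e := by rw [he]; exact prim_mono _
  have hφ0 := phi_pos hp hφ hx₀
  have hmt : m ≠ ∞ := (ENNReal.div_lt_top hex₀ hφ0.ne').ne
  -- The average of the decreasing function `h` over (0, z ∧ x₀] is at least the average over (0,
  -- x₀], which is m.
  have hme : ∀ z ∈ openInt 0 D, m * phi p ν (min z x₀) ≤ e (min z x₀) := by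
    intro z hz
    have hmin := min_mem_openInt hz hx₀
    have := prim_mul_prim_le (measurable_vhat (p := p) (ν := ν)) hha (mem_openInt_zero.1 hmin).1.le
      (min_le_right z x₀)
    rw [← he] at this
    rw [hm, mul_comm, ← mul_div_assoc]
    exact ENNReal.div_le_of_le_mul (by rw [mul_comm (e _)]; exact this)
  -- Expand one factor T as an integral against κ and interchange; integrating v̂ h over y < z
  -- rebuilds e(z ∧ x₀).
  have hZle : Z ≤ ∫⁻ z, phi p ν (min z x₀) ^ (q - 1) * e (min z x₀) ∂κ := by
    calc Z = ∫⁻ y in Ioc 0 x₀, ∫⁻ z, vhat p ν y * h y *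
          (Ioi y).indicator (fun z => phi p ν (min z x₀) ^ (q - 1)) z ∂κ := by
          refine lintegral_congr fun y => ?_
          rw [lintegral_const_mul _ (hψ.indicator measurableSet_Ioi),
            lintegral_indicator measurableSet_Ioi, mul_assoc]
          congr 1
          simp only [hh]
          rw [← ENNReal.rpow_mul, hps', ENNReal.rpow_add_of_nonneg _ _ hps.le zero_le_one,
            ENNReal.rpow_one]
      _ = ∫⁻ z, (∫⁻ y in Ioc 0 x₀, vhat p ν y * h y *
          (Ioi y).indicator (fun z => phi p ν (min z x₀) ^ (q - 1)) z) ∂κ := by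
          refine lintegral_lintegral_swap (Measurable.aemeasurable ?_)
          refine (hgm.comp measurable_fst).mul ?_
          have : Function.uncurry (fun y z => (Ioi y).indicator
              (fun z => phi p ν (min z x₀) ^ (q - 1)) z) =
              {w : ℝ × ℝ | w.1 < w.2}.indicator (fun w => phi p ν (min w.2 x₀) ^ (q - 1)) := by
            ext w
            rfl
          change Measurable (Function.uncurry (fun y z => (Ioi y).indicator
              (fun z => phi p ν (min z x₀) ^ (q - 1)) z))
          rw [this]
          exact (hψ.comp measurable_snd).indicator (measurableSet_lt measurable_fst measurable_snd)
      _ ≤ _ := by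
          refine lintegral_mono fun z => ?_
          rw [mul_comm, he, prim, ← lintegral_mul_const _ hgm, min_comm, ← Ioc_inter_Iic,
            inter_comm, ← Measure.restrict_restrict measurableSet_Iic,
            ← lintegral_indicator measurableSet_Iic]
          refine lintegral_mono fun y => ?_
          by_cases hyz : y < z
          · rw [indicator_of_mem (show z ∈ Ioi y from hyz),
              indicator_of_mem (show y ∈ Iic z from hyz.le), min_comm]
          · rw [indicator_of_notMem (show z ∉ Ioi y from hyz), mul_zero]
            exact zero_le
  -- Each factor m φ is bounded by e, which converts φ^{q-1} e into e^q.
  have hmZ : m ^ (q - 1) * Z ≤ W := by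
    refine (mul_le_mul' le_rfl hZle).trans ?_
    rw [← lintegral_const_mul' _ _ (ENNReal.rpow_ne_top_of_nonneg hq1.le hmt)]
    refine lintegral_mono_ae ?_
    filter_upwards [hκI] with z hz
    rw [← mul_assoc, ← ENNReal.mul_rpow_of_nonneg _ _ hq1.le]
    calc _ ≤ e (min z x₀) ^ (q - 1) * e (min z x₀) :=
          mul_le_mul' (ENNReal.rpow_le_rpow (hme z hz) hq1.le) le_rfl
      _ = e (min z x₀) ^ q := by
          nth_rw 2 [← ENNReal.rpow_one (e (min z x₀))]
          rw [← ENNReal.rpow_add_of_nonneg _ _ hq1.le zero_le_one]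
          congr 1; ring
  have hWt : W ≠ ∞ := by
    refine ne_top_of_le_ne_top (ENNReal.mul_ne_top (ENNReal.rpow_ne_top_of_nonneg hq0.le hex₀)
      (measure_ne_top κ univ)) ?_
    rw [← lintegral_const]
    exact lintegral_mono fun z => ENNReal.rpow_le_rpow (hemono (min_le_right _ _)) hq0.le
  rw [← ENNReal.rpow_mul]
  rcases eq_or_ne W 0 with hW0 | hW0
  -- If W = 0 and m > 0, then e > 0 on (0, D) would force κ = 0, hence e = 0 and m = 0. So m = 0 in
  -- any case, and it absorbs the possibly infinite negative power of W.
  · have hm0 : m = 0 := by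
      by_contra hm0
      have hfalse : ∀ᵐ z ∂κ, False := by
        have := (lintegral_eq_zero_iff ((hemono.measurable.comp
          (measurable_id.min measurable_const)).pow_const q)).1 hW0
        filter_upwards [this, hκI] with z hz hzI
        have hez : e (min z x₀) = 0 := (ENNReal.rpow_eq_zero_iff_of_pos hq0).1 hz
        have := hme z hzI
        rw [hez, nonpos_iff_eq_zero, mul_eq_zero] at this
        exact this.elim hm0 (phi_pos hp hφ (min_mem_openInt hzI hx₀)).ne'
      rw [Filter.eventually_false_iff_eq_bot, ae_eq_bot] at hfalse
      refine hm0 ?_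
      rw [hm, he, prim]
      simp [hh, hT, hfalse, hps]
    rw [hm0, ENNReal.zero_rpow_of_pos (div_pos hq1 hp0), mul_zero]
    exact zero_le
  · have h1 : m ^ ((q - 1) / p) * W ^ (1 / q) ≤ optConst p q D μ ν * W ^ (1 / p) := by
      calc _ ≤ m ^ ((q - 1) / p) * (optConst p q D μ ν * Z ^ (1 / p)) := mul_le_mul' le_rfl hWA
        _ = optConst p q D μ ν * (m ^ (q - 1) * Z) ^ (1 / p) := by
            rw [ENNReal.mul_rpow_of_nonneg _ _ (by positivity), ← ENNReal.rpow_mul, mul_one_div]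
            ring
        _ ≤ _ := mul_le_mul' le_rfl (ENNReal.rpow_le_rpow hmZ (by positivity))
    have hWp0 : W ^ (1 / p) ≠ 0 := by
      rw [Ne, ENNReal.rpow_eq_zero_iff_of_pos (by positivity)]; exact hW0
    have hWpt : W ^ (1 / p) ≠ ∞ := ENNReal.rpow_ne_top_of_nonneg (by positivity) hWt
    rw [← ENNReal.div_le_iff hWp0 hWpt, mul_div_assoc, ← ENNReal.rpow_sub _ _ hW0 hWt] at h1
    have hexp : 1 / q * (1 - q / p) = 1 / q - 1 / p := by field_simp
    rwa [hexp, mul_comm]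

theorem measure_openInt_lt_top (hp : 1 < p) (hpq : p ≤ q) [SigmaFinite ν] (hD : 0 < D)
    (hφ : ∀ x ∈ openInt 0 D, phi p ν x < ∞) (hA : optConst p q D μ ν ≠ ∞) {x : ℝ}
    (hx : x ∈ openInt 0 D) : μ (openInt (x : EReal) D) < ∞ := by
  have hq0 : 0 < q := by linarith
  have hps : 0 < pStar p := by linarith [pStar_sub_one_pos hp]
  have hB := ((le_iSup₂_of_le x hx le_rfl).trans (constB_le_deltaBar (μ := μ) hp hpq hD hφ)).trans
    (deltaBar_le_optConst hp hpq hD hφ)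
  rw [lt_top_iff_ne_top]
  intro h
  rw [h, ENNReal.top_rpow_of_pos (by positivity), ENNReal.mul_top, top_le_iff] at hB
  · exact hA hB
  · rw [Ne, ENNReal.rpow_eq_zero_iff_of_pos (by positivity)]
    exact (phi_pos hp hφ hx).ne'

/-- A finite optimal constant bounds B, so `μ` is finite away from 0. The finite-measure estimate is
applied to `μ` cut off near 0, and the cut-off is then removed by monotone convergence in the
quotient only. -/
theorem deltaTilde_le_optConst (hp : 1 < p) (hpq : p ≤ q) [SigmaFinite ν] (hD : 0 < D)
    (hφ : ∀ x ∈ openInt 0 D, phi p ν x < ∞) : deltaTilde p q D μ ν ≤ optConst p q D μ ν := by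
  have hp0 : 0 < p := by linarith
  have hq0 : 0 < q := by linarith
  have hb : 0 < (q - 1) / p := div_pos (by linarith) hp0
  have ha : 0 ≤ q / p - 1 := by rw [sub_nonneg, le_div_iff₀ hp0]; linarith
  have hps := pStar_sub_one_pos hp
  rcases eq_or_ne (optConst p q D μ ν) ∞ with hA | hA
  · rw [hA]; exact le_top
  rw [deltaTilde_eq hp hpq hD hφ]
  refine iSup₂_le fun x₀ hx₀ => ?_
  have hx₀' := (mem_openInt_zero.1 hx₀).1
  set ε : ℕ → ℝ := fun k => x₀ / ((k : ℝ) + 1) with hε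
  have hε0 : ∀ k, 0 < ε k := fun k => by simp only [hε]; positivity
  have hεI : ∀ k, ε k ∈ openInt 0 D := fun k => mem_openInt_of_le hx₀ (hε0 k) (by
    simp only [hε]; exact div_le_self hx₀'.le (by linarith [(Nat.cast_nonneg k : (0 : ℝ) ≤ k)]))
  have hεanti : Antitone ε := fun i j hij => by simp only [hε]; gcongr
  have hεsmall : ∀ y > 0, ∃ k, ε k ≤ y := fun y hy => by
    obtain ⟨k, hk⟩ := exists_nat_gt (x₀ / y)
    refine ⟨k, ?_⟩
    rw [div_lt_iff₀ hy] at hk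
    simp only [hε]
    rw [div_le_iff₀ (by positivity)]
    nlinarith
  set h : ℕ → ℝ → ℝ≥0∞ := fun k y => (∫⁻ z in Ioi y, phi p ν (min z x₀) ^ (q - 1)
    ∂(μ.restrict (openInt (ε k : EReal) D))) ^ (pStar p - 1) with hh
  set e : ℕ → ℝ → ℝ≥0∞ := fun k => prim fun y => vhat p ν y * h k y with he
  have hhanti : ∀ k, Antitone (h k) := fun k x y hxy =>
    ENNReal.rpow_le_rpow (lintegral_mono_set (Ioi_subset_Ioi hxy)) hps.le
  have hsub : ∀ k y, Ioi y ∩ openInt (ε k : EReal) D ⊆ openInt (y : EReal) D := fun k y z hz =>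
    mem_openInt_coe.2 ⟨hz.1, hz.2.2⟩
  have hh_le : ∀ k y, h k y ≤ tailPow p q D μ (fun z => phi p ν (min z x₀)) y := fun k y => by
    refine ENNReal.rpow_le_rpow ?_ hps.le
    rw [Measure.restrict_restrict measurableSet_Ioi]
    exact lintegral_mono_set (hsub k y)
  have hh_eq : ∀ k y, ε k ≤ y → h k y = tailPow p q D μ (fun z => phi p ν (min z x₀)) y := by
    intro k y hky
    simp only [hh, tailPow]
    rw [Measure.restrict_restrict measurableSet_Ioi, (hsub k y).antisymm fun z hz => ?_]
    have hz' := mem_openInt_coe.1 hz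
    exact ⟨hz'.1, mem_openInt_coe.2 ⟨lt_of_le_of_lt hky hz'.1, hz'.2⟩⟩
  have hhmono : Monotone h := fun i j hij y => by
    refine ENNReal.rpow_le_rpow (lintegral_mono' (Measure.restrict_mono le_rfl
      (Measure.restrict_mono (fun z hz => ?_) le_rfl)) le_rfl) hps.le
    exact ⟨lt_of_le_of_lt (EReal.coe_le_coe_iff.2 (hεanti hij)) hz.1, hz.2⟩
  have he_le : ∀ k x, e k (min x x₀) ≤ f2 p q D μ ν x₀ x := fun k x => by
    rw [f2_eq_prim hx₀]
    exact lintegral_mono fun y => mul_le_mul' le_rfl (hh_le k y)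
  have hsup : f2 p q D μ ν x₀ x₀ = ⨆ k, e k x₀ := by
    have hmeas : ∀ k, Measurable fun y => vhat p ν y * h k y := fun k =>
      measurable_vhat.mul (hhanti k).measurable
    rw [f2_eq_prim hx₀, min_self]
    simp only [he, prim]
    rw [← lintegral_iSup hmeas (fun i j hij y => mul_le_mul' le_rfl (hhmono hij y))]
    refine setLIntegral_congr_fun measurableSet_Ioc fun y hy => ?_
    obtain ⟨k, hk⟩ := hεsmall y hy.1
    refine le_antisymm (le_iSup_of_le k ?_) (iSup_le fun k => mul_le_mul' le_rfl (hh_le k y))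
    rw [hh_eq k y hk]
  have hkey : ∀ k, lrNorm D μ q (f2 p q D μ ν x₀) ^ (1 - q / p) *
      (e k x₀ / phi p ν x₀) ^ ((q - 1) / p) ≤ optConst p q D μ ν := by
    intro k
    have hfin : IsFiniteMeasure (μ.restrict (openInt (ε k : EReal) D)) :=
      ⟨by rw [Measure.restrict_apply_univ]; exact measure_openInt_lt_top hp hpq hD hφ hA (hεI k)⟩
    have hκ : μ.restrict (openInt (ε k : EReal) D) ≤ μ.restrict (openInt 0 D) :=
      Measure.restrict_mono (openInt_subset_openInt (hε0 k).le) le_rfl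
    -- Under a nonpositive exponent the norm of the cut-off function may be replaced at once by the
    -- larger norm of `f2`, so no limit is needed in that factor.
    refine le_trans (mul_le_mul' ?_ le_rfl) (rpow_mul_rpow_le_optConst hp hpq hD hφ hκ hx₀ rfl)
    rw [← neg_sub (q / p) 1, ENNReal.rpow_neg, ENNReal.rpow_neg, lrNorm_eq _ _ hq0]
    refine ENNReal.inv_le_inv.2 (ENNReal.rpow_le_rpow (ENNReal.rpow_le_rpow ?_ (by positivity)) ha)
    refine lintegral_mono' hκ fun z => ENNReal.rpow_le_rpow ?_ hq0.le
    rw [enorm_eq_self]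
    exact he_le k z
  have hpow : (f2 p q D μ ν x₀ x₀ / phi p ν x₀) ^ ((q - 1) / p) =
      ⨆ k, (e k x₀ / phi p ν x₀) ^ ((q - 1) / p) := by
    rw [hsup, ENNReal.iSup_div]
    exact (ENNReal.orderIsoRpow _ hb).map_iSup _
  rw [hpow, ENNReal.mul_iSup]
  exact iSup_le hkey

theorem delta_eq : delta p q D μ ν =
    (⨆ x ∈ openInt 0 D, 1 / phi p ν x ^ gammaStar q p *
      ∫⁻ y in Ioc 0 x, vhat p ν y *
        (∫⁻ z in openInt (y : EReal) D, phi p ν z ^ (q * gammaStar q p / pStar p) ∂μ)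
          ^ (pStar p / q)) ^ (1 / pStar p) := by
  have hexp : gammaStar q p * (q / pStar p) = q * gammaStar q p / pStar p := by ring
  simp only [delta, opIIStar, ← ENNReal.rpow_mul, hexp, one_div, ENNReal.div_eq_inv_mul]

end HardyType

/-! ### Assembly of the estimates -/

open HardyType in
theorem corollary2p3 (p q : ℝ) (hp : 1 < p) (hpq : p ≤ q) (D : EReal) (hD : 0 < D)
    (μ ν : Measure ℝ) [SigmaFinite ν]
    (hφ : ∀ x ∈ openInt 0 D, phi p ν x < ∞) :
    -- the chain of estimates
    (constB p q D μ ν ≤ max (deltaBar p q D μ ν) (deltaTilde p q D μ ν) ∧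
      max (deltaBar p q D μ ν) (deltaTilde p q D μ ν) ≤ optConst p q D μ ν ∧
      optConst p q D μ ν
        ≤ min (delta p q D μ ν) (ENNReal.ofReal (kConst q p) * constB p q D μ ν) ∧
      min (delta p q D μ ν) (ENNReal.ofReal (kConst q p) * constB p q D μ ν)
        ≤ delta p q D μ ν ∧
      delta p q D μ ν ≤ ENNReal.ofReal (kTilde q p) * constB p q D μ ν) ∧
    kConst q p ≤ kTilde q p ∧
    -- the upper bound
    (delta p q D μ ν =
        (⨆ x ∈ openInt 0 D, 1 / phi p ν x ^ gammaStar q p *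
          ∫⁻ y in Ioc 0 x, vhat p ν y *
            (∫⁻ z in openInt (y : EReal) D, phi p ν z ^ (q * gammaStar q p / pStar p) ∂μ)
              ^ (pStar p / q)) ^ (1 / pStar p)) ∧
    -- the first lower bound
    (deltaBar p q D μ ν =
        (⨆ x ∈ openInt 0 D,
          (1 / phi p ν x ^ (q / p) * (∫⁻ z in Ioc 0 x, phi p ν z ^ q ∂μ) +
            phi p ν x ^ (q / pStar p) * μ (openInt (x : EReal) D))) ^ (1 / q) ∧
      constB p q D μ ν ≤ deltaBar p q D μ ν) ∧
    -- the second lower bound, with `f2 p q D μ ν x₀ = f_1^{(x₀)} II~(f_1^{(x₀)})` on `(0, D)`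
    ((∀ x₀ ∈ openInt 0 D, ∀ x ∈ openInt 0 D,
        testFun p ν (x₀ : EReal) x * opIITilde p q D μ ν (x₀ : EReal) (testFun p ν (x₀ : EReal)) x
          = f2 p q D μ ν x₀ x) ∧
      deltaTilde p q D μ ν =
        ⨆ x₀ ∈ openInt 0 D, lrNorm D μ q (f2 p q D μ ν x₀) ^ (1 - q / p) *
          (f2 p q D μ ν x₀ x₀ / phi p ν x₀) ^ ((q - 1) / p)) := by
  have hB := constB_le_deltaBar (μ := μ) hp hpq hD hφ
  exact ⟨⟨hB.trans (le_max_left _ _),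
    max_le (deltaBar_le_optConst hp hpq hD hφ) (deltaTilde_le_optConst hp hpq hD hφ),
    le_min (optConst_le_delta hp hpq hD hφ) (optConst_le_kConst_mul hp hpq hD hφ),
    min_le_left _ _, delta_le hp hpq hφ⟩, kConst_le_kTilde hp hpq, delta_eq,
    ⟨deltaBar_eq hp hpq hD hφ, hB⟩,
    fun _ hx₀ _ hx => testFun_mul_opIITilde hp hφ hx₀ hx, deltaTilde_eq hp hpq hD hφ⟩
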